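/- **Lemma 2.2.** Let $L>0$ and let $S\subset\mathbb R^2$ (coordinates $x_2,x_3$) be a bounded, connected open set with Lipschitz boundary, $\mathcal L^2(S)=1$ and $\int_S x_2=\int_S x_3=\int_S x_2x_3=0$; put $\Omega=(0,L)\times S$. Let $W:\mathbb M^{3\times3}\to[0,+\infty]$ satisfy $W(RF)=W(F)$ for all $R\in SO(3)$ and $F\in\mathbb M^{3\times 3}$, $W=0$ on $SO(3)$, $W(F)\ge c\,\mathrm{dist}^2(F,SO(3))$ for some $c>0$ and all $F$, and let $W$ be (finite and) of class $C^2$ in a neighbourhood of $SO(3)$. Let $g\in L^2((0,L);\mathbb R^3)$ and $\tilde g(x_1)=\int_L^{x_1}g(t)\,dt$. Put $\mathcal L=D^2W(\mathrm{Id})$, $Q_3(F)=\mathcal LF:F$ and, for $A\in\mathbb M^{3\times3}_{skw}$, $$Q_1(A)=\min_{\alpha\in W^{1,2}(S;\mathbb R^3)}\int_S Q_3\big(x_2Ae_2+x_3Ae_3\,\big|\,\partial_2\alpha\,\big|\,\partial_3\alpha\big)\,dx_2dx_3 .$$ Let $\mathcal A$ be the set of triples $(y,d_2,d_3)\in W^{2,2}((0,L);\mathbb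 R^3)\times W^{1,2}((0,L);\mathbb R^3)\times W^{1,2}((0,L);\mathbb R^3)$ such that $R:=(y'|d_2|d_3)\in SO(3)$ a.e. in $(0,L)$, and for such triples let $$J_2(y,d_2,d_3)=\frac12\int_0^L Q_1(R^TR')\,dx_1-\int_0^L g\cdot y\,dx_1 .$$ A triple in $\mathcal A$ with $y(0)=0$, $d_k(0)=e_k$ ($k=2,3$) is called a stationary point of $J_2$ with respect to these boundary conditions (and natural boundary conditions at $x_1=L$) if $\frac{d}{d\varepsilon}J_2(\gamma(\varepsilon))\big|_{\varepsilon=0}=0$ for every curve $\gamma:[0,1]\to\mathcal A$ that starts at the triple, satisfies the same boundary conditions at $x_1=0$ for every $\varepsilon$, and is smooth with values in $W^{2,2}\times W^{1,2}\times W^{1,2}$. Let $(y,d_2,d_3)\in\mathcal A$ satisfy $y(0)=0$ and $d_k(0)=e_k$ for $k=2,3$, and put $R=(y'|d_2|d_3)$, $A=R^TR'$. For a.e. $x_1\in(0,L)$ let $\alpha(x_1,\cdot)\in W^{1,2}(S;\mathbb R^3)$ be the solution of the minimum problem defining $Q_1(A(x_1))$ for which $\alpha(x_1,\cdot)$, $\partial_2\alpha(x_1,\cdot)$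 and $\partial_3\alpha(x_1,\cdot)$ have zero mean on $S$. Let $$E=\mathcal L\big(x_2Ae_2+x_3Ae_3\,\big|\,\partial_2\alpha\,\big|\,\partial_3\alpha\big),\qquad \tilde E(x_1)=\int_S x_2E\,dx_2dx_3,\qquad \hat E(x_1)=\int_S x_3E\,dx_2dx_3 .$$ Then $(y,d_2,d_3)$ is a stationary point of $J_2$ with respect to the boundary conditions $y(0)=0$, $d_k(0)=e_k$ for $k=2,3$ (and natural boundary conditions at $x_1=L$) if and only if $\tilde E_{11}$, $\hat E_{11}$ and $\hat E_{21}-\tilde E_{31}$ belong to $W^{1,1}(0,L)$ and $$\begin{cases} \tilde E_{11}'=A_{13}(\hat E_{21}-\tilde E_{31})-A_{23}\hat E_{11}-R^T\tilde g\cdot e_2,\\ \hat E_{11}'=-A_{12}(\hat E_{21}-\tilde E_{31})+A_{23}\tilde E_{11}-R^T\tilde g\cdot e_3,\\ \hat E_{21}'-\tilde E_{31}'=A_{12}\hat E_{11}-A_{13}\tilde E_{11},\\ \tilde E_{11}(L)=\hat E_{11}(L)=0,\quad \hat E_{21}(L)-\tilde E_{31}(L)=0, \end{cases}$$ where the equations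 hold a.e. in $(0,L)$ and the values at $L$ are those of the continuous representatives. -/

import Mathlib

open MeasureTheory Set Matrix
open scoped ContDiff NNReal ENNReal

/- The (Frobenius) norm `|F|² = F : F` on `3 × 3` matrices. -/
attribute [local instance] Matrix.frobeniusNormedAddCommGroup Matrix.frobeniusNormedSpace

noncomputable section

namespace Rod

abbrev E2 := EuclideanSpace ℝ (Fin 2)
abbrev E3 := EuclideanSpace ℝ (Fin 3)
abbrev M3 := Matrix (Fin 3) (Fin 3) ℝ

/-- The set of proper rotations of `ℝ³`. -/
def SO3 : Set M3 := {R | R ∈ Matrix.specialOrthogonalGroup (Fin 3) ℝ}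

/-- The matrix `(a | b | c)` with columns `a`, `b`, `c`. -/
def cols (a b c : Fin 3 → ℝ) : M3 := (Matrix.of ![a, b, c])ᵀ

/-! ### Weak derivatives and Sobolev spaces -/

section Weak

set_option linter.unusedSectionVars false

variable {V : Type*} [NormedAddCommGroup V] [NormedSpace ℝ V] [MeasureSpace V]
variable {F : Type*} [NormedAddCommGroup F] [NormedSpace ℝ F]

/-- The Lebesgue space `L²(Ω; F)`. -/
abbrev L2 (Ω : Set V) (F : Type*) [NormedAddCommGroup F] := Lp F 2 (volume.restrict Ω)

/-- `w` is the distributional derivative in `Ω` of `u` in the direction `v`: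
`∫_Ω (∂_v φ) u = - ∫_Ω φ w` for every test function `φ ∈ C_c^∞(Ω)`. It is only used for functions
`u`, `w` that are integrable on `Ω`. -/
def HasWeakDeriv (Ω : Set V) (v : V) (u w : V → F) : Prop :=
  ∀ φ : V → ℝ, ContDiff ℝ ∞ φ → HasCompactSupport φ → tsupport φ ⊆ Ω →
    ∫ x in Ω, (fderiv ℝ φ x v) • u x = - ∫ x in Ω, φ x • w x

variable [BorelSpace V] [IsLocallyFiniteMeasure (volume : Measure V)]

lemma integrable_test {Ω : Set V} {ψ : V → ℝ} (hψ : Continuous ψ) (hs : HasCompactSupport ψ)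
    (u : L2 Ω F) : Integrable (fun x => ψ x • u x) (volume.restrict Ω) := by
  have h1 : MemLp ψ 2 (volume.restrict Ω) := hψ.memLp_of_hasCompactSupport hs
  have h2 : MemLp (fun x => ψ x • u x) 1 (volume.restrict Ω) := (Lp.memLp u).smul h1
  exact memLp_one_iff_integrable.1 h2

lemma integrable_test_deriv {Ω : Set V} {φ : V → ℝ} (hφ : ContDiff ℝ ∞ φ)
    (hs : HasCompactSupport φ) (v : V) (u : L2 Ω F) :
    Integrable (fun x => (fderiv ℝ φ x v) • u x) (volume.restrict Ω) :=
  integrable_test ((hφ.continuous_fderiv (by simp)).clm_apply continuous_const)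
    (hs.fderiv_apply ℝ v) u

lemma HasWeakDeriv.zero (Ω : Set V) (v : V) :
    HasWeakDeriv Ω v (⇑(0 : L2 Ω F)) (⇑(0 : L2 Ω F)) := by
  intro φ _ _ _
  have h : ⇑(0 : L2 Ω F) =ᵐ[volume.restrict Ω] 0 := Lp.coeFn_zero F 2 (volume.restrict Ω)
  have key : ∀ ψ : V → ℝ, ∫ x in Ω, ψ x • (0 : L2 Ω F) x = 0 := by
    intro ψ
    refine integral_eq_zero_of_ae ?_
    filter_upwards [h] with x hx
    rw [hx, Pi.zero_apply, smul_zero]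
  rw [key, key, neg_zero]

lemma HasWeakDeriv.add {Ω : Set V} {v : V} {u w u' w' : L2 Ω F}
    (h : HasWeakDeriv Ω v (⇑u) (⇑w)) (h' : HasWeakDeriv Ω v (⇑u') (⇑w')) :
    HasWeakDeriv Ω v (⇑(u + u')) (⇑(w + w')) := by
  intro φ hφ hs ht
  have e1 : ∫ x in Ω, (fderiv ℝ φ x v) • (u + u') x
      = ∫ x in Ω, ((fderiv ℝ φ x v) • u x + (fderiv ℝ φ x v) • u' x) := by
    refine integral_congr_ae ?_
    filter_upwards [Lp.coeFn_add u u'] with x hx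
    rw [hx, Pi.add_apply, smul_add]
  have e2 : ∫ x in Ω, φ x • (w + w') x = ∫ x in Ω, (φ x • w x + φ x • w' x) := by
    refine integral_congr_ae ?_
    filter_upwards [Lp.coeFn_add w w'] with x hx
    rw [hx, Pi.add_apply, smul_add]
  rw [e1, e2, integral_add (integrable_test_deriv hφ hs v u) (integrable_test_deriv hφ hs v u'),
    integral_add (integrable_test hφ.continuous hs w) (integrable_test hφ.continuous hs w'),
    h φ hφ hs ht, h' φ hφ hs ht, neg_add]

lemma HasWeakDeriv.smul {Ω : Set V} {v : V} (c : ℝ) {u w : L2 Ω F}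
    (h : HasWeakDeriv Ω v (⇑u) (⇑w)) : HasWeakDeriv Ω v (⇑(c • u)) (⇑(c • w)) := by
  intro φ hφ hs ht
  have e1 : ∫ x in Ω, (fderiv ℝ φ x v) • (c • u) x
      = ∫ x in Ω, c • ((fderiv ℝ φ x v) • u x) := by
    refine integral_congr_ae ?_
    filter_upwards [Lp.coeFn_smul c u] with x hx
    rw [hx, Pi.smul_apply, smul_comm]
  have e2 : ∫ x in Ω, φ x • (c • w) x = ∫ x in Ω, c • (φ x • w x) := by
    refine integral_congr_ae ?_
    filter_upwards [Lp.coeFn_smul c w] with x hx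
    rw [hx, Pi.smul_apply, smul_comm]
  rw [e1, e2, integral_smul, integral_smul, h φ hφ hs ht, smul_neg]

end Weak

/-- `W^{1,2}((0,L); ℝ³)`: pairs `(u, u')` in `L² × L²` such that `u'` is the weak derivative of
`u`, with the norm (equivalent to the usual one) induced by `L² × L²`. -/
def W12 (L : ℝ) : Submodule ℝ (L2 (Ioo 0 L) E3 × L2 (Ioo 0 L) E3) where
  carrier := {p | HasWeakDeriv (Ioo 0 L) (1 : ℝ) (⇑p.1) (⇑p.2)}
  zero_mem' := HasWeakDeriv.zero _ _
  add_mem' := fun h h' => HasWeakDeriv.add h h'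
  smul_mem' := fun c _ h => HasWeakDeriv.smul c h

/-- `W^{2,2}((0,L); ℝ³)`: pairs `(u, p)` in `W^{1,2} × W^{1,2}` such that `u' = p`, with the norm
(equivalent to the usual one) induced by `W^{1,2} × W^{1,2}`. -/
def W22 (L : ℝ) : Submodule ℝ (W12 L × W12 L) where
  carrier := {q | q.1.1.2 = q.2.1.1}
  zero_mem' := rfl
  add_mem' := fun {a b} (h : a.1.1.2 = a.2.1.1) (h' : b.1.1.2 = b.2.1.1) => by
    change a.1.1.2 + b.1.1.2 = a.2.1.1 + b.2.1.1
    rw [h, h']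
  smul_mem' := fun c {a} (h : a.1.1.2 = a.2.1.1) => by
    change c • a.1.1.2 = c • a.2.1.1
    rw [h]

/-- `W^{1,2}(S; ℝ³)` for `S ⊆ ℝ²`: triples `(α, ∂₂α, ∂₃α)` in `L²(S; ℝ³)`. The coordinates in `ℝ²`
are called `x₂, x₃`; they are `x 0` and `x 1`. -/
def W12S (S : Set E2) : Submodule ℝ (L2 S E3 × L2 S E3 × L2 S E3) where
  carrier := {p | HasWeakDeriv S (EuclideanSpace.single 0 (1 : ℝ)) (⇑p.1) (⇑p.2.1) ∧
    HasWeakDeriv S (EuclideanSpace.single 1 (1 : ℝ)) (⇑p.1) (⇑p.2.2)}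
  zero_mem' := ⟨HasWeakDeriv.zero _ _, HasWeakDeriv.zero _ _⟩
  add_mem' := fun h h' => ⟨HasWeakDeriv.add h.1 h'.1, HasWeakDeriv.add h.2 h'.2⟩
  smul_mem' := fun c _ h => ⟨HasWeakDeriv.smul c h.1, HasWeakDeriv.smul c h.2⟩

/-- The value at `t ∈ [0,L]` of the continuous representative of `u : (0,L) → F` exists and is
`a`. -/
def HasValueAt {F : Type*} [TopologicalSpace F] (L : ℝ) (u : ℝ → F) (t : ℝ) (a : F) : Prop :=
  ∃ c : ℝ → F, ContinuousOn c (Icc 0 L) ∧ u =ᵐ[volume.restrict (Ioo 0 L)] c ∧ c t = a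

/-- `u ∈ W^{1,1}(0,L)`, `u' = f` a.e. in `(0,L)`, and `u(L) = 0`. -/
def SolvesWithZeroEnd (L : ℝ) (u f : ℝ → ℝ) : Prop :=
  IntegrableOn u (Ioo 0 L) ∧ IntegrableOn f (Ioo 0 L) ∧
    HasWeakDeriv (Ioo 0 L) (1 : ℝ) u f ∧ HasValueAt L u L 0

/-! ### The cross-section and the stored-energy density -/

/-- Near each boundary point, in suitable Cartesian coordinates, `S` is the open set above the
graph of a Lipschitz function. -/
def HasLipschitzBoundary (S : Set E2) : Prop :=
  ∀ p ∈ frontier S, ∃ (Φ : E2 ≃ₗᵢ[ℝ] E2) (f : ℝ → ℝ) (K : ℝ≥0) (r : ℝ),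
    0 < r ∧ LipschitzWith K f ∧ ∀ x ∈ Metric.ball p r, (x ∈ S ↔ f (Φ x 0) < Φ x 1)

/-- The standing assumptions on the cross-section of the rod. -/
structure IsCrossSection (S : Set E2) : Prop where
  isOpen : IsOpen S
  isConnected : IsConnected S
  isBounded : Bornology.IsBounded S
  lipschitz : HasLipschitzBoundary S
  area : volume S = 1
  centroid₂ : ∫ x in S, x 0 = 0
  centroid₃ : ∫ x in S, x 1 = 0
  product : ∫ x in S, x 0 * x 1 = 0

/-- The standing assumptions on the stored-energy density `W : M^{3×3} → [0,∞]`. -/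
structure IsEnergyDensity (W : M3 → ℝ≥0∞) : Prop where
  frame_indifferent : ∀ R ∈ SO3, ∀ F : M3, W (R * F) = W F
  zero_on_SO3 : ∀ R ∈ SO3, W R = 0
  coercive : ∃ c : ℝ, 0 < c ∧ ∀ F : M3, ENNReal.ofReal (c * Metric.infDist F SO3 ^ 2) ≤ W F
  smooth : ∃ U : Set M3, IsOpen U ∧ SO3 ⊆ U ∧ (∀ F ∈ U, W F ≠ ⊤) ∧
    ContDiffOn ℝ 2 (fun F => (W F).toReal) U

/-- The linear map `𝓛 = D²W(Id)` on `M^{3×3}`: the matrix `𝓛 F` is determined by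
`𝓛 F : G = D²W(Id)[F, G]`. -/
def elast (W : M3 → ℝ≥0∞) (F : M3) : M3 :=
  Matrix.of fun i j =>
    fderiv ℝ (fderiv ℝ (fun G : M3 => (W G).toReal)) 1 F (Matrix.single i j 1)

/-- The quadratic form `Q₃(F) = 𝓛 F : F`. -/
def Q3 (W : M3 → ℝ≥0∞) (F : M3) : ℝ := ∑ i, ∑ j, elast W F i j * F i j

/-- The matrix field `(x₂ A e₂ + x₃ A e₃ | ∂₂α | ∂₃α)` on `S`. -/
def strain {S : Set E2} (A : M3) (α : W12S S) (x : E2) : M3 :=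
  cols (fun i => x 0 * A i 1 + x 1 * A i 2) (α.1.2.1 x).ofLp (α.1.2.2 x).ofLp

/-- The functional `F_A(α) = ∫_S Q₃(x₂ A e₂ + x₃ A e₃ | ∂₂α | ∂₃α)`. -/
def crossEnergy {S : Set E2} (W : M3 → ℝ≥0∞) (A : M3) (α : W12S S) : ℝ :=
  ∫ x in S, Q3 W (strain A α x)

/-- `Q₁(A) = min F_A` over `W^{1,2}(S; ℝ³)`. -/
def Q1 (S : Set E2) (W : M3 → ℝ≥0∞) (A : M3) : ℝ :=
  sInf (range fun α : W12S S => crossEnergy W A α)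

/-- The class `𝓑` of all `α` such that `α`, `∂₂α` and `∂₃α` have zero mean. -/
def classB (S : Set E2) : Set (W12S S) :=
  {α | ∫ x in S, α.1.1 x = 0 ∧ ∫ x in S, α.1.2.1 x = 0 ∧ ∫ x in S, α.1.2.2 x = 0}

/-- `α ∈ 𝓑` solves the minimum problem that defines `Q₁(A)`. -/
def IsWarping {S : Set E2} (W : M3 → ℝ≥0∞) (A : M3) (α : W12S S) : Prop :=
  α ∈ classB S ∧ ∀ β : W12S S, crossEnergy W A α ≤ crossEnergy W A β

/-! ### The limit functional -/

/-- Triples `(y, d₂, d₃)` in `W^{2,2} × W^{1,2} × W^{1,2}` on `(0,L)`. -/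
abbrev Config (L : ℝ) := W22 L × W12 L × W12 L

variable {L : ℝ}

/-- The deformation `y` of the mid-fiber. -/
def midFiber (q : Config L) : ℝ → E3 := q.1.1.1.1.1

/-- `R = (y' | d₂ | d₃)`. -/
def rot (q : Config L) (t : ℝ) : M3 :=
  cols (q.1.1.2.1.1 t).ofLp (q.2.1.1.1 t).ofLp (q.2.2.1.1 t).ofLp

/-- `R' = (y'' | d₂' | d₃')`. -/
def rotDeriv (q : Config L) (t : ℝ) : M3 :=
  cols (q.1.1.2.1.2 t).ofLp (q.2.1.1.2 t).ofLp (q.2.2.1.2 t).ofLp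

/-- `A = Rᵀ R'`. -/
def curv (q : Config L) (t : ℝ) : M3 := (rot q t)ᵀ * rotDeriv q t

/-- The class `𝓐`: `R ∈ SO(3)` a.e. in `(0,L)`. -/
def classA (L : ℝ) : Set (Config L) :=
  {q | ∀ᵐ t ∂(volume.restrict (Ioo 0 L)), rot q t ∈ SO3}

/-- The boundary conditions `y(0) = 0`, `d₂(0) = e₂`, `d₃(0) = e₃`. -/
def IsClamped (q : Config L) : Prop :=
  HasValueAt L (midFiber q) 0 0 ∧
    HasValueAt L (⇑q.2.1.1.1) 0 (EuclideanSpace.single 1 (1 : ℝ)) ∧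
    HasValueAt L (⇑q.2.2.1.1) 0 (EuclideanSpace.single 2 (1 : ℝ))

/-- `J₂(y,d₂,d₃) = ½ ∫₀ᴸ Q₁(RᵀR') - ∫₀ᴸ g · y`. Only its (finite) values on the class `𝓐` are
used. -/
def J2 (S : Set E2) (W : M3 → ℝ≥0∞) (g : ℝ → E3) (q : Config L) : ℝ :=
  1 / 2 * (∫ t in Ioo 0 L, Q1 S W (curv q t)) - ∫ t in Ioo 0 L, inner ℝ (g t) (midFiber q t)

/-- `q` is a stationary point of `J₂` with respect to the boundary conditions at `0` (and natural
boundary conditions at `L`): along every smooth curve `γ : [0,1] → 𝓐`, smooth as a curve in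
`W^{2,2} × W^{1,2} × W^{1,2}`, that starts at `q` and satisfies the boundary conditions at `0`,
the derivative of `J₂ ∘ γ` at `0` is zero. -/
def IsStationaryPoint (S : Set E2) (W : M3 → ℝ≥0∞) (g : ℝ → E3) (q : Config L) : Prop :=
  ∀ γ : ℝ → Config L, ContDiffOn ℝ ∞ γ (Icc 0 1) →
    (∀ ε ∈ Icc (0 : ℝ) 1, γ ε ∈ classA L ∧ IsClamped (γ ε)) → γ 0 = q →
    HasDerivWithinAt (fun ε => J2 S W g (γ ε)) 0 (Icc 0 1) 0

/-- The stress `E = 𝓛(x₂ A e₂ + x₃ A e₃ | ∂₂α | ∂₃α)`. -/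
def stress {S : Set E2} (W : M3 → ℝ≥0∞) (A : M3) (α : W12S S) (x : E2) : M3 :=
  elast W (strain A α x)

/-- The bending moment `Ẽ(t) = ∫_S x₂ E(t, ·)`. -/
def momentTilde {S : Set E2} (W : M3 → ℝ≥0∞) (q : Config L) (α : ℝ → W12S S) (t : ℝ) : M3 :=
  Matrix.of fun i j => ∫ x in S, x 0 * stress W (curv q t) (α t) x i j

/-- The bending moment `Ê(t) = ∫_S x₃ E(t, ·)`. -/
def momentHat {S : Set E2} (W : M3 → ℝ≥0∞) (q : Config L) (α : ℝ → W12S S) (t : ℝ) : M3 :=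
  Matrix.of fun i j => ∫ x in S, x 1 * stress W (curv q t) (α t) x i j

/-- `g̃(t) = ∫_L^t g`. -/
def primitive (L : ℝ) (g : ℝ → E3) (t : ℝ) : E3 := ∫ s in L..t, g s

/-- The system of Euler–Lagrange equations for the moments `Et = Ẽ`, `Eh = Ê`, with its conditions
at `L`, where `G = Rᵀ g̃`. The entry `11` of a matrix `M` is `M 0 0`, and so on. -/
def EulerLagrangeSystem (L : ℝ) (A Et Eh : ℝ → M3) (G : ℝ → Fin 3 → ℝ) : Prop :=
  SolvesWithZeroEnd L (fun t => Et t 0 0)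
    (fun t => A t 0 2 * (Eh t 1 0 - Et t 2 0) - A t 1 2 * Eh t 0 0 - G t 1) ∧
  SolvesWithZeroEnd L (fun t => Eh t 0 0)
    (fun t => -(A t 0 1) * (Eh t 1 0 - Et t 2 0) + A t 1 2 * Et t 0 0 - G t 2) ∧
  SolvesWithZeroEnd L (fun t => Eh t 1 0 - Et t 2 0)
    (fun t => A t 0 1 * Eh t 0 0 - A t 0 2 * Et t 0 0)

end Rod

end

open Rod

/-! Write an admissible variation of the frame as Ṙ = R B. Differentiating RᵀR = Id shows that B is
skew, and the boundary conditions make the variations of y, d₂ and d₃ vanish at x₁ = 0. The three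
functions β = B₁₂, B₁₃, B₂₃ then describe the whole variation and vanish at 0. The proof computes
the derivative of J₂ in terms of them.

The elastic part rests on Q₁ being the partial minimum of a nonnegative quadratic form in (A, α). If
α minimizes at A, the first-order condition makes the terms in the variation of α disappear, and
Q₁(A + H) lies between Q₁(A) + 2m(H) and Q₁(A) + 2m(H) + C|H|², where m(H) is the work of the
moments Ẽ, Ê on H (`le_Q1_add`, `exists_Q1_bound`). No minimizer at A + H is needed. Integrating
this bracket in x₁ gives differentiability of the energy on L² fields, and A = RᵀR' depends on the
configuration through a bounded bilinear map W^{1,2} × L² → L², so `hasDerivWithinAt_J2` follows by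
the chain rule. The minimizers α(x₁, ·) are not assumed measurable in x₁; measurability of the
moments comes from difference quotients of Q₁ (`memLp_momentWork`).

Next, Ȧ = B' + BᵀA - AᵀB (`curvVar_eq`). Because g̃(L) = 0 and ẏ(0) = 0, the load term integrates by
parts into a pairing of Rᵀg̃ with B e₁ (`integral_load`). Skewness leaves only the entries (1,2),
(1,3), (2,3), encoded by `![0, 0, 1]` and `![1, 2, 2]`, and the first variation becomes the sum over
these of ∫ (p β' + f β), with p the unknowns and f the right-hand sides of the system
(`firstVariation_eq`).

If p' = f and p(L) = 0, each integral vanishes, since β(0) = 0. Conversely, rotating R in one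
coordinate plane by the angle 2 arctan(ε φ), with φ smooth and φ(0) = 0, gives a smooth admissible
curve for which one β equals 2φ and the other two vanish (`frameVar_planeCurve`). Stationarity
therefore separates into three weak equations; compactly supported φ give the differential
equations, and φ(t) = t gives the natural boundary conditions (`solvesWithZeroEnd_of_forall`). -/

namespace Rod

/-! ### Primitives of integrable functions on `(0,L)` -/

section Primitive

set_option linter.unusedSectionVars false

variable {F : Type*} [NormedAddCommGroup F] [NormedSpace ℝ F]
variable {G : Type*} [NormedAddCommGroup G] [NormedSpace ℝ G]
variable {L : ℝ}

/-- On `[0,L]` the function `c` is a primitive of the integrable function `w`. -/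
structure IsPrim (L : ℝ) (c w : ℝ → F) : Prop where
  integrableOn : IntegrableOn w (Ioo 0 L)
  eq_integral : ∀ t ∈ Icc 0 L, c t = c 0 + ∫ s in (0 : ℝ)..t, w s

lemma intervalIntegrable_of_integrableOn_Ioo {w : ℝ → F} (h : IntegrableOn w (Ioo 0 L)) {a b : ℝ}
    (ha : a ∈ Icc 0 L) (hb : b ∈ Icc 0 L) : IntervalIntegrable w volume a b := by
  have h0L : (0 : ℝ) ≤ L := ha.1.trans ha.2
  have h1 : IntervalIntegrable w volume 0 L := by
    rwa [intervalIntegrable_iff_integrableOn_Ioo_of_le h0L]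
  refine h1.mono_set ?_
  rw [uIcc_of_le h0L]
  exact uIcc_subset_Icc ha hb

lemma setIntegral_Ioo_eq_intervalIntegral (hL : 0 ≤ L) (w : ℝ → F) :
    ∫ t in Ioo 0 L, w t = ∫ t in (0 : ℝ)..L, w t := by
  rw [intervalIntegral.integral_of_le hL, integral_Ioc_eq_integral_Ioo]

namespace IsPrim

variable {c d w v : ℝ → F}

lemma intervalIntegrable (h : IsPrim L c w) {a b : ℝ} (ha : a ∈ Icc 0 L) (hb : b ∈ Icc 0 L) :
    IntervalIntegrable w volume a b :=
  intervalIntegrable_of_integrableOn_Ioo h.integrableOn ha hb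

lemma sub_eq (h : IsPrim L c w) {a b : ℝ} (ha : a ∈ Icc 0 L) (hb : b ∈ Icc 0 L) :
    c b - c a = ∫ s in a..b, w s := by
  have h0 : (0 : ℝ) ∈ Icc 0 L := ⟨le_rfl, ha.1.trans ha.2⟩
  rw [h.eq_integral a ha, h.eq_integral b hb, add_sub_add_left_eq_sub,
    intervalIntegral.integral_interval_sub_left (h.intervalIntegrable h0 hb)
      (h.intervalIntegrable h0 ha)]

lemma continuousOn (h : IsPrim L c w) : ContinuousOn c (Icc 0 L) := by
  rcases le_or_gt 0 L with hL | hL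
  · have h1 : ContinuousOn (fun t => c 0 + ∫ s in (0 : ℝ)..t, w s) (Icc 0 L) := by
      refine continuousOn_const.add ?_
      have := intervalIntegral.continuousOn_primitive_interval (μ := volume) (f := w)
        (a := 0) (b := L) ?_
      · rwa [uIcc_of_le hL] at this
      · rw [uIcc_of_le hL, integrableOn_Icc_iff_integrableOn_Ioo]
        exact h.integrableOn
    exact h1.congr h.eq_integral
  · rw [Icc_eq_empty (not_le.2 hL)]
    exact continuousOn_empty _

lemma aestronglyMeasurable (h : IsPrim L c w) :
    AEStronglyMeasurable c (volume.restrict (Ioo 0 L)) :=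
  (h.continuousOn.mono Ioo_subset_Icc_self).aestronglyMeasurable measurableSet_Ioo

lemma exists_bound (h : IsPrim L c w) : ∃ C, ∀ t ∈ Icc 0 L, ‖c t‖ ≤ C :=
  isCompact_Icc.exists_bound_of_continuousOn h.continuousOn

lemma fst_integrableOn (h : IsPrim L c w) : IntegrableOn c (Ioo 0 L) :=
  h.continuousOn.integrableOn_Icc.mono_set Ioo_subset_Icc_self

/-- Lebesgue differentiation. The integral formula for `c` is known only on `[0, L]`, which contains
a neighbourhood of each interior point. -/
lemma ae_hasDerivAt [CompleteSpace F] (h : IsPrim L c w) :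
    ∀ᵐ t ∂(volume.restrict (Ioo 0 L)), HasDerivAt c (w t) t := by
  rw [ae_restrict_iff' measurableSet_Ioo]
  rcases le_or_gt 0 L with hL | hL
  · have h1 := (h.intervalIntegrable (a := 0) (b := L) (by simp [hL])
      (by simp [hL])).ae_hasDerivAt_integral
    filter_upwards [h1] with t ht htm
    have h2 := (ht (by rw [uIcc_of_le hL]; exact Ioo_subset_Icc_self htm) 0
      (by simp)).const_add (c 0)
    refine h2.congr_of_eventuallyEq ?_
    filter_upwards [Ioo_mem_nhds htm.1 htm.2] with s hs
    exact h.eq_integral s (Ioo_subset_Icc_self hs)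
  · simp [Ioo_eq_empty (not_lt.2 hL.le)]

lemma ae_eq_of_eqOn [CompleteSpace F] (h : IsPrim L c w) (h' : IsPrim L d v)
    (hcd : EqOn c d (Ioo 0 L)) : w =ᵐ[volume.restrict (Ioo 0 L)] v := by
  filter_upwards [h.ae_hasDerivAt, h'.ae_hasDerivAt, ae_restrict_mem measurableSet_Ioo]
    with t h1 h2 ht
  refine h1.unique (h2.congr_of_eventuallyEq ?_)
  filter_upwards [Ioo_mem_nhds ht.1 ht.2] with s hs
  exact hcd hs

lemma congr_deriv (h : IsPrim L c w) (hwv : w =ᵐ[volume.restrict (Ioo 0 L)] v) :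
    IsPrim L c v := by
  refine ⟨h.integrableOn.congr hwv, fun t ht => ?_⟩
  rw [h.eq_integral t ht]
  congr 1
  refine intervalIntegral.integral_congr_ae ?_
  have h1 := (ae_restrict_iff' measurableSet_Ioo).1 hwv
  -- For `t = L` the integral runs over `(0, L]`, whose endpoint is not covered by the a.e. equality
  -- on `(0, L)`.
  have h2 : ∀ᵐ s : ℝ, s ≠ L := by
    simp [ae_iff]
  filter_upwards [h1, h2] with s hs hs' hm
  rw [uIoc_of_le ht.1] at hm
  exact hs ⟨hm.1, lt_of_le_of_ne (hm.2.trans ht.2) hs'⟩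

lemma add (h : IsPrim L c w) (h' : IsPrim L d v) :
    IsPrim L (fun t => c t + d t) (fun t => w t + v t) := by
  refine ⟨h.integrableOn.add h'.integrableOn, fun t ht => ?_⟩
  have h0 : (0 : ℝ) ∈ Icc 0 L := ⟨le_rfl, ht.1.trans ht.2⟩
  rw [intervalIntegral.integral_add (h.intervalIntegrable h0 ht) (h'.intervalIntegrable h0 ht),
    h.eq_integral t ht, h'.eq_integral t ht]
  abel

lemma sum {ι : Type*} (s : Finset ι) {c w : ι → ℝ → F} (h : ∀ i ∈ s, IsPrim L (c i) (w i)) :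
    IsPrim L (fun t => ∑ i ∈ s, c i t) (fun t => ∑ i ∈ s, w i t) := by
  classical
  induction s using Finset.induction_on with
  | empty => exact ⟨by simp, by simp⟩
  | insert i s hi ih =>
    simp only [Finset.sum_insert hi]
    exact (h i (by simp)).add (ih fun j hj => h j (by simp [hj]))

lemma const (a : F) : IsPrim L (fun _ => a) (fun _ => 0) :=
  ⟨integrableOn_zero, by simp⟩

lemma clm_comp [CompleteSpace F] [CompleteSpace G] (h : IsPrim L c w) (T : F →L[ℝ] G) :
    IsPrim L (fun t => T (c t)) (fun t => T (w t)) := by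
  refine ⟨T.integrable_comp h.integrableOn, fun t ht => ?_⟩
  have h0 : (0 : ℝ) ∈ Icc 0 L := ⟨le_rfl, ht.1.trans ht.2⟩
  rw [ContinuousLinearMap.intervalIntegral_comp_comm _ (h.intervalIntegrable h0 ht),
    h.eq_integral t ht, map_add]

end IsPrim

/-! ### Products of scalar primitives and integration by parts -/

namespace IsPrim

variable {c d w v : ℝ → ℝ}

lemma integrableOn_mul_left (h : IsPrim L c w) (hv : IntegrableOn v (Ioo 0 L)) :
    IntegrableOn (fun t => c t * v t) (Ioo 0 L) := by
  obtain ⟨C, hC⟩ := h.exists_bound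
  refine Integrable.bdd_mul (c := C) hv h.aestronglyMeasurable ?_
  filter_upwards [ae_restrict_mem measurableSet_Ioo] with t ht
  exact hC t (Ioo_subset_Icc_self ht)

/-- The product rule. -/
lemma mul (h : IsPrim L c w) (h' : IsPrim L d v) :
    IsPrim L (fun t => c t * d t) (fun t => w t * d t + c t * v t) := by
  refine ⟨?_, fun t ht => ?_⟩
  · refine Integrable.add ?_ (h.integrableOn_mul_left h'.integrableOn)
    exact (h'.integrableOn_mul_left h.integrableOn).congr_fun (fun t _ => mul_comm _ _)
      measurableSet_Ioo
  have h0 : (0 : ℝ) ∈ Icc 0 L := ⟨le_rfl, ht.1.trans ht.2⟩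
  have hL : 0 ≤ L := h0.2
  -- Nothing is known about `c` outside `[0, L]`, so it is replaced by the constant-plus-integral
  -- formula. This is absolutely continuous, and integration by parts on `[0, t]` is the product
  -- rule in integrated form.
  have key : ∀ {c w : ℝ → ℝ}, IsPrim L c w →
      AbsolutelyContinuousOnInterval (fun s => c 0 + ∫ r in (0 : ℝ)..s, w r) 0 t := by
    intro c w h
    exact (LipschitzWith.const (c 0)).lipschitzOnWith.absolutelyContinuousOnInterval.fun_add
      ((h.intervalIntegrable h0 ht).absolutelyContinuousOnInterval_intervalIntegral (by simp))
  have hd : ∀ {c w : ℝ → ℝ}, IsPrim L c w → ∀ᵐ s : ℝ, s ∈ uIoc 0 t →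
      deriv (fun s => c 0 + ∫ r in (0 : ℝ)..s, w r) s = w s := by
    intro c w h
    filter_upwards [(h.intervalIntegrable h0 ht).ae_hasDerivAt_integral] with s hs hst
    exact ((hs (uIoc_subset_uIcc hst) 0 (by simp)).const_add (c 0)).deriv
  have h1 := (key h).integral_deriv_mul_eq_sub (key h')
  simp only [intervalIntegral.integral_same, add_zero] at h1
  rw [← h.eq_integral t ht, ← h'.eq_integral t ht] at h1
  rw [← sub_eq_iff_eq_add', ← h1]
  refine intervalIntegral.integral_congr_ae ?_
  filter_upwards [hd h, hd h'] with s hs hs' hst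
  have hs0 : s ∈ Icc 0 L := by
    rw [uIoc_of_le ht.1] at hst
    exact ⟨hst.1.le, hst.2.trans ht.2⟩
  rw [hs hst, hs' hst, ← h.eq_integral s hs0, ← h'.eq_integral s hs0]

/-- Integration by parts. -/
lemma integral_mul (h : IsPrim L c w) (h' : IsPrim L d v) (hL : 0 ≤ L) :
    ∫ t in Ioo 0 L, (w t * d t + c t * v t) = c L * d L - c 0 * d 0 := by
  rw [setIntegral_Ioo_eq_intervalIntegral hL,
    ← (h.mul h').sub_eq ⟨le_rfl, hL⟩ ⟨hL, le_rfl⟩]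

end IsPrim

lemma isPrim_of_contDiff {φ : ℝ → ℝ} (hφ : ContDiff ℝ 1 φ) : IsPrim L φ (deriv φ) := by
  have hc : Continuous (deriv φ) := hφ.continuous_deriv le_rfl
  refine ⟨(hc.integrableOn_Icc).mono_set Ioo_subset_Icc_self, fun t _ => ?_⟩
  rw [intervalIntegral.integral_deriv_eq_sub (fun x _ => hφ.differentiable one_ne_zero x)
    (hc.intervalIntegrable _ _)]
  ring

end Primitive

end Rod

namespace Rod

/-! ### Weak derivatives on an interval -/

section WeakDerivative

set_option linter.unusedSectionVars false

variable {F : Type*} [NormedAddCommGroup F] [NormedSpace ℝ F] [CompleteSpace F]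
variable {L : ℝ}

lemma IsPrim.hasWeakDeriv_real {c w : ℝ → ℝ} (h : IsPrim L c w) (hL : 0 ≤ L) :
    HasWeakDeriv (Ioo 0 L) (1 : ℝ) c w := by
  intro φ hφ _ ht
  have h1 := (isPrim_of_contDiff (L := L) (hφ.of_le (by simp))).integral_mul h hL
  have h0 : ∀ x ∉ Ioo 0 L, φ x = 0 := fun x hx => image_eq_zero_of_notMem_tsupport fun h => hx (ht h)
  rw [h0 0 (by simp), h0 L (by simp), zero_mul, zero_mul, sub_zero, integral_add] at h1
  · simp only [fderiv_apply_one_eq_deriv, smul_eq_mul]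
    linarith
  · have := h.integrableOn_mul_left (v := deriv φ)
      (isPrim_of_contDiff (L := L) (hφ.of_le (by simp))).integrableOn
    exact this.congr_fun (fun t _ => mul_comm _ _) measurableSet_Ioo
  · exact (isPrim_of_contDiff (L := L) (hφ.of_le (by simp))).integrableOn_mul_left h.integrableOn

/-- A compactly supported smooth function with zero mean is the derivative of a compactly supported
smooth function. -/
lemma exists_primitive_of_integral_eq_zero {θ : ℝ → ℝ} (hθ : ContDiff ℝ ∞ θ)
    (hs : HasCompactSupport θ) (ht : tsupport θ ⊆ Ioo 0 L) (hI : ∫ t, θ t = 0) :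
    ∃ φ : ℝ → ℝ, ContDiff ℝ ∞ φ ∧ HasCompactSupport φ ∧ tsupport φ ⊆ Ioo 0 L ∧ deriv φ = θ := by
  rcases (tsupport θ).eq_empty_or_nonempty with he | hne
  · refine ⟨0, contDiff_const, HasCompactSupport.zero, by simp, ?_⟩
    rw [tsupport_eq_empty_iff] at he
    rw [he]; ext; simp
  obtain ⟨a, ha, hal⟩ := hs.isCompact.exists_isLeast hne
  obtain ⟨b, hb, hbl⟩ := hs.isCompact.exists_isGreatest hne
  have hz : ∀ t, t ∉ Icc a b → θ t = 0 := fun t h =>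
    image_eq_zero_of_notMem_tsupport fun h' => h ⟨hal h', hbl h'⟩
  have hd : ∀ t, HasDerivAt (fun t => ∫ s in a..t, θ s) (θ t) t := fun t =>
    intervalIntegral.integral_hasDerivAt_right (hθ.continuous.intervalIntegrable _ _)
      hθ.continuous.stronglyMeasurable.stronglyMeasurableAtFilter hθ.continuous.continuousAt
  have hderiv : deriv (fun t => ∫ s in a..t, θ s) = θ := funext fun t => (hd t).deriv
  have hsub : tsupport (fun t => ∫ s in a..t, θ s) ⊆ Icc a b := by
    refine closure_minimal (fun t h => ?_) isClosed_Icc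
    by_contra hn
    refine h ?_
    by_cases hta : t < a
    · refine intervalIntegral.integral_zero_ae (Filter.Eventually.of_forall fun s hs => ?_)
      rw [uIoc_comm, uIoc_of_le hta.le] at hs
      -- At the endpoint `a` itself `hz` gives nothing; there `θ` vanishes by continuity from the
      -- left.
      by_cases hsa : s = a
      · have := (hd a).continuousAt
        have h1 : ∀ r < a, θ r = 0 := fun r hr => hz r fun h => absurd h.1 (not_le.2 hr)
        have h2 : Filter.Tendsto θ (nhdsWithin a (Iio a)) (nhds (θ a)) :=
          hθ.continuous.continuousAt.mono_left nhdsWithin_le_nhds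
        have h3 : Filter.Tendsto θ (nhdsWithin a (Iio a)) (nhds 0) :=
          tendsto_const_nhds.congr' (by
            filter_upwards [self_mem_nhdsWithin] with r hr using (h1 r hr).symm)
        rw [hsa]
        exact tendsto_nhds_unique h2 h3
      · exact hz s fun h => hsa (le_antisymm hs.2 h.1)
    -- To the right of the support the primitive equals the total integral of `θ`, which is zero.
    · change ∫ s in a..t, θ s = 0
      have hbt : b < t := by
        by_contra h'
        exact hn ⟨not_lt.1 hta, not_lt.1 h'⟩
      have hat : a ≤ t := not_lt.1 hta
      rw [intervalIntegral.integral_of_le hat, ← integral_Icc_eq_integral_Ioc,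
        setIntegral_eq_integral_of_forall_compl_eq_zero, hI]
      intro s hs
      exact hz s fun h => hs ⟨h.1, h.2.trans hbt.le⟩
  refine ⟨fun t => ∫ s in a..t, θ s, ?_, ?_, ?_, hderiv⟩
  · rw [contDiff_infty_iff_deriv]
    exact ⟨fun t => (hd t).differentiableAt, by rwa [hderiv]⟩
  · exact isCompact_Icc.of_isClosed_subset (isClosed_tsupport _) hsub
  · exact hsub.trans fun t h => ⟨(ht ha).1.trans_le h.1, h.2.trans_lt (ht hb).2⟩

lemma exists_test_integral_eq_one (hL : 0 < L) :
    ∃ η : ℝ → ℝ, ContDiff ℝ ∞ η ∧ HasCompactSupport η ∧ tsupport η ⊆ Ioo 0 L ∧ ∫ t, η t = 1 := by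
  -- The outer radius `L / 4` keeps the support inside `[L/4, 3L/4]`.
  let f : ContDiffBump (L / 2) := ⟨L / 8, L / 4, by positivity, by linarith⟩
  refine ⟨f.normed volume, f.contDiff_normed, f.hasCompactSupport_normed, ?_, f.integral_normed⟩
  rw [f.tsupport_normed_eq, Real.closedBall_eq_Icc]
  intro t ht
  have h4 : f.rOut = L / 4 := rfl
  rw [h4] at ht
  exact ⟨by linarith [ht.1], by linarith [ht.2]⟩

/-- A function with vanishing weak derivative is constant. -/
lemma ae_eq_const_of_hasWeakDeriv_zero (hL : 0 < L) {v : ℝ → F} (hv : IntegrableOn v (Ioo 0 L))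
    (h : ∀ φ : ℝ → ℝ, ContDiff ℝ ∞ φ → HasCompactSupport φ → tsupport φ ⊆ Ioo 0 L →
      ∫ t in Ioo 0 L, deriv φ t • v t = 0) :
    ∃ k : F, v =ᵐ[volume.restrict (Ioo 0 L)] fun _ => k := by
  obtain ⟨η, hη, hηs, hηt, hη1⟩ := exists_test_integral_eq_one hL
  have hint : ∀ ψ : ℝ → ℝ, Continuous ψ → IntegrableOn (fun t => ψ t • v t) (Ioo 0 L) := by
    intro ψ hψ
    obtain ⟨C, hC⟩ := isCompact_Icc.exists_bound_of_continuousOn (hψ.continuousOn (s := Icc 0 L))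
    refine Integrable.bdd_smul (C := C) hv hψ.aestronglyMeasurable ?_
    filter_upwards [ae_restrict_mem measurableSet_Ioo] with t ht
    exact hC t (Ioo_subset_Icc_self ht)
  -- The constant is the mean of `v` with weight `η`. A test function `ψ` splits into `(∫ ψ) η` and
  -- a part of zero mean; the latter is the derivative of a test function, so `v` annihilates it.
  refine ⟨∫ t in Ioo 0 L, η t • v t, ?_⟩
  set k := ∫ t in Ioo 0 L, η t • v t
  have hk : IntegrableOn (fun t => v t - k) (Ioo 0 L) := hv.sub (by simp)
  have key := isOpen_Ioo.ae_eq_zero_of_integral_contDiff_smul_eq_zero (f := fun t => v t - k)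
    (U := Ioo 0 L) (μ := volume) hk.locallyIntegrableOn ?_
  · rw [Filter.EventuallyEq, ae_restrict_iff' measurableSet_Ioo]
    filter_upwards [key] with t ht htm
    exact sub_eq_zero.1 (ht htm)
  intro ψ hψ hψs hψt
  have hout : ∀ (χ : ℝ → ℝ), tsupport χ ⊆ Ioo 0 L → ∀ t, t ∉ Ioo 0 L → χ t = 0 :=
    fun χ hχ t ht => image_eq_zero_of_notMem_tsupport fun h => ht (hχ h)
  have hψI : ∫ t in Ioo 0 L, ψ t = ∫ t, ψ t :=
    setIntegral_eq_integral_of_forall_compl_eq_zero (hout ψ hψt)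
  rw [← setIntegral_eq_integral_of_forall_compl_eq_zero (s := Ioo 0 L)
    (fun t ht => by rw [hout ψ hψt t ht, zero_smul])]
  set a := ∫ t, ψ t
  have hθt : tsupport (fun t => ψ t - a * η t) ⊆ Ioo 0 L :=
    (tsupport_sub _ _).trans (union_subset hψt (tsupport_mul_subset_right.trans hηt))
  have hθI : ∫ t, (ψ t - a * η t) = 0 := by
    rw [integral_sub (hψ.continuous.integrable_of_hasCompactSupport hψs)
      ((hη.continuous.integrable_of_hasCompactSupport hηs).const_mul a), integral_const_mul, hη1,
      mul_one, sub_self]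
  obtain ⟨φ, hφ, hφs, hφt, hφd⟩ := exists_primitive_of_integral_eq_zero (L := L)
    (θ := fun t => ψ t - a * η t) (hψ.sub (contDiff_const.mul hη))
    (hψs.sub (hηs.mul_left)) hθt hθI
  have h1 := h φ hφ hφs hφt
  rw [hφd] at h1
  have h2 : ∫ t in Ioo 0 L, (ψ t - a * η t) • v t = (∫ t in Ioo 0 L, ψ t • v t) - a • k := by
    have h3 : IntegrableOn (fun t => a • η t • v t) (Ioo 0 L) := (hint η hη.continuous).smul a
    rw [← integral_smul, ← integral_sub (hint ψ hψ.continuous) h3]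
    refine integral_congr_ae (Filter.Eventually.of_forall fun t => ?_)
    simp only [sub_smul, mul_smul]
  rw [h2] at h1
  simp only [smul_sub]
  rw [integral_sub (hint ψ hψ.continuous), integral_smul_const, hψI, h1]
  exact (hψ.continuous.integrable_of_hasCompactSupport hψs).integrableOn.smul_const k

lemma integrableOn_deriv_smul {φ : ℝ → ℝ} (hφ : ContDiff ℝ ∞ φ) {u : ℝ → F}
    (hu : IntegrableOn u (Ioo 0 L)) : IntegrableOn (fun t => deriv φ t • u t) (Ioo 0 L) := by
  have hc : Continuous (deriv φ) := hφ.continuous_deriv (by simp)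
  obtain ⟨C, hC⟩ := isCompact_Icc.exists_bound_of_continuousOn (hc.continuousOn (s := Icc 0 L))
  refine Integrable.bdd_smul (C := C) hu hc.aestronglyMeasurable ?_
  filter_upwards [ae_restrict_mem measurableSet_Ioo] with t ht
  exact hC t (Ioo_subset_Icc_self ht)

/-- A function of class `W^{1,1}(0,L)` is a.e. equal to a primitive of its weak derivative. -/
lemma HasWeakDeriv.exists_isPrim_real (hL : 0 < L) {u w : ℝ → ℝ} (hu : IntegrableOn u (Ioo 0 L))
    (hw : IntegrableOn w (Ioo 0 L)) (h : HasWeakDeriv (Ioo 0 L) (1 : ℝ) u w) :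
    ∃ c, IsPrim L c w ∧ u =ᵐ[volume.restrict (Ioo 0 L)] c := by
  have hd : IsPrim L (fun t => ∫ s in (0 : ℝ)..t, w s) w := ⟨hw, fun t _ => by simp⟩
  obtain ⟨k, hk⟩ := ae_eq_const_of_hasWeakDeriv_zero hL
    (v := fun t => u t - ∫ s in (0 : ℝ)..t, w s) (hu.sub hd.fst_integrableOn) fun φ hφ hs ht => by
      have h1 := h φ hφ hs ht
      have h2 := hd.hasWeakDeriv_real hL.le φ hφ hs ht
      simp only [fderiv_apply_one_eq_deriv] at h1 h2
      simp only [smul_sub]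
      rw [integral_sub (integrableOn_deriv_smul hφ hu)
        (integrableOn_deriv_smul hφ hd.fst_integrableOn), h1, h2, sub_self]
  refine ⟨fun t => k + ∫ s in (0 : ℝ)..t, w s, ⟨hw, fun t _ => by simp⟩, ?_⟩
  filter_upwards [hk] with t ht
  rw [← ht]; ring

lemma eqOn_Icc_of_ae_eq {X : Type*} [TopologicalSpace X] [T2Space X] (hL : 0 < L) {c d : ℝ → X}
    (hc : ContinuousOn c (Icc 0 L)) (hd : ContinuousOn d (Icc 0 L))
    (h : c =ᵐ[volume.restrict (Ioo 0 L)] d) : EqOn c d (Icc 0 L) := by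
  have h1 : c =ᵐ[volume.restrict (Icc 0 L)] d := by
    rwa [← restrict_Ioo_eq_restrict_Icc]
  exact Measure.eqOn_Icc_of_ae_eq volume hL.ne h1 hc hd

end WeakDerivative

end Rod

namespace Rod

/-! ### The space `W^{1,2}((0,L); ℝ³)` -/

section Sobolev

variable {L : ℝ}

/-- Passage to coordinates, where the scalar product rule and the scalar theory of weak derivatives
apply. -/
lemma isPrim_iff_apply {c w : ℝ → E3} :
    IsPrim L c w ↔ ∀ i, IsPrim L (fun t => c t i) (fun t => w t i) := by
  refine ⟨fun h i => h.clm_comp (EuclideanSpace.proj i), fun h => ?_⟩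
  have hw : IntegrableOn w (Ioo 0 L) := by
    have h1 : Integrable (fun t => (w t).ofLp) (volume.restrict (Ioo 0 L)) :=
      Integrable.of_eval fun i => (h i).integrableOn
    exact ((PiLp.continuousLinearEquiv 2 ℝ (fun _ : Fin 3 => ℝ)).symm :
      (Fin 3 → ℝ) →L[ℝ] E3).integrable_comp h1
  refine ⟨hw, fun t ht => ?_⟩
  ext i
  have h0 : (0 : ℝ) ∈ Icc 0 L := ⟨le_rfl, ht.1.trans ht.2⟩
  have h1 := (EuclideanSpace.proj i : E3 →L[ℝ] ℝ).intervalIntegral_comp_comm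
    (intervalIntegrable_of_integrableOn_Ioo hw h0 ht)
  simp only [PiLp.proj_apply] at h1
  rw [PiLp.add_apply, ← h1]
  exact (h i).eq_integral t ht

lemma hasWeakDeriv_iff_apply {u w : ℝ → E3} (hu : IntegrableOn u (Ioo 0 L))
    (hw : IntegrableOn w (Ioo 0 L)) :
    HasWeakDeriv (Ioo 0 L) (1 : ℝ) u w ↔
      ∀ i, HasWeakDeriv (Ioo 0 L) (1 : ℝ) (fun t => u t i) (fun t => w t i) := by
  have hint : ∀ {φ : ℝ → ℝ} {f : ℝ → E3}, Continuous φ → IntegrableOn f (Ioo 0 L) →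
      Integrable (fun t => φ t • f t) (volume.restrict (Ioo 0 L)) := by
    intro φ f hφ hf
    obtain ⟨C, hC⟩ := isCompact_Icc.exists_bound_of_continuousOn (hφ.continuousOn (s := Icc 0 L))
    refine Integrable.bdd_smul (C := C) hf hφ.aestronglyMeasurable ?_
    filter_upwards [ae_restrict_mem measurableSet_Ioo] with t ht
    exact hC t (Ioo_subset_Icc_self ht)
  have hcomp : ∀ {φ : ℝ → ℝ} {f : ℝ → E3} (i : Fin 3), Continuous φ → IntegrableOn f (Ioo 0 L) →
      (∫ t in Ioo 0 L, φ t • f t) i = ∫ t in Ioo 0 L, φ t • f t i := by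
    intro φ f i hφ hf
    have := (EuclideanSpace.proj i : E3 →L[ℝ] ℝ).integral_comp_comm (hint hφ hf)
    simpa using this.symm
  have hc : ∀ {φ : ℝ → ℝ}, ContDiff ℝ ∞ φ → Continuous (fun x => fderiv ℝ φ x 1) := fun hφ =>
    (hφ.continuous_fderiv (by simp)).clm_apply continuous_const
  constructor
  · intro h i φ hφ hs ht
    have h1 := congrArg (fun v : E3 => v i) (h φ hφ hs ht)
    simp only [PiLp.neg_apply] at h1
    rwa [hcomp i (hc hφ) hu, hcomp i hφ.continuous hw] at h1
  · intro h φ hφ hs ht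
    ext i
    rw [PiLp.neg_apply, hcomp i (hc hφ) hu, hcomp i hφ.continuous hw]
    exact h i φ hφ hs ht

lemma L2.integrableOn {F : Type*} [NormedAddCommGroup F] (u : L2 (Ioo 0 L) F) :
    IntegrableOn u (Ioo 0 L) :=
  (Lp.memLp u).integrable one_le_two

lemma W12.exists_isPrim (hL : 0 < L) (U : W12 L) :
    ∃ c : ℝ → E3, IsPrim L c U.1.2 ∧ U.1.1 =ᵐ[volume.restrict (Ioo 0 L)] c := by
  have h := (hasWeakDeriv_iff_apply (L2.integrableOn _) (L2.integrableOn _)).1 U.2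
  have hi : ∀ i : Fin 3, ∃ c : ℝ → ℝ, IsPrim L c (fun t => U.1.2 t i) ∧
      (fun t => U.1.1 t i) =ᵐ[volume.restrict (Ioo 0 L)] c := fun i =>
    (h i).exists_isPrim_real hL
      ((EuclideanSpace.proj i : E3 →L[ℝ] ℝ).integrable_comp (L2.integrableOn U.1.1))
      ((EuclideanSpace.proj i : E3 →L[ℝ] ℝ).integrable_comp (L2.integrableOn U.1.2))
  choose c hc hu using hi
  refine ⟨fun t => WithLp.toLp 2 fun i => c i t, isPrim_iff_apply.2 hc, ?_⟩
  filter_upwards [ae_all_iff.2 hu] with t ht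
  ext i
  exact ht i

/-- The continuous representative. -/
noncomputable def W12.rep (hL : 0 < L) (U : W12 L) : ℝ → E3 := (W12.exists_isPrim hL U).choose

lemma W12.rep_isPrim (hL : 0 < L) (U : W12 L) : IsPrim L (W12.rep hL U) U.1.2 :=
  (W12.exists_isPrim hL U).choose_spec.1

lemma W12.ae_eq_rep (hL : 0 < L) (U : W12 L) :
    U.1.1 =ᵐ[volume.restrict (Ioo 0 L)] W12.rep hL U :=
  (W12.exists_isPrim hL U).choose_spec.2

lemma IsPrim.hasWeakDeriv {c w : ℝ → E3} (h : IsPrim L c w) (hL : 0 ≤ L) :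
    HasWeakDeriv (Ioo 0 L) (1 : ℝ) c w :=
  (hasWeakDeriv_iff_apply h.fst_integrableOn h.integrableOn).2 fun i =>
    (isPrim_iff_apply.1 h i).hasWeakDeriv_real hL

lemma HasWeakDeriv.congr {u u' w w' : ℝ → E3} (h : HasWeakDeriv (Ioo 0 L) (1 : ℝ) u w)
    (hu : u =ᵐ[volume.restrict (Ioo 0 L)] u') (hw : w =ᵐ[volume.restrict (Ioo 0 L)] w') :
    HasWeakDeriv (Ioo 0 L) (1 : ℝ) u' w' := by
  intro φ hφ hs ht
  have h1 := h φ hφ hs ht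
  have e1 : ∫ x in Ioo 0 L, (fderiv ℝ φ x) 1 • u x = ∫ x in Ioo 0 L, (fderiv ℝ φ x) 1 • u' x :=
    integral_congr_ae (hu.mono fun t ht => by simp only [ht])
  have e2 : ∫ x in Ioo 0 L, φ x • w x = ∫ x in Ioo 0 L, φ x • w' x :=
    integral_congr_ae (hw.mono fun t ht => by simp only [ht])
  rw [← e1, ← e2, h1]

/-- Hölder's inequality on a set of finite measure; the constant is the square root of the length.
-/
lemma exists_integral_norm_le (L : ℝ) :
    ∃ K : ℝ, 0 ≤ K ∧ ∀ u : L2 (Ioo 0 L) E3, ∫ t in Ioo 0 L, ‖u t‖ ≤ K * ‖u‖ := by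
  refine ⟨((volume.restrict (Ioo 0 L)) univ ^ (1 / (1 : ℝ≥0∞).toReal - 1 / (2 : ℝ≥0∞).toReal)).toReal,
    ENNReal.toReal_nonneg, fun u => ?_⟩
  have h := eLpNorm_le_eLpNorm_mul_rpow_measure_univ (p := 1) (q := 2) (one_le_two)
    (Lp.aestronglyMeasurable u)
  have h1 : ∫ t in Ioo 0 L, ‖u t‖ = (eLpNorm u 1 (volume.restrict (Ioo 0 L))).toReal := by
    rw [integral_norm_eq_lintegral_enorm (Lp.aestronglyMeasurable u), eLpNorm_one_eq_lintegral_enorm]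
  rw [h1, mul_comm, Lp.norm_def, ← ENNReal.toReal_mul]
  refine ENNReal.toReal_mono ?_ h
  refine ENNReal.mul_ne_top (Lp.memLp u).eLpNorm_ne_top (ENNReal.rpow_ne_top_of_nonneg ?_ ?_)
  · norm_num
  · simp

lemma norm_intervalIntegral_le {w : ℝ → E3} (hw : IntegrableOn w (Ioo 0 L)) {a b : ℝ}
    (ha : a ∈ Icc 0 L) (hb : b ∈ Icc 0 L) :
    ‖∫ s in a..b, w s‖ ≤ ∫ t in Ioo 0 L, ‖w t‖ := by
  refine (intervalIntegral.norm_integral_le_integral_norm_uIoc).trans ?_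
  rw [← integral_Ioc_eq_integral_Ioo]
  refine setIntegral_mono_set ?_ (Filter.Eventually.of_forall fun _ => norm_nonneg _) ?_
  · rw [integrableOn_Ioc_iff_integrableOn_Ioo]; exact hw.norm
  · refine (Ioc_subset_Ioc ?_ ?_).eventuallyLE
    · exact le_min ha.1 hb.1
    · exact max_le ha.2 hb.2

/-- The Sobolev embedding of `W^{1,2}(0,L)` into `L^∞(0,L)`. -/
lemma W12.exists_sup_bound (hL : 0 < L) :
    ∃ C : ℝ, 0 ≤ C ∧ ∀ U : W12 L, ∀ t ∈ Icc 0 L, ‖W12.rep hL U t‖ ≤ C * ‖U‖ := by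
  obtain ⟨K, hK0, hK⟩ := exists_integral_norm_le L
  refine ⟨K / L + K, by positivity, fun U t ht => ?_⟩
  have hp := W12.rep_isPrim hL U
  -- The value at `t` differs from the value at any `s` by at most the `L¹` norm of the derivative;
  -- averaging over `s` then brings in the `L¹` norm of the function.
  have h1 : ∀ s ∈ Ioo 0 L, ‖W12.rep hL U t‖ ≤ ‖W12.rep hL U s‖ + K * ‖U.1.2‖ := by
    intro s hs
    have h2 := hp.sub_eq (Ioo_subset_Icc_self hs) ht
    rw [sub_eq_iff_eq_add'] at h2
    rw [h2]
    refine (norm_add_le _ _).trans ?_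
    gcongr
    exact (norm_intervalIntegral_le hp.integrableOn (Ioo_subset_Icc_self hs) ht).trans (hK _)
  have h3 : ∫ s in Ioo 0 L, ‖W12.rep hL U t‖ ≤ ∫ s in Ioo 0 L, (‖W12.rep hL U s‖ + K * ‖U.1.2‖) :=
    setIntegral_mono_on (integrable_const _) (hp.fst_integrableOn.norm.add (integrable_const _))
      measurableSet_Ioo h1
  rw [integral_add hp.fst_integrableOn.norm (integrable_const _)] at h3
  simp only [integral_const, MeasurableSet.univ, measureReal_restrict_apply, univ_inter,
    Real.volume_real_Ioo, sub_zero, max_eq_left hL.le, smul_eq_mul] at h3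
  have h4 : ∫ s in Ioo 0 L, ‖W12.rep hL U s‖ ≤ K * ‖U.1.1‖ := by
    refine le_trans (le_of_eq ?_) (hK U.1.1)
    exact integral_congr_ae ((W12.ae_eq_rep hL U).mono fun s hs => by simp only [hs])
  have h5 : ‖U.1.1‖ ≤ ‖U‖ := norm_fst_le U.1
  have h6 : ‖U.1.2‖ ≤ ‖U‖ := norm_snd_le U.1
  have h7 : L * ‖W12.rep hL U t‖ ≤ K * ‖U‖ + L * (K * ‖U‖) := by
    refine h3.trans ?_
    gcongr
    exact h4.trans (by gcongr)
  have h8 : (K / L + K) * ‖U‖ = (K * ‖U‖ + L * (K * ‖U‖)) / L := by field_simp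
  rw [h8, le_div_iff₀ hL]
  linarith

lemma W12.exists_ae_bound (hL : 0 < L) :
    ∃ C : ℝ, 0 ≤ C ∧ ∀ U : W12 L, ∀ᵐ t ∂(volume.restrict (Ioo 0 L)), ‖U.1.1 t‖ ≤ C * ‖U‖ := by
  obtain ⟨C, hC, h⟩ := W12.exists_sup_bound hL
  refine ⟨C, hC, fun U => ?_⟩
  filter_upwards [W12.ae_eq_rep hL U, ae_restrict_mem measurableSet_Ioo] with t ht htm
  rw [ht]
  exact h U t (Ioo_subset_Icc_self htm)

lemma W12.memLp_inner (hL : 0 < L) (U : W12 L) (f : L2 (Ioo 0 L) E3) :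
    MemLp (fun t => inner ℝ (U.1.1 t) (f t)) 2 (volume.restrict (Ioo 0 L)) := by
  obtain ⟨C, hC, h⟩ := W12.exists_ae_bound hL
  refine (Lp.memLp f).of_le_mul (c := C * ‖U‖)
    ((Lp.aestronglyMeasurable _).inner (Lp.aestronglyMeasurable _)) ?_
  filter_upwards [h U] with t ht
  exact (norm_inner_le_norm _ _).trans (by gcongr)

/-- The product `U · f` of `U` in `W^{1,2}` and `f` in `L²`. -/
noncomputable def innerL2 (hL : 0 < L) (U : W12 L) (f : L2 (Ioo 0 L) E3) : L2 (Ioo 0 L) ℝ :=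
  (W12.memLp_inner hL U f).toLp _

lemma innerL2_ae (hL : 0 < L) (U : W12 L) (f : L2 (Ioo 0 L) E3) :
    innerL2 hL U f =ᵐ[volume.restrict (Ioo 0 L)] fun t => inner ℝ (U.1.1 t) (f t) :=
  (W12.memLp_inner hL U f).coeFn_toLp

lemma innerL2_add_left (hL : 0 < L) (U U' : W12 L) (f : L2 (Ioo 0 L) E3) :
    innerL2 hL (U + U') f = innerL2 hL U f + innerL2 hL U' f := by
  apply Lp.ext
  filter_upwards [innerL2_ae hL (U + U') f, innerL2_ae hL U f, innerL2_ae hL U' f,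
    Lp.coeFn_add (innerL2 hL U f) (innerL2 hL U' f), Lp.coeFn_add U.1.1 U'.1.1] with t h1 h2 h3 h4 h5
  rw [h1, h4, Pi.add_apply, h2, h3, ← inner_add_left, ← Pi.add_apply, ← h5]
  rfl

lemma innerL2_smul_left (hL : 0 < L) (c : ℝ) (U : W12 L) (f : L2 (Ioo 0 L) E3) :
    innerL2 hL (c • U) f = c • innerL2 hL U f := by
  apply Lp.ext
  filter_upwards [innerL2_ae hL (c • U) f, innerL2_ae hL U f,
    Lp.coeFn_smul c (innerL2 hL U f), Lp.coeFn_smul c U.1.1] with t h1 h2 h4 h5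
  rw [h1, h4, Pi.smul_apply, h2, smul_eq_mul, ← real_inner_smul_left, ← Pi.smul_apply, ← h5]
  rfl

lemma innerL2_add_right (hL : 0 < L) (U : W12 L) (f f' : L2 (Ioo 0 L) E3) :
    innerL2 hL U (f + f') = innerL2 hL U f + innerL2 hL U f' := by
  apply Lp.ext
  filter_upwards [innerL2_ae hL U (f + f'), innerL2_ae hL U f, innerL2_ae hL U f',
    Lp.coeFn_add (innerL2 hL U f) (innerL2 hL U f'), Lp.coeFn_add f f'] with t h1 h2 h3 h4 h5
  rw [h1, h4, Pi.add_apply, h2, h3, h5, Pi.add_apply, inner_add_right]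

lemma innerL2_smul_right (hL : 0 < L) (c : ℝ) (U : W12 L) (f : L2 (Ioo 0 L) E3) :
    innerL2 hL U (c • f) = c • innerL2 hL U f := by
  apply Lp.ext
  filter_upwards [innerL2_ae hL U (c • f), innerL2_ae hL U f,
    Lp.coeFn_smul c (innerL2 hL U f), Lp.coeFn_smul c f] with t h1 h2 h4 h5
  rw [h1, h4, Pi.smul_apply, h2, h5, Pi.smul_apply, smul_eq_mul, real_inner_smul_right]

/-- The bounded bilinear map `(U, f) ↦ U · f`. -/
noncomputable def pairing (hL : 0 < L) :
    W12 L →L[ℝ] L2 (Ioo 0 L) E3 →L[ℝ] L2 (Ioo 0 L) ℝ :=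
  LinearMap.mkContinuous₂
    (LinearMap.mk₂ ℝ (innerL2 hL) (innerL2_add_left hL) (innerL2_smul_left hL)
      (innerL2_add_right hL) (innerL2_smul_right hL))
    (W12.exists_ae_bound hL).choose fun U f => by
      obtain ⟨_, h⟩ := (W12.exists_ae_bound hL).choose_spec
      refine Lp.norm_le_mul_norm_of_ae_le_mul (g := f) ?_
      filter_upwards [innerL2_ae hL U f, h U] with t h1 h2
      rw [LinearMap.mk₂_apply, h1]
      exact (norm_inner_le_norm _ _).trans (by gcongr)

lemma pairing_ae (hL : 0 < L) (U : W12 L) (f : L2 (Ioo 0 L) E3) :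
    pairing hL U f =ᵐ[volume.restrict (Ioo 0 L)] fun t => inner ℝ (U.1.1 t) (f t) :=
  innerL2_ae hL U f

/-- `U ↦ U` as a map from `W^{1,2}` to `L²`. -/
noncomputable def toL2 (L : ℝ) : W12 L →L[ℝ] L2 (Ioo 0 L) E3 :=
  (ContinuousLinearMap.fst ℝ _ _).comp (W12 L).subtypeL

/-- `U ↦ U'` as a map from `W^{1,2}` to `L²`. -/
noncomputable def derivL2 (L : ℝ) : W12 L →L[ℝ] L2 (Ioo 0 L) E3 :=
  (ContinuousLinearMap.snd ℝ _ _).comp (W12 L).subtypeL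

@[simp] lemma toL2_apply (U : W12 L) : toL2 L U = U.1.1 := rfl
@[simp] lemma derivL2_apply (U : W12 L) : derivL2 L U = U.1.2 := rfl

lemma isPrim_primitive (f : L2 (Ioo 0 L) E3) : IsPrim L (fun t => ∫ s in (0 : ℝ)..t, f s) f :=
  ⟨L2.integrableOn f, fun t _ => by simp⟩

lemma memLp_of_isPrim {c w : ℝ → E3} (h : IsPrim L c w) :
    MemLp c 2 (volume.restrict (Ioo 0 L)) := by
  obtain ⟨C, hC⟩ := h.exists_bound
  refine (memLp_const C).of_le h.aestronglyMeasurable ?_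
  filter_upwards [ae_restrict_mem measurableSet_Ioo] with t ht
  exact (hC t (Ioo_subset_Icc_self ht)).trans (le_abs_self C)

/-- The primitive that vanishes at `0`, as a bounded operator on `L²(0,L)`. -/
noncomputable def volterra (L : ℝ) : L2 (Ioo 0 L) E3 →L[ℝ] L2 (Ioo 0 L) E3 :=
  LinearMap.mkContinuous
    { toFun := fun f => (memLp_of_isPrim (isPrim_primitive f)).toLp _
      map_add' := fun f f' => by
        rw [← MemLp.toLp_add, MemLp.toLp_eq_toLp_iff]
        filter_upwards [ae_restrict_mem measurableSet_Ioo] with t ht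
        have h0 : (0 : ℝ) ∈ Icc 0 L := ⟨le_rfl, (ht.1.trans ht.2).le⟩
        have h1 := (((isPrim_primitive f).add (isPrim_primitive f')).congr_deriv
          (Lp.coeFn_add f f').symm).eq_integral t (Ioo_subset_Icc_self ht)
        simpa using h1.symm
      map_smul' := fun c f => by
        rw [RingHom.id_apply, ← MemLp.toLp_const_smul, MemLp.toLp_eq_toLp_iff]
        filter_upwards [ae_restrict_mem measurableSet_Ioo] with t ht
        have h1 := (((isPrim_primitive f).clm_comp
          (c • ContinuousLinearMap.id ℝ E3)).congr_deriv (v := (c • f : L2 (Ioo 0 L) E3)) (by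
            filter_upwards [Lp.coeFn_smul c f] with t ht
            simp [ht])).eq_integral t (Ioo_subset_Icc_self ht)
        simpa using h1.symm }
    ((volume.restrict (Ioo 0 L)).real univ ^ (2 : ℝ≥0∞).toReal⁻¹ *
      (exists_integral_norm_le L).choose) fun f => by
      obtain ⟨h0, h⟩ := (exists_integral_norm_le L).choose_spec
      rw [mul_assoc]
      refine Lp.norm_le_of_ae_bound (mul_nonneg h0 (norm_nonneg _)) ?_
      filter_upwards [(memLp_of_isPrim (isPrim_primitive f)).coeFn_toLp,
        ae_restrict_mem measurableSet_Ioo] with t ht htm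
      change ‖((memLp_of_isPrim (isPrim_primitive f)).toLp _) t‖ ≤ _
      rw [ht]
      exact (norm_intervalIntegral_le (L2.integrableOn f) ⟨le_rfl, (htm.1.trans htm.2).le⟩
        (Ioo_subset_Icc_self htm)).trans (h f)

lemma volterra_ae (f : L2 (Ioo 0 L) E3) :
    volterra L f =ᵐ[volume.restrict (Ioo 0 L)] fun t => ∫ s in (0 : ℝ)..t, f s :=
  (memLp_of_isPrim (isPrim_primitive f)).coeFn_toLp

lemma volterra_hasWeakDeriv (hL : 0 ≤ L) (f : L2 (Ioo 0 L) E3) :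
    HasWeakDeriv (Ioo 0 L) (1 : ℝ) (volterra L f) f :=
  ((isPrim_primitive f).hasWeakDeriv hL).congr (volterra_ae f).symm Filter.EventuallyEq.rfl

/-- The primitive that vanishes at `0`, as a bounded operator from `W^{1,2}` to `W^{2,2}`. -/
noncomputable def primW22 (hL : 0 ≤ L) : W12 L →L[ℝ] W22 L :=
  ((((((volterra L).comp (toL2 L)).prod (toL2 L)).codRestrict (W12 L)
    fun U => volterra_hasWeakDeriv hL U.1.1).prod (ContinuousLinearMap.id ℝ (W12 L))).codRestrict
      (W22 L) fun _ => rfl)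

end Sobolev

end Rod

namespace Rod

/-! ### The second derivative of the stored-energy density at the identity -/

section Hessian

/-- Restrict `w` to the line through `x` in the direction `v`. If its second derivative were
negative, the second derivative test would make `0` a local maximum as well as a minimum. The
restriction would then be locally constant, with second derivative zero. -/
lemma fderiv_fderiv_apply_self_nonneg {E : Type*} [NormedAddCommGroup E] [NormedSpace ℝ E]
    {w : E → ℝ} {x : E} (hw : ContDiffAt ℝ 2 w x) (hx : ∀ y, w x ≤ w y) (v : E) :
    0 ≤ fderiv ℝ (fderiv ℝ w) x v v := by
  set f : ℝ → ℝ := fun s => w (x + s • v)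
  have hline : ∀ s : ℝ, HasDerivAt (fun s : ℝ => x + s • v) v s := fun s => by
    have := ((hasDerivAt_id s).smul_const v).const_add x
    rwa [one_smul] at this
  have hcont : ContinuousAt (fun s : ℝ => x + s • v) 0 := (hline 0).continuousAt
  have h10 : x + (0 : ℝ) • v = x := by simp
  have hev : ∀ᶠ s in nhds (0 : ℝ), HasDerivAt f (fderiv ℝ w (x + s • v) v) s := by
    have h1 : ∀ᶠ y in nhds x, ContDiffAt ℝ 2 w y := hw.eventually (by simp)
    rw [← h10] at h1
    filter_upwards [hcont.eventually h1] with s hs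
    exact (hs.differentiableAt two_ne_zero).hasFDerivAt.comp_hasDerivAt s (hline s)
  have hd1 : deriv f =ᶠ[nhds 0] fun s => fderiv ℝ w (x + s • v) v := hev.mono fun s hs => hs.deriv
  have hd2 : deriv (deriv f) 0 = fderiv ℝ (fderiv ℝ w) x v v := by
    rw [hd1.deriv_eq]
    have h1 : HasFDerivAt (fderiv ℝ w) (fderiv ℝ (fderiv ℝ w) x) (x + (0 : ℝ) • v) := by
      rw [h10]
      exact ((hw.fderiv_right (m := 1) (by norm_num)).differentiableAt one_ne_zero).hasFDerivAt
    have h2 := h1.comp_hasDerivAt (0 : ℝ) (hline 0)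
    exact (h2.clm_apply (hasDerivAt_const 0 v)).deriv.trans (by simp)
  have hf0 : f 0 = w x := by simp only [f, h10]
  have hfn : ∀ s, f 0 ≤ f s := fun s => hf0.le.trans (hx _)
  have hmin : IsLocalMin f 0 := Filter.Eventually.of_forall hfn
  by_contra hneg
  rw [not_le, ← hd2] at hneg
  have hmax := isLocalMax_of_deriv_deriv_neg hneg hmin.deriv_eq_zero hev.self_of_nhds.continuousAt
  have hz : f =ᶠ[nhds 0] fun _ => f 0 := hmax.mono fun s hs => le_antisymm hs (hfn s)
  have h0 : deriv (deriv f) 0 = 0 := by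
    rw [hz.deriv.deriv_eq]
    simp
  exact absurd h0 hneg.ne

lemma bilin_eq_sum (b : LinearMap.BilinForm ℝ M3) (F G : M3) :
    b F G = ∑ i, ∑ j, G i j * b F (Matrix.single i j 1) := by
  conv_lhs => rw [matrix_eq_sum_single G]
  simp only [map_sum]
  refine Finset.sum_congr rfl fun i _ => Finset.sum_congr rfl fun j _ => ?_
  have h : Matrix.single i j (G i j) = G i j • Matrix.single i j (1 : ℝ) := by
    rw [Matrix.smul_single, smul_eq_mul, mul_one]
  rw [h, map_smul, smul_eq_mul]

lemma bilin_eq_sum_sum (b : LinearMap.BilinForm ℝ M3) (F G : M3) :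
    b F G = ∑ i, ∑ j, ∑ k, ∑ l, G i j * F k l *
      b (Matrix.single k l 1) (Matrix.single i j 1) := by
  rw [bilin_eq_sum]
  refine Finset.sum_congr rfl fun i _ => Finset.sum_congr rfl fun j _ => ?_
  have h := bilin_eq_sum b.flip (Matrix.single i j 1) F
  simp only [LinearMap.BilinForm.flip_apply] at h
  rw [h]
  simp only [Finset.mul_sum, mul_assoc]

lemma exists_bilin_le (b : LinearMap.BilinForm ℝ M3) :
    ∃ C : ℝ, 0 < C ∧ ∀ H : M3, b H H ≤ C * ∑ i, ∑ j, H i j ^ 2 := by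
  have hle : ∀ (H : M3) (i j : Fin 3), H i j ^ 2 ≤ ∑ i, ∑ j, H i j ^ 2 := fun H i j =>
    (Finset.single_le_sum (f := fun j => H i j ^ 2) (fun _ _ => sq_nonneg _)
      (Finset.mem_univ j)).trans (Finset.single_le_sum (f := fun i => ∑ j, H i j ^ 2)
        (fun _ _ => Finset.sum_nonneg fun _ _ => sq_nonneg _) (Finset.mem_univ i))
  -- The summand `1` makes the constant positive even for the zero form.
  refine ⟨1 + ∑ i, ∑ j, ∑ k, ∑ l, |b (Matrix.single k l 1) (Matrix.single i j 1)|, by positivity,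
    fun H => ?_⟩
  have h0 : 0 ≤ ∑ i, ∑ j, H i j ^ 2 :=
    Finset.sum_nonneg fun _ _ => Finset.sum_nonneg fun _ _ => sq_nonneg _
  have hle' := hle H
  obtain ⟨N, hN⟩ : ∃ N, N = ∑ i, ∑ j, H i j ^ 2 := ⟨_, rfl⟩
  rw [← hN] at h0 hle' ⊢
  rw [bilin_eq_sum_sum, add_mul, one_mul]
  refine le_add_of_nonneg_of_le h0 ?_
  simp only [Finset.sum_mul]
  refine Finset.sum_le_sum fun i _ => Finset.sum_le_sum fun j _ => Finset.sum_le_sum fun k _ =>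
    Finset.sum_le_sum fun l _ => (le_abs_self _).trans ?_
  rw [abs_mul, mul_comm]
  gcongr
  rw [abs_mul]
  nlinarith [hle' i j, hle' k l, sq_nonneg (|H i j| - |H k l|), sq_abs (H i j), sq_abs (H k l)]

/-- `D²W(Id)` as a bilinear form. -/
noncomputable def hessian (W : M3 → ℝ≥0∞) : LinearMap.BilinForm ℝ M3 :=
  LinearMap.mk₂ ℝ (fun F G => fderiv ℝ (fderiv ℝ (fun G : M3 => (W G).toReal)) 1 F G)
    (fun F F' G => by rw [map_add]; rfl) (fun c F G => by rw [map_smul]; rfl)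
    (fun F G G' => map_add _ _ _) (fun c F G => map_smul _ _ _)

lemma elast_apply (W : M3 → ℝ≥0∞) (F : M3) (i j : Fin 3) :
    elast W F i j = hessian W F (Matrix.single i j 1) := rfl

lemma sum_elast_mul (W : M3 → ℝ≥0∞) (F G : M3) :
    ∑ i, ∑ j, elast W F i j * G i j = hessian W F G := by
  rw [bilin_eq_sum]
  simp only [elast_apply, mul_comm]

lemma Q3_eq (W : M3 → ℝ≥0∞) (F : M3) : Q3 W F = hessian W F F := sum_elast_mul W F F

variable {W : M3 → ℝ≥0∞}

lemma one_mem_SO3 : (1 : M3) ∈ SO3 := one_mem (Matrix.specialOrthogonalGroup (Fin 3) ℝ)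

lemma IsEnergyDensity.contDiffAt (hW : IsEnergyDensity W) :
    ContDiffAt ℝ 2 (fun F => (W F).toReal) (1 : M3) := by
  obtain ⟨U, hU, hs, _, hc⟩ := hW.smooth
  exact hc.contDiffAt (hU.mem_nhds (hs one_mem_SO3))

lemma hessian_symm (hW : IsEnergyDensity W) (F G : M3) : hessian W F G = hessian W G F :=
  hW.contDiffAt.isSymmSndFDerivAt (by simp) F G

/-- The identity is a global minimum of `(W G).toReal`: its value there is zero, and `toReal` is
nonnegative even where `W` is infinite, since it sends `⊤` to `0`. -/
lemma hessian_nonneg (hW : IsEnergyDensity W) (F : M3) : 0 ≤ hessian W F F := by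
  refine fderiv_fderiv_apply_self_nonneg hW.contDiffAt (fun G => ?_) F
  simp [hW.zero_on_SO3 1 one_mem_SO3]

end Hessian

/-! ### Partial minimization of a nonnegative quadratic form -/

section PartialMin

variable {A V : Type*} [AddCommGroup A] [Module ℝ A] [AddCommGroup V] [Module ℝ V]

/-- The infimum of `b((a,v),(a,v))` over `v`. -/
noncomputable def partialMin (b : LinearMap.BilinForm ℝ (A × V)) (a : A) : ℝ :=
  sInf (range fun v => b (a, v) (a, v))

variable {b : LinearMap.BilinForm ℝ (A × V)}

lemma partialMin_le (hn : ∀ z, 0 ≤ b z z) (a : A) (v : V) :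
    partialMin b a ≤ b (a, v) (a, v) :=
  csInf_le ⟨0, by rintro _ ⟨v, rfl⟩; exact hn _⟩ ⟨v, rfl⟩

lemma le_partialMin {a : A} {m : ℝ} (h : ∀ v, m ≤ b (a, v) (a, v)) : m ≤ partialMin b a :=
  le_csInf (range_nonempty _) (by rintro _ ⟨v, rfl⟩; exact h v)

lemma quadratic_add (hs : ∀ z z', b z z' = b z' z) (z h : A × V) :
    b (z + h) (z + h) = b z z + 2 * b z h + b h h := by
  simp only [map_add, LinearMap.add_apply, hs h z]
  ring

/-- First-order condition at the minimizer: moving `v₀` by `s • v` changes the energy by `2sβ +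
s²κ`, which is nonnegative for all `s` only if `β = 0`. -/
lemma eq_zero_of_minimizer (hs : ∀ z z', b z z' = b z' z) {a : A} {v₀ : V}
    (hv₀ : ∀ v, b (a, v₀) (a, v₀) ≤ b (a, v) (a, v)) (v : V) : b (a, v₀) (0, v) = 0 := by
  set β := b (a, v₀) (0, v)
  set κ := b (0, v) (0, v)
  have h1 : ∀ s : ℝ, 0 ≤ 2 * s * β + s ^ 2 * κ := by
    intro s
    have h2 := hv₀ (v₀ + s • v)
    have h3 : ((a, v₀ + s • v) : A × V) = (a, v₀) + s • (0, v) := by simp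
    rw [h3, quadratic_add hs] at h2
    simp only [map_smul, LinearMap.smul_apply, smul_eq_mul] at h2
    nlinarith
  by_contra hβ
  have hpos : 0 < 1 + |κ| := by positivity
  -- For this `s` the linear term outweighs the quadratic one, so the change is negative unless `β =
  -- 0`.
  have h2 := h1 (-β / (1 + |κ|))
  have h3 : 2 * (-β / (1 + |κ|)) * β + (-β / (1 + |κ|)) ^ 2 * κ
      = β ^ 2 / (1 + |κ|) ^ 2 * (κ - 2 * (1 + |κ|)) := by
    field_simp
    ring
  rw [h3] at h2
  have h4 : 0 < β ^ 2 / (1 + |κ|) ^ 2 := by positivity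
  nlinarith [le_abs_self κ, abs_nonneg κ]

lemma partialMin_eq (hn : ∀ z, 0 ≤ b z z) {a : A} {v₀ : V}
    (hv₀ : ∀ v, b (a, v₀) (a, v₀) ≤ b (a, v) (a, v)) : partialMin b a = b (a, v₀) (a, v₀) :=
  le_antisymm (partialMin_le hn a v₀) (le_partialMin hv₀)

/-- The old minimizer `v₀` is a competitor at `a + h`. -/
lemma partialMin_add_le (hs : ∀ z z', b z z' = b z' z) (hn : ∀ z, 0 ≤ b z z) {a : A} {v₀ : V}
    (hv₀ : ∀ v, b (a, v₀) (a, v₀) ≤ b (a, v) (a, v)) (h : A) :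
    partialMin b (a + h) ≤ partialMin b a + 2 * b (a, v₀) (h, 0) + b (h, 0) (h, 0) := by
  rw [partialMin_eq hn hv₀, ← quadratic_add hs]
  simpa using partialMin_le hn (a + h) v₀

/-- Expand the energy of any competitor at `a + h` about `(a, v₀)`: the first-order condition
removes the change of `v` from the linear term, and the quadratic term is nonnegative. -/
lemma le_partialMin_add (hs : ∀ z z', b z z' = b z' z) (hn : ∀ z, 0 ≤ b z z) {a : A} {v₀ : V}
    (hv₀ : ∀ v, b (a, v₀) (a, v₀) ≤ b (a, v) (a, v)) (h : A) :
    partialMin b a + 2 * b (a, v₀) (h, 0) ≤ partialMin b (a + h) := by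
  refine le_partialMin fun v => ?_
  have h1 : ((a + h, v) : A × V) = (a, v₀) + (h, v - v₀) := by simp
  have h2 : ((h, v - v₀) : A × V) = (h, 0) + (0, v - v₀) := by simp
  have h3 : b (a, v₀) (h, v - v₀) = b (a, v₀) (h, 0) := by
    rw [h2, map_add, eq_zero_of_minimizer hs hv₀, add_zero]
  rw [partialMin_eq hn hv₀, h1, quadratic_add hs, h3]
  linarith [hn (h, v - v₀)]

/-- For fixed competitors `v`, `v'` this is convexity of `z ↦ b z z`, that is, nonnegativity of `b`
on the difference. The infima over `v'` and `v` are then taken one after the other. -/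
lemma convexOn_partialMin (hs : ∀ z z', b z z' = b z' z) (hn : ∀ z, 0 ≤ b z z) :
    ConvexOn ℝ univ (partialMin b) := by
  refine ⟨convex_univ, fun a _ a' _ s t hs0 ht0 hst => ?_⟩
  have key : ∀ v v', partialMin b (s • a + t • a') ≤
      s * b (a, v) (a, v) + t * b (a', v') (a', v') := by
    intro v v'
    refine (partialMin_le hn _ (s • v + t • v')).trans ?_
    have h1 : ((s • a + t • a', s • v + t • v') : A × V) = s • (a, v) + t • (a', v') := by simp
    have h2 := hn ((a, v) - (a', v'))
    rw [h1]
    simp only [map_add, map_sub, map_smul, LinearMap.add_apply, LinearMap.sub_apply,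
      LinearMap.smul_apply, smul_eq_mul, hs (a', v') (a, v)] at h2 ⊢
    obtain rfl : t = 1 - s := by linarith
    nlinarith [mul_nonneg (mul_nonneg hs0 ht0) h2]
  have h1 : ∀ v, (partialMin b (s • a + t • a') - s * b (a, v) (a, v)) ≤ t * partialMin b a' := by
    intro v
    -- The infimum is reached after dividing by the weight, so weight zero is treated apart.
    rcases ht0.eq_or_lt with rfl | ht
    · linarith [key v 0]
    · rw [← div_le_iff₀' ht]
      refine le_partialMin fun v' => ?_
      rw [div_le_iff₀' ht]
      linarith [key v v']
  have h2 : partialMin b (s • a + t • a') - t * partialMin b a' ≤ s * partialMin b a := by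
    rcases hs0.eq_or_lt with rfl | hs'
    · linarith [h1 0]
    · rw [← div_le_iff₀' hs']
      refine le_partialMin fun v => ?_
      rw [div_le_iff₀' hs']
      linarith [h1 v]
  simp only [smul_eq_mul]
  linarith

end PartialMin

end Rod

namespace Rod

/-! ### The quadratic form `Q₁` -/

section CrossSection

variable {S : Set E2}

@[simp] lemma strain_apply_zero (A : M3) (α : W12S S) (x : E2) (i : Fin 3) :
    strain A α x i 0 = x 0 * A i 1 + x 1 * A i 2 := rfl

@[simp] lemma strain_apply_one (A : M3) (α : W12S S) (x : E2) (i : Fin 3) :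
    strain A α x i 1 = α.1.2.1 x i := rfl

@[simp] lemma strain_apply_two (A : M3) (α : W12S S) (x : E2) (i : Fin 3) :
    strain A α x i 2 = α.1.2.2 x i := rfl

/-- The strain is linear in the pair `(A, α)`, but only almost everywhere, because the derivatives
of `α` are `L²` classes. The same holds for `strain_smul`; both make `crossForm` bilinear. -/
lemma strain_add (A A' : M3) (α α' : W12S S) : ∀ᵐ x ∂(volume.restrict S),
    strain (A + A') (α + α') x = strain A α x + strain A' α' x := by
  filter_upwards [Lp.coeFn_add α.1.2.1 α'.1.2.1, Lp.coeFn_add α.1.2.2 α'.1.2.2] with x h1 h2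
  ext i j
  fin_cases j
  · simp; ring
  · exact congrArg (fun v : E3 => v i) h1
  · exact congrArg (fun v : E3 => v i) h2

lemma strain_smul (c : ℝ) (A : M3) (α : W12S S) : ∀ᵐ x ∂(volume.restrict S),
    strain (c • A) (c • α) x = c • strain A α x := by
  filter_upwards [Lp.coeFn_smul c α.1.2.1, Lp.coeFn_smul c α.1.2.2] with x h1 h2
  ext i j
  fin_cases j
  · simp; ring
  · exact congrArg (fun v : E3 => v i) h1
  · exact congrArg (fun v : E3 => v i) h2

lemma strain_zero (H : M3) : ∀ᵐ x ∂(volume.restrict S), strain H (0 : W12S S) x =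
    cols (fun i => x 0 * H i 1 + x 1 * H i 2) (fun _ => 0) (fun _ => 0) := by
  have h1 : (0 : W12S S).1.2.1 = 0 := by simp
  have h2 : (0 : W12S S).1.2.2 = 0 := by simp
  filter_upwards [Lp.coeFn_zero E3 2 (volume.restrict S)] with x hx
  rw [strain, h1, h2, hx]
  rfl

lemma IsCrossSection.isFiniteMeasure (hS : IsCrossSection S) :
    IsFiniteMeasure (volume.restrict S) :=
  ⟨by simp [hS.area]⟩

lemma IsCrossSection.memLp_coord (hS : IsCrossSection S) (k : Fin 2) :
    MemLp (fun x : E2 => x k) 2 (volume.restrict S) := by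
  have := hS.isFiniteMeasure
  obtain ⟨C, hC⟩ := hS.isBounded.exists_norm_le
  refine (memLp_const C).of_le (by fun_prop) ?_
  filter_upwards [ae_restrict_mem hS.isOpen.measurableSet] with x hx
  exact ((PiLp.norm_apply_le x k).trans (hC x hx)).trans (le_abs_self C)

lemma IsCrossSection.memLp_strain (hS : IsCrossSection S) (A : M3) (α : W12S S) (i j : Fin 3) :
    MemLp (fun x => strain A α x i j) 2 (volume.restrict S) := by
  fin_cases j
  · exact ((hS.memLp_coord 0).mul_const (A i 1)).add ((hS.memLp_coord 1).mul_const (A i 2))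
  · exact (EuclideanSpace.proj i : E3 →L[ℝ] ℝ).comp_memLp' (Lp.memLp α.1.2.1)
  · exact (EuclideanSpace.proj i : E3 →L[ℝ] ℝ).comp_memLp' (Lp.memLp α.1.2.2)

lemma IsCrossSection.integrable_hessian (hS : IsCrossSection S) (W : M3 → ℝ≥0∞)
    (A A' : M3) (α α' : W12S S) :
    Integrable (fun x => hessian W (strain A α x) (strain A' α' x)) (volume.restrict S) := by
  simp only [bilin_eq_sum_sum (hessian W) (strain A α _) (strain A' α' _)]
  refine integrable_finsetSum _ fun i _ => integrable_finsetSum _ fun j _ =>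
    integrable_finsetSum _ fun k _ => integrable_finsetSum _ fun l _ => ?_
  exact ((hS.memLp_strain A' α' i j).integrable_mul (hS.memLp_strain A α k l)).mul_const _

/-- The form `∫_S 𝓛 F : F'` on pairs of strains. -/
noncomputable def strainPairing (W : M3 → ℝ≥0∞) (A : M3) (α : W12S S) (A' : M3) (α' : W12S S) : ℝ :=
  ∫ x in S, hessian W (strain A α x) (strain A' α' x)

lemma strainPairing_add_left (hS : IsCrossSection S) (W : M3 → ℝ≥0∞) (A A' B : M3)
    (α α' β : W12S S) : strainPairing W (A + A') (α + α') B β =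
      strainPairing W A α B β + strainPairing W A' α' B β := by
  simp only [strainPairing]
  rw [← integral_add (hS.integrable_hessian W _ _ _ _) (hS.integrable_hessian W _ _ _ _)]
  refine integral_congr_ae ?_
  filter_upwards [strain_add A A' α α'] with x hx
  rw [hx, map_add, LinearMap.add_apply]

lemma strainPairing_add_right (hS : IsCrossSection S) (W : M3 → ℝ≥0∞) (B A A' : M3)
    (β α α' : W12S S) : strainPairing W B β (A + A') (α + α') =
      strainPairing W B β A α + strainPairing W B β A' α' := by
  simp only [strainPairing]
  rw [← integral_add (hS.integrable_hessian W _ _ _ _) (hS.integrable_hessian W _ _ _ _)]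
  refine integral_congr_ae ?_
  filter_upwards [strain_add A A' α α'] with x hx
  rw [hx, map_add]

lemma strainPairing_smul_left (W : M3 → ℝ≥0∞) (c : ℝ) (A B : M3) (α β : W12S S) :
    strainPairing W (c • A) (c • α) B β = c • strainPairing W A α B β := by
  simp only [strainPairing]
  rw [smul_eq_mul, ← integral_const_mul]
  refine integral_congr_ae ?_
  filter_upwards [strain_smul c A α] with x hx
  rw [hx, map_smul, LinearMap.smul_apply, smul_eq_mul]

lemma strainPairing_smul_right (W : M3 → ℝ≥0∞) (c : ℝ) (B A : M3) (β α : W12S S) :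
    strainPairing W B β (c • A) (c • α) = c • strainPairing W B β A α := by
  simp only [strainPairing]
  rw [smul_eq_mul, ← integral_const_mul]
  refine integral_congr_ae ?_
  filter_upwards [strain_smul c A α] with x hx
  rw [hx, map_smul, smul_eq_mul]

/-- The symmetric bilinear form associated with `(A, α) ↦ F_A(α)`. -/
noncomputable def crossForm (hS : IsCrossSection S) (W : M3 → ℝ≥0∞) :
    LinearMap.BilinForm ℝ (M3 × W12S S) :=
  LinearMap.mk₂ ℝ (fun z z' => strainPairing W z.1 z.2 z'.1 z'.2)
    (fun z z' y => strainPairing_add_left hS W z.1 z'.1 y.1 z.2 z'.2 y.2)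
    (fun c z y => strainPairing_smul_left W c z.1 y.1 z.2 y.2)
    (fun y z z' => strainPairing_add_right hS W y.1 z.1 z'.1 y.2 z.2 z'.2)
    (fun c y z => strainPairing_smul_right W c y.1 z.1 y.2 z.2)

variable {W : M3 → ℝ≥0∞}

lemma crossForm_apply (hS : IsCrossSection S) (W : M3 → ℝ≥0∞) (z z' : M3 × W12S S) :
    crossForm hS W z z' = ∫ x in S, hessian W (strain z.1 z.2 x) (strain z'.1 z'.2 x) := rfl

lemma crossForm_symm (hS : IsCrossSection S) (hW : IsEnergyDensity W) (z z' : M3 × W12S S) :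
    crossForm hS W z z' = crossForm hS W z' z := by
  simp only [crossForm_apply]
  exact integral_congr_ae (Filter.Eventually.of_forall fun x => hessian_symm hW _ _)

lemma crossForm_nonneg (hS : IsCrossSection S) (hW : IsEnergyDensity W) (z : M3 × W12S S) :
    0 ≤ crossForm hS W z z :=
  integral_nonneg fun _ => hessian_nonneg hW _

lemma crossEnergy_eq (hS : IsCrossSection S) (A : M3) (α : W12S S) :
    crossEnergy W A α = crossForm hS W (A, α) (A, α) := by
  simp only [crossEnergy, Q3_eq, crossForm_apply]

lemma Q1_eq_partialMin (hS : IsCrossSection S) (A : M3) :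
    Q1 S W A = partialMin (crossForm hS W) A := by
  simp only [Q1, partialMin, crossEnergy_eq hS]

/-- The work of the moments `Ẽ`, `Ê` on a variation `H` of the strain `A`. -/
noncomputable def momentWork (W : M3 → ℝ≥0∞) (A : M3) (α : W12S S) (H : M3) : ℝ :=
  ∑ i, ((∫ x in S, x 0 * stress W A α x i 0) * H i 1 + (∫ x in S, x 1 * stress W A α x i 0) * H i 2)

lemma IsCrossSection.memLp_stress (hS : IsCrossSection S) (A : M3) (α : W12S S) (i j : Fin 3) :
    MemLp (fun x => stress W A α x i j) 2 (volume.restrict S) := by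
  have h : ∀ x, stress W A α x i j = ∑ k, ∑ l, strain A α x k l *
      hessian W (Matrix.single k l 1) (Matrix.single i j 1) := fun x => by
    have := bilin_eq_sum (hessian W).flip (Matrix.single i j 1) (strain A α x)
    rw [LinearMap.BilinForm.flip_apply] at this
    exact this
  simp only [h]
  exact memLp_finsetSum _ fun k _ => memLp_finsetSum _ fun l _ =>
    (hS.memLp_strain A α k l).mul_const _

/-- The strain of `(H, 0)` has only a first column, `x₂ H e₂ + x₃ H e₃`. Pairing it with the stress
leaves the first column of the stress, weighted by `x₂` and `x₃`. -/
lemma crossForm_left_zero (hS : IsCrossSection S) (A : M3) (α : W12S S) (H : M3) :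
    crossForm hS W (A, α) (H, 0) = momentWork W A α H := by
  have hi : ∀ (k : Fin 2) (i : Fin 3) (a : ℝ),
      Integrable (fun x : E2 => x k * stress W A α x i 0 * a) (volume.restrict S) := fun k i a =>
    ((hS.memLp_coord k).integrable_mul (hS.memLp_stress A α i 0)).mul_const a
  rw [crossForm_apply, momentWork]
  simp only [← integral_mul_const]
  have hi2 : ∀ i, Integrable (fun x : E2 => x 0 * stress W A α x i 0 * H i 1
      + x 1 * stress W A α x i 0 * H i 2) (volume.restrict S) := fun i => (hi 0 i _).add (hi 1 i _)
  have hi3 : ∀ i, ∫ x in S, x 0 * stress W A α x i 0 * H i 1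
      + x 1 * stress W A α x i 0 * H i 2 = (∫ x in S, x 0 * stress W A α x i 0 * H i 1)
      + ∫ x in S, x 1 * stress W A α x i 0 * H i 2 := fun i => integral_add (hi 0 i _) (hi 1 i _)
  simp only [← hi3]
  rw [← integral_finsetSum _ fun i _ => hi2 i]
  refine integral_congr_ae ?_
  filter_upwards [strain_zero H] with x hx
  rw [← sum_elast_mul, hx]
  refine Finset.sum_congr rfl fun i _ => ?_
  rw [Fin.sum_univ_three]
  simp only [stress, cols, Matrix.transpose_apply, Matrix.of_apply, Matrix.cons_val]
  ring

lemma isWarping_iff (hS : IsCrossSection S) {A : M3} {α : W12S S} (h : IsWarping W A α)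
    (β : W12S S) : crossForm hS W (A, α) (A, α) ≤ crossForm hS W (A, β) (A, β) := by
  simpa only [crossEnergy_eq hS] using h.2 β

lemma Q1_nonneg (hS : IsCrossSection S) (hW : IsEnergyDensity W) (A : M3) : 0 ≤ Q1 S W A := by
  rw [Q1_eq_partialMin hS]
  exact le_partialMin fun v => crossForm_nonneg hS hW _

/-- Lower half of the bracket that identifies the derivative of `Q1` at `A` as twice the moment
work. -/
lemma le_Q1_add (hS : IsCrossSection S) (hW : IsEnergyDensity W) {A : M3} {α : W12S S}
    (h : IsWarping W A α) (H : M3) : Q1 S W A + 2 * momentWork W A α H ≤ Q1 S W (A + H) := by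
  simp only [Q1_eq_partialMin hS, ← crossForm_left_zero hS]
  exact le_partialMin_add (crossForm_symm hS hW) (crossForm_nonneg hS hW) (isWarping_iff hS h) H

/-- Upper half of the bracket: `α` remains a competitor at `A + H`, and the error is the form at
`(H, 0)`, a quadratic form on a finite-dimensional space. The competitor `0` gives the growth bound.
-/
lemma exists_Q1_bound (hS : IsCrossSection S) (hW : IsEnergyDensity W) :
    ∃ C : ℝ, 0 < C ∧ (∀ A, Q1 S W A ≤ C * ∑ i, ∑ j, A i j ^ 2) ∧
      ∀ (A : M3) (α : W12S S), IsWarping W A α → ∀ H : M3,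
        Q1 S W (A + H) ≤ Q1 S W A + 2 * momentWork W A α H + C * ∑ i, ∑ j, H i j ^ 2 := by
  obtain ⟨C, hC, h⟩ := exists_bilin_le
    ((crossForm hS W).compl₁₂ (LinearMap.inl ℝ M3 (W12S S)) (LinearMap.inl ℝ M3 (W12S S)))
  simp only [LinearMap.compl₁₂_apply, LinearMap.inl_apply] at h
  refine ⟨C, hC, fun A => ?_, fun A α hα H => ?_⟩
  · rw [Q1_eq_partialMin hS]
    exact (partialMin_le (crossForm_nonneg hS hW) A 0).trans (h A)
  · simp only [Q1_eq_partialMin hS, ← crossForm_left_zero hS]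
    exact (partialMin_add_le (crossForm_symm hS hW) (crossForm_nonneg hS hW)
      (isWarping_iff hS hα) H).trans (by linarith [h H])

/-- A convex function on a finite-dimensional space is continuous. -/
lemma measurable_Q1 (hS : IsCrossSection S) (hW : IsEnergyDensity W) :
    Measurable (fun h : Fin 3 → Fin 3 → ℝ => Q1 S W (Matrix.of h)) := by
  have h1 : ConvexOn ℝ univ (fun h : Fin 3 → Fin 3 → ℝ => Q1 S W (Matrix.of h)) := by
    have := convexOn_partialMin (crossForm_symm hS hW) (crossForm_nonneg hS hW)
    simp only [Q1_eq_partialMin hS]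
    exact ⟨convex_univ, fun a _ a' _ s t hs ht hst =>
      this.2 (mem_univ (Matrix.of a)) (mem_univ (Matrix.of a')) hs ht hst⟩
  exact (continuousOn_univ.1 (h1.continuousOn isOpen_univ)).measurable

/-- The upper bound for `Q1` along `A + s E_ij` is quadratic in `s` and must stay nonnegative, so
its discriminant controls the moment by `|A|` without any estimate on `α`. -/
lemma exists_momentWork_bound (hS : IsCrossSection S) (hW : IsEnergyDensity W) :
    ∃ C : ℝ, 0 < C ∧ ∀ (A : M3) (α : W12S S), IsWarping W A α → ∀ i j : Fin 3,
      |momentWork W A α (Matrix.single i j 1)| ≤ C * √(∑ i, ∑ j, A i j ^ 2) := by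
  obtain ⟨C, hC, h1, h2⟩ := exists_Q1_bound hS hW
  refine ⟨C, hC, fun A α hα i j => ?_⟩
  set m := momentWork W A α (Matrix.single i j 1)
  set a := ∑ i, ∑ j, A i j ^ 2
  have hm : ∀ s : ℝ, momentWork W A α (s • Matrix.single i j 1) = s * m := fun s => by
    simp only [m, momentWork, Matrix.smul_apply, smul_eq_mul, Finset.mul_sum]
    exact Finset.sum_congr rfl fun _ _ => by ring
  have hsq : ∀ s : ℝ, ∑ k, ∑ l, (s • Matrix.single i j (1 : ℝ)) k l ^ 2 = s ^ 2 := fun s => by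
    simp only [Matrix.smul_apply, smul_eq_mul, mul_pow]
    rw [Finset.sum_eq_single i, Finset.sum_eq_single j]
    · simp
    · intro l _ hl; simp [hl.symm]
    · simp
    · intro k _ hk; simp [hk.symm]
    · simp
  have key : ∀ s : ℝ, 0 ≤ C * a + 2 * (s * m) + C * s ^ 2 := fun s => by
    have h3 := h2 A α hα (s • Matrix.single i j 1)
    rw [hm, hsq] at h3
    linarith [Q1_nonneg hS hW (A + s • Matrix.single i j 1), h1 A]
  -- This `s` minimizes the quadratic.
  have h4 := key (-m / C)
  have h5 : C * a + 2 * (-m / C * m) + C * (-m / C) ^ 2 = (C ^ 2 * a - m ^ 2) / C := by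
    field_simp
    ring
  rw [h5] at h4
  have h6 : m ^ 2 ≤ C ^ 2 * a := by
    by_contra hlt
    exact absurd h4 (not_le.2 (div_neg_of_neg_of_pos (by linarith) hC))
  calc |m| = √(m ^ 2) := (Real.sqrt_sq_eq_abs m).symm
    _ ≤ √(C ^ 2 * a) := Real.sqrt_le_sqrt h6
    _ = C * √a := by rw [Real.sqrt_mul (sq_nonneg C), Real.sqrt_sq hC.le]

end CrossSection

end Rod

namespace Rod

/-! ### The first variation of `J₂` -/

section FirstVariation

variable {S : Set E2} {W : M3 → ℝ≥0∞} {L : ℝ}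

lemma momentWork_eq_sum (A : M3) (α : W12S S) (H : M3) :
    momentWork W A α H = ∑ i, ∑ j, momentWork W A α (Matrix.single i j 1) * H i j := by
  simp only [momentWork, Fin.sum_univ_three, Matrix.single_apply]
  simp

/-! ### Measurability and square integrability of the moments -/

section L2Field

variable {A : ℝ → M3} {α : ℝ → W12S S}

lemma aemeasurable_Q1_comp (hS : IsCrossSection S) (hW : IsEnergyDensity W)
    (hA : ∀ i j, MemLp (fun t => A t i j) 2 (volume.restrict (Ioo 0 L))) :
    AEMeasurable (fun t => Q1 S W (A t)) (volume.restrict (Ioo 0 L)) :=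
  (measurable_Q1 hS hW).comp_aemeasurable (f := fun t i j => A t i j)
    (aemeasurable_pi_lambda _ fun i => aemeasurable_pi_lambda _ fun j =>
      (hA i j).aestronglyMeasurable.aemeasurable)

lemma integrable_sum_sq (hA : ∀ i j, MemLp (fun t => A t i j) 2 (volume.restrict (Ioo 0 L))) :
    Integrable (fun t => ∑ i, ∑ j, A t i j ^ 2) (volume.restrict (Ioo 0 L)) :=
  integrable_finsetSum _ fun i _ => integrable_finsetSum _ fun j _ => (hA i j).integrable_sq

lemma integrable_Q1_comp (hS : IsCrossSection S) (hW : IsEnergyDensity W)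
    (hA : ∀ i j, MemLp (fun t => A t i j) 2 (volume.restrict (Ioo 0 L))) :
    Integrable (fun t => Q1 S W (A t)) (volume.restrict (Ioo 0 L)) := by
  obtain ⟨C, hC, h1, _⟩ := exists_Q1_bound hS hW
  refine ((integrable_sum_sq hA).const_mul C).mono'
    (aemeasurable_Q1_comp hS hW hA).aestronglyMeasurable (Filter.Eventually.of_forall fun t => ?_)
  rw [Real.norm_of_nonneg (Q1_nonneg hS hW _)]
  exact h1 (A t)

lemma momentWork_smul (B : M3) (β : W12S S) (s : ℝ) (H : M3) :
    momentWork W B β (s • H) = s * momentWork W B β H := by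
  simp only [momentWork, Matrix.smul_apply, smul_eq_mul, Finset.mul_sum]
  exact Finset.sum_congr rfl fun _ _ => by ring

/-- The bracket squeezes the quotient with step `s = 1 / (n + 1)`; the factor `(n + 1) / 2` is `1 /
(2s)`, since the derivative of `Q1` is twice the work. -/
lemma tendsto_Q1_quotient (hS : IsCrossSection S) (hW : IsEnergyDensity W) {B : M3} {β : W12S S}
    (hβ : IsWarping W B β) (H : M3) :
    Filter.Tendsto (fun n : ℕ => (Q1 S W (B + (1 / ((n : ℝ) + 1)) • H) - Q1 S W B) *
      (((n : ℝ) + 1) / 2)) Filter.atTop (nhds (momentWork W B β H)) := by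
  obtain ⟨C, hC, _, h2⟩ := exists_Q1_bound hS hW
  set N := ∑ i, ∑ j, H i j ^ 2
  have hlim : Filter.Tendsto (fun n : ℕ => momentWork W B β H + C * N / 2 * (1 / ((n : ℝ) + 1)))
      Filter.atTop (nhds (momentWork W B β H)) := by
    simpa using (tendsto_one_div_add_atTop_nhds_zero_nat.const_mul (C * N / 2)).const_add
      (momentWork W B β H)
  refine tendsto_of_tendsto_of_tendsto_of_le_of_le tendsto_const_nhds hlim (fun n => ?_)
    (fun n => ?_)
  all_goals
    have hn : (0 : ℝ) < (n : ℝ) + 1 := by positivity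
    set s : ℝ := 1 / ((n : ℝ) + 1)
    have hs : 0 < s := by positivity
    have hsn : ((n : ℝ) + 1) / 2 = 1 / (2 * s) := by
      simp only [s]; field_simp
    simp only [hsn]
    rw [mul_one_div]
  · rw [le_div_iff₀ (by positivity)]
    have := le_Q1_add hS hW hβ (s • H)
    rw [momentWork_smul] at this
    linarith
  · rw [div_le_iff₀ (by positivity)]
    have := h2 B β hβ (s • H)
    have hsq : ∑ i, ∑ j, (s • H) i j ^ 2 = s ^ 2 * N := by
      simp only [N, Matrix.smul_apply, smul_eq_mul, mul_pow, Finset.mul_sum]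
    rw [momentWork_smul, hsq] at this
    nlinarith

/-- The choice `t ↦ α t` need not be measurable. Its moments are a.e. limits of difference quotients
of `Q1` along `A`, hence measurable, and are dominated by a multiple of `|A|`. -/
lemma memLp_momentWork (hS : IsCrossSection S) (hW : IsEnergyDensity W)
    (hA : ∀ i j, MemLp (fun t => A t i j) 2 (volume.restrict (Ioo 0 L)))
    (hα : ∀ᵐ t ∂(volume.restrict (Ioo 0 L)), IsWarping W (A t) (α t)) (i j : Fin 3) :
    MemLp (fun t => momentWork W (A t) (α t) (Matrix.single i j 1)) 2
      (volume.restrict (Ioo 0 L)) := by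
  have hmeas : AEMeasurable (fun t => momentWork W (A t) (α t) (Matrix.single i j 1))
      (volume.restrict (Ioo 0 L)) := by
    refine aemeasurable_of_tendsto_metrizable_ae Filter.atTop
      (f := fun (n : ℕ) t => (Q1 S W (A t + (1 / ((n : ℝ) + 1)) • Matrix.single i j (1 : ℝ))
        - Q1 S W (A t)) * (((n : ℝ) + 1) / 2)) (fun n => ?_) ?_
    · refine (AEMeasurable.sub ?_ (aemeasurable_Q1_comp hS hW hA)).mul_const _
      exact aemeasurable_Q1_comp hS hW fun k l => (hA k l).add (memLp_const _)
    · filter_upwards [hα] with t ht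
      exact tendsto_Q1_quotient hS hW ht _
  obtain ⟨C, hC, h⟩ := exists_momentWork_bound hS hW
  have hsqrt : MemLp (fun t => √(∑ i, ∑ j, A t i j ^ 2)) 2 (volume.restrict (Ioo 0 L)) := by
    have hi := integrable_sum_sq hA
    rw [memLp_two_iff_integrable_sq
      (hi.aestronglyMeasurable.aemeasurable.sqrt.aestronglyMeasurable)]
    refine hi.congr (Filter.Eventually.of_forall fun t => ?_)
    exact (Real.sq_sqrt (Finset.sum_nonneg fun _ _ => Finset.sum_nonneg fun _ _ => sq_nonneg _)).symm
  refine hsqrt.of_le_mul (c := C) hmeas.aestronglyMeasurable ?_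
  filter_upwards [hα] with t ht
  rw [Real.norm_eq_abs, Real.norm_of_nonneg (Real.sqrt_nonneg _)]
  exact h (A t) (α t) ht i j

end L2Field

/-- The energy `∫ Q₁(a)` of a square integrable matrix field. -/
noncomputable def fieldEnergy (S : Set E2) (W : M3 → ℝ≥0∞) (a : Fin 3 → Fin 3 → L2 (Ioo 0 L) ℝ) : ℝ :=
  ∫ t in Ioo 0 L, Q1 S W (Matrix.of fun i j => a i j t)

lemma L2.norm_sq_eq (h : L2 (Ioo 0 L) ℝ) : ‖h‖ ^ 2 = ∫ t in Ioo 0 L, h t ^ 2 := by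
  rw [← real_inner_self_eq_norm_sq, L2.inner_def]
  exact integral_congr_ae (Filter.Eventually.of_forall fun t => by simp [pow_two])

lemma L2.inner_eq (f h : L2 (Ioo 0 L) ℝ) : inner ℝ f h = ∫ t in Ioo 0 L, f t * h t := by
  rw [L2.inner_def]
  exact integral_congr_ae (Filter.Eventually.of_forall fun t => by simp [mul_comm])

/-- The pointwise bracket integrated in `t`: the energy is differentiable at `a` on `L²` fields,
with a remainder quadratic in the norm. Minimizers are needed only for the field `a`. -/
lemma abs_fieldEnergy_sub_le (hS : IsCrossSection S) (hW : IsEnergyDensity W) :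
    ∃ C : ℝ, ∀ (a b M : Fin 3 → Fin 3 → L2 (Ioo 0 L) ℝ) (α : ℝ → W12S S),
      (∀ᵐ t ∂(volume.restrict (Ioo 0 L)), IsWarping W (Matrix.of fun i j => a i j t) (α t)) →
      (∀ i j, M i j =ᵐ[volume.restrict (Ioo 0 L)] fun t =>
        momentWork W (Matrix.of fun i j => a i j t) (α t) (Matrix.single i j 1)) →
      |fieldEnergy S W b - fieldEnergy S W a - 2 * ∑ i, ∑ j, inner ℝ (M i j) (b i j - a i j)| ≤
        C * ∑ i, ∑ j, ‖b i j - a i j‖ ^ 2 := by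
  obtain ⟨C, hC, _, h2⟩ := exists_Q1_bound hS hW
  refine ⟨C, fun a b M α hα hM => ?_⟩
  have hmem : ∀ (c : Fin 3 → Fin 3 → L2 (Ioo 0 L) ℝ) (i j : Fin 3),
      MemLp (fun t => (Matrix.of fun i j => c i j t : M3) i j) 2 (volume.restrict (Ioo 0 L)) :=
    fun c i j => Lp.memLp (c i j)
  have hint : ∀ i j, Integrable (fun t => M i j t * (b i j - a i j : L2 (Ioo 0 L) ℝ) t)
      (volume.restrict (Ioo 0 L)) := fun i j => (Lp.memLp (M i j)).integrable_mul (Lp.memLp _)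
  have hsq : ∀ i j, Integrable (fun t => (b i j - a i j : L2 (Ioo 0 L) ℝ) t ^ 2)
      (volume.restrict (Ioo 0 L)) := fun i j => (Lp.memLp (b i j - a i j)).integrable_sq
  have e1 : ∑ i, ∑ j, inner ℝ (M i j) (b i j - a i j) =
      ∫ t in Ioo 0 L, ∑ i, ∑ j, M i j t * (b i j - a i j : L2 (Ioo 0 L) ℝ) t := by
    rw [integral_finsetSum _ fun i _ => integrable_finsetSum _ fun j _ => hint i j]
    refine Finset.sum_congr rfl fun i _ => ?_
    rw [integral_finsetSum _ fun j _ => hint i j]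
    exact Finset.sum_congr rfl fun j _ => L2.inner_eq _ _
  have e2 : ∑ i, ∑ j, ‖b i j - a i j‖ ^ 2 =
      ∫ t in Ioo 0 L, ∑ i, ∑ j, (b i j - a i j : L2 (Ioo 0 L) ℝ) t ^ 2 := by
    rw [integral_finsetSum _ fun i _ => integrable_finsetSum _ fun j _ => hsq i j]
    refine Finset.sum_congr rfl fun i _ => ?_
    rw [integral_finsetSum _ fun j _ => hsq i j]
    exact Finset.sum_congr rfl fun j _ => L2.norm_sq_eq _
  have hintM : Integrable (fun t => ∑ i, ∑ j, M i j t * (b i j - a i j : L2 (Ioo 0 L) ℝ) t)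
      (volume.restrict (Ioo 0 L)) :=
    integrable_finsetSum _ fun i _ => integrable_finsetSum _ fun j _ => hint i j
  have hintsq : Integrable (fun t => ∑ i, ∑ j, (b i j - a i j : L2 (Ioo 0 L) ℝ) t ^ 2)
      (volume.restrict (Ioo 0 L)) :=
    integrable_finsetSum _ fun i _ => integrable_finsetSum _ fun j _ => hsq i j
  have hQa := integrable_Q1_comp hS hW (hmem a)
  have hQb := integrable_Q1_comp hS hW (hmem b)
  have hpt : ∀ᵐ t ∂(volume.restrict (Ioo 0 L)),
      ‖Q1 S W (Matrix.of fun i j => b i j t) - Q1 S W (Matrix.of fun i j => a i j t)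
        - 2 * ∑ i, ∑ j, M i j t * (b i j - a i j : L2 (Ioo 0 L) ℝ) t‖ ≤
      C * ∑ i, ∑ j, (b i j - a i j : L2 (Ioo 0 L) ℝ) t ^ 2 := by
    have hsub : ∀ i j, ⇑(b i j - a i j) =ᵐ[volume.restrict (Ioo 0 L)] ⇑(b i j) - ⇑(a i j) :=
      fun i j => Lp.coeFn_sub _ _
    filter_upwards [hα, ae_all_iff.2 fun i => ae_all_iff.2 (hM i),
      ae_all_iff.2 fun i => ae_all_iff.2 (hsub i)] with t h1 h3 h4
    set H : M3 := Matrix.of fun i j => (b i j - a i j : L2 (Ioo 0 L) ℝ) t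
    have hadd : (Matrix.of fun i j => b i j t : M3) = (Matrix.of fun i j => a i j t) + H := by
      ext i j
      change b i j t = a i j t + (b i j - a i j : L2 (Ioo 0 L) ℝ) t
      rw [h4 i j, Pi.sub_apply, add_sub_cancel]
    have h5 : ∑ i, ∑ j, M i j t * (b i j - a i j : L2 (Ioo 0 L) ℝ) t =
        momentWork W (Matrix.of fun i j => a i j t) (α t) H := by
      rw [momentWork_eq_sum]
      exact Finset.sum_congr rfl fun i _ => Finset.sum_congr rfl fun j _ => by rw [h3 i j]; rfl
    have h6 : ∑ i, ∑ j, (b i j - a i j : L2 (Ioo 0 L) ℝ) t ^ 2 = ∑ i, ∑ j, H i j ^ 2 := rfl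
    rw [h5, h6, hadd, Real.norm_eq_abs, abs_le]
    have h7 := le_Q1_add hS hW h1 H
    have h8 := h2 _ _ h1 H
    have h9 : 0 ≤ C * ∑ i, ∑ j, H i j ^ 2 := by positivity
    constructor <;> linarith
  have e3 : fieldEnergy S W b - fieldEnergy S W a
      - 2 * ∑ i, ∑ j, inner ℝ (M i j) (b i j - a i j) =
      ∫ t in Ioo 0 L, (Q1 S W (Matrix.of fun i j => b i j t) - Q1 S W (Matrix.of fun i j => a i j t)
        - 2 * ∑ i, ∑ j, M i j t * (b i j - a i j : L2 (Ioo 0 L) ℝ) t) := by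
    have hQab : Integrable (fun t => Q1 S W (Matrix.of fun i j => b i j t)
        - Q1 S W (Matrix.of fun i j => a i j t)) (volume.restrict (Ioo 0 L)) := hQb.sub hQa
    rw [integral_sub hQab (hintM.const_mul 2), integral_sub hQb hQa, integral_const_mul,
      e1]
    rfl
  rw [e3, e2, ← integral_const_mul]
  exact norm_integral_le_of_norm_le (hintsq.const_mul C) hpt

lemma hasDerivWithinAt_zero_of_le {r ρ : ℝ → ℝ} {s : Set ℝ} {x : ℝ}
    (h : ∀ ε, |r ε - r x| ≤ ρ ε) (hρx : ρ x = 0) (hρ : HasDerivWithinAt ρ 0 s x) :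
    HasDerivWithinAt r 0 s x := by
  rw [hasDerivWithinAt_iff_isLittleO] at hρ ⊢
  simp only [smul_zero, sub_zero, hρx] at hρ ⊢
  exact Asymptotics.IsBigO.trans_isLittleO
    (Asymptotics.isBigO_of_le _ fun ε => (h ε).trans (le_abs_self _)) hρ

/-- After the linear part is removed, the remainder is dominated by a multiple of the squared `L²`
distance to `a x`, whose derivative at `x` is zero. -/
lemma hasDerivWithinAt_fieldEnergy (hS : IsCrossSection S) (hW : IsEnergyDensity W)
    {a : ℝ → Fin 3 → Fin 3 → L2 (Ioo 0 L) ℝ} {a' M : Fin 3 → Fin 3 → L2 (Ioo 0 L) ℝ}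
    {α : ℝ → W12S S} {s : Set ℝ} {x : ℝ}
    (hα : ∀ᵐ t ∂(volume.restrict (Ioo 0 L)), IsWarping W (Matrix.of fun i j => a x i j t) (α t))
    (hM : ∀ i j, M i j =ᵐ[volume.restrict (Ioo 0 L)] fun t =>
      momentWork W (Matrix.of fun i j => a x i j t) (α t) (Matrix.single i j 1))
    (ha : ∀ i j, HasDerivWithinAt (fun ε => a ε i j) (a' i j) s x) :
    HasDerivWithinAt (fun ε => fieldEnergy S W (a ε)) (2 * ∑ i, ∑ j, inner ℝ (M i j) (a' i j)) s x := by
  obtain ⟨C, hC⟩ := abs_fieldEnergy_sub_le (L := L) hS hW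
  have hd : ∀ i j, HasDerivWithinAt (fun ε => a ε i j - a x i j) (a' i j) s x := fun i j =>
    (ha i j).sub_const _
  have h1 : HasDerivWithinAt (fun ε => 2 * ∑ i, ∑ j, inner ℝ (M i j) (a ε i j - a x i j))
      (2 * ∑ i, ∑ j, inner ℝ (M i j) (a' i j)) s x := by
    refine HasDerivWithinAt.const_mul 2 (HasDerivWithinAt.fun_sum fun i _ =>
      HasDerivWithinAt.fun_sum fun j _ => ?_)
    exact (innerSL ℝ (M i j)).hasFDerivAt.comp_hasDerivWithinAt x (hd i j)
  have h2 : HasDerivWithinAt (fun ε => C * ∑ i, ∑ j, ‖a ε i j - a x i j‖ ^ 2) 0 s x := by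
    have : HasDerivWithinAt (fun ε => C * ∑ i, ∑ j, ‖a ε i j - a x i j‖ ^ 2)
        (C * ∑ i, ∑ j, 2 * inner ℝ (a x i j - a x i j) (a' i j)) s x :=
      HasDerivWithinAt.const_mul C (HasDerivWithinAt.fun_sum fun i _ =>
        HasDerivWithinAt.fun_sum fun j _ => (hd i j).norm_sq)
    simpa using this
  have h3 : HasDerivWithinAt (fun ε => fieldEnergy S W (a ε)
      - 2 * ∑ i, ∑ j, inner ℝ (M i j) (a ε i j - a x i j)) 0 s x := by
    refine hasDerivWithinAt_zero_of_le (fun ε => ?_) (by simp) h2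
    refine le_trans (le_of_eq ?_) (hC (a x) (a ε) M α hα hM)
    simp only [sub_self, inner_zero_right, Finset.sum_const_zero, mul_zero, sub_zero]
    ring_nf
  simpa using h3.fun_add h1

/-- The columns of `R` as elements of `W^{1,2}`. -/
noncomputable def column (L : ℝ) (k : Fin 3) : Config L →L[ℝ] W12 L :=
  ![(ContinuousLinearMap.snd ℝ _ _).comp ((W22 L).subtypeL.comp (ContinuousLinearMap.fst ℝ _ _)),
    (ContinuousLinearMap.fst ℝ _ _).comp (ContinuousLinearMap.snd ℝ _ _),
    (ContinuousLinearMap.snd ℝ _ _).comp (ContinuousLinearMap.snd ℝ _ _)] k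

/-- The deformation `y` of the mid-fiber as an element of `W^{1,2}`. -/
noncomputable def midFiberW12 (L : ℝ) : Config L →L[ℝ] W12 L :=
  (ContinuousLinearMap.fst ℝ _ _).comp ((W22 L).subtypeL.comp (ContinuousLinearMap.fst ℝ _ _))

lemma rot_apply (q : Config L) (t : ℝ) (i k : Fin 3) : rot q t i k = (column L k q).1.1 t i := by
  fin_cases k <;> rfl

lemma rotDeriv_apply (q : Config L) (t : ℝ) (i k : Fin 3) :
    rotDeriv q t i k = (column L k q).1.2 t i := by
  fin_cases k <;> rfl

lemma column_zero (q : Config L) : column L 0 q = q.1.1.2 := rfl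

lemma column_one (q : Config L) : column L 1 q = q.2.1 := rfl

lemma column_two (q : Config L) : column L 2 q = q.2.2 := rfl

lemma midFiberW12_apply (q : Config L) : midFiberW12 L q = q.1.1.1 := rfl

lemma inner_eq_sum (u v : E3) : inner ℝ u v = ∑ i, u i * v i := by
  rw [PiLp.inner_apply]
  exact Finset.sum_congr rfl fun i _ => by rw [RCLike.inner_apply, conj_trivial, mul_comm]

lemma curv_apply (q : Config L) (t : ℝ) (k j : Fin 3) :
    curv q t k j = inner ℝ ((column L k q).1.1 t) ((column L j q).1.2 t) := by
  rw [inner_eq_sum]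
  simp only [curv, Matrix.mul_apply, Matrix.transpose_apply, rot_apply, rotDeriv_apply]

attribute [irreducible] column midFiberW12

/-- `A = Rᵀ R'` as a field of class `L²`. -/
noncomputable def curvL2 (hL : 0 < L) (q : Config L) (k j : Fin 3) : L2 (Ioo 0 L) ℝ :=
  pairing hL (column L k q) (derivL2 L (column L j q))

lemma curvL2_ae (hL : 0 < L) (q : Config L) (k j : Fin 3) :
    curvL2 hL q k j =ᵐ[volume.restrict (Ioo 0 L)] fun t => curv q t k j := by
  filter_upwards [pairing_ae hL (column L k q) (derivL2 L (column L j q))] with t ht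
  rw [curv_apply]
  exact ht

lemma curvL2_ae_matrix (hL : 0 < L) (q : Config L) :
    ∀ᵐ t ∂(volume.restrict (Ioo 0 L)), (Matrix.of fun k j => curvL2 hL q k j t : M3) = curv q t := by
  filter_upwards [ae_all_iff.2 fun k => ae_all_iff.2 (curvL2_ae hL q k)] with t ht
  ext k j
  exact ht k j

/-- The variation of `A = Rᵀ R'` in the direction `η`. -/
noncomputable def curvVar (hL : 0 < L) (q η : Config L) (k j : Fin 3) : L2 (Ioo 0 L) ℝ :=
  pairing hL (column L k η) (derivL2 L (column L j q)) +
    pairing hL (column L k q) (derivL2 L (column L j η))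

lemma HasDerivWithinAt.clm_map {E F : Type*} [NormedAddCommGroup E] [NormedSpace ℝ E]
    [NormedAddCommGroup F] [NormedSpace ℝ F] (T : E →L[ℝ] F) {f : ℝ → E} {f' : E} {s : Set ℝ} {x : ℝ}
    (h : HasDerivWithinAt f f' s x) : HasDerivWithinAt (fun ε => T (f ε)) (T f') s x :=
  T.hasFDerivAt.comp_hasDerivWithinAt x h

lemma hasDerivWithinAt_pairing (hL : 0 < L) {U : ℝ → W12 L} {f : ℝ → L2 (Ioo 0 L) E3} {U' : W12 L}
    {f' : L2 (Ioo 0 L) E3} {s : Set ℝ} {x : ℝ} (hU : HasDerivWithinAt U U' s x)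
    (hf : HasDerivWithinAt f f' s x) :
    HasDerivWithinAt (fun ε => pairing hL (U ε) (f ε)) (pairing hL U' (f x) + pairing hL (U x) f')
      s x :=
  (HasDerivWithinAt.clm_map (pairing hL) hU).clm_apply hf

lemma hasDerivWithinAt_curvL2 (hL : 0 < L) {γ : ℝ → Config L} {η : Config L} {s : Set ℝ} {x : ℝ}
    (hγ : HasDerivWithinAt γ η s x) (k j : Fin 3) :
    HasDerivWithinAt (fun ε => curvL2 hL (γ ε) k j) (curvVar hL (γ x) η k j) s x := by
  have h1 := HasDerivWithinAt.clm_map (E := Config L) (F := W12 L) (column L k) hγ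
  have h2 := HasDerivWithinAt.clm_map (E := Config L) (F := W12 L) (column L j) hγ
  exact hasDerivWithinAt_pairing hL h1 (HasDerivWithinAt.clm_map (derivL2 L) h2)

lemma memLp_curv (hL : 0 < L) (q : Config L) (i j : Fin 3) :
    MemLp (fun t => curv q t i j) 2 (volume.restrict (Ioo 0 L)) :=
  (memLp_congr_ae (curvL2_ae hL q i j)).1 (Lp.memLp _)

lemma inner_toLp_midFiber {g : ℝ → E3} (hg : MemLp g 2 (volume.restrict (Ioo 0 L)))
    (q : Config L) : inner ℝ (hg.toLp g) (toL2 L (midFiberW12 L q)) =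
      ∫ t in Ioo 0 L, inner ℝ (g t) (midFiber q t) := by
  rw [L2.inner_def, midFiberW12_apply]
  refine integral_congr_ae ?_
  filter_upwards [hg.coeFn_toLp] with t ht
  rw [ht]
  rfl

/-- In this form `J2` is the energy of a field depending bilinearly and boundedly on the
configuration, minus a bounded linear functional, so it can be differentiated along curves. -/
lemma J2_eq (hL : 0 < L) {g : ℝ → E3} (hg : MemLp g 2 (volume.restrict (Ioo 0 L))) (q : Config L) :
    J2 S W g q = 1 / 2 * fieldEnergy S W (curvL2 hL q)
      - inner ℝ (hg.toLp g) (toL2 L (midFiberW12 L q)) := by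
  have h : fieldEnergy S W (curvL2 hL q) = ∫ t in Ioo 0 L, Q1 S W (curv q t) := by
    refine integral_congr_ae ?_
    filter_upwards [curvL2_ae_matrix hL q] with t ht
    rw [ht]
  rw [J2, h, inner_toLp_midFiber]

lemma sum_inner_eq_integral_momentWork {A : ℝ → M3} {α : ℝ → W12S S}
    {M : Fin 3 → Fin 3 → L2 (Ioo 0 L) ℝ} (hM : ∀ i j, M i j =ᵐ[volume.restrict (Ioo 0 L)] fun t =>
      momentWork W (A t) (α t) (Matrix.single i j 1)) (h : Fin 3 → Fin 3 → L2 (Ioo 0 L) ℝ) :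
    ∑ i, ∑ j, inner ℝ (M i j) (h i j) =
      ∫ t in Ioo 0 L, momentWork W (A t) (α t) (Matrix.of fun i j => h i j t) := by
  have hint : ∀ i j, Integrable (fun t => M i j t * h i j t)
      (volume.restrict (Ioo 0 L)) := fun i j => (Lp.memLp (M i j)).integrable_mul (Lp.memLp _)
  have e : ∑ i, ∑ j, inner ℝ (M i j) (h i j) =
      ∫ t in Ioo 0 L, ∑ i, ∑ j, M i j t * h i j t := by
    rw [integral_finsetSum _ fun i _ => integrable_finsetSum _ fun j _ => hint i j]
    refine Finset.sum_congr rfl fun i _ => ?_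
    rw [integral_finsetSum _ fun j _ => hint i j]
    exact Finset.sum_congr rfl fun j _ => L2.inner_eq _ _
  rw [e]
  refine integral_congr_ae ?_
  filter_upwards [ae_all_iff.2 fun i => ae_all_iff.2 (hM i)] with t ht
  rw [momentWork_eq_sum]
  exact Finset.sum_congr rfl fun i _ => Finset.sum_congr rfl fun j _ => by rw [ht i j]; rfl

end FirstVariation

end Rod

namespace Rod

/-! ### Differentiation of J₂ along a curve of configurations -/

section FirstVariationTheorem

variable {S : Set E2} {W : M3 → ℝ≥0∞} {L : ℝ}

/-- The first variation of `J₂`. -/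
theorem hasDerivWithinAt_J2 (hL : 0 < L) (hS : IsCrossSection S) (hW : IsEnergyDensity W)
    {g : ℝ → E3} (hg : MemLp g 2 (volume.restrict (Ioo 0 L))) {γ : ℝ → Config L} {q η : Config L}
    {s : Set ℝ} {x : ℝ} (hγ : HasDerivWithinAt γ η s x) (hq : γ x = q) {α : ℝ → W12S S}
    (hα : ∀ᵐ t ∂(volume.restrict (Ioo 0 L)), IsWarping W (curv q t) (α t)) :
    HasDerivWithinAt (fun ε => J2 S W g (γ ε))
      ((∫ t in Ioo 0 L, momentWork W (curv q t) (α t)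
          (Matrix.of fun i j => curvVar hL q η i j t))
        - ∫ t in Ioo 0 L, inner ℝ (g t) (midFiber η t)) s x := by
  have hmem := memLp_momentWork hS hW (memLp_curv hL q) hα
  obtain ⟨M, hM⟩ : ∃ M : Fin 3 → Fin 3 → L2 (Ioo 0 L) ℝ, ∀ i j,
      M i j =ᵐ[volume.restrict (Ioo 0 L)] fun t =>
        momentWork W (curv q t) (α t) (Matrix.single i j 1) :=
    ⟨fun i j => (hmem i j).toLp _, fun i j => (hmem i j).coeFn_toLp⟩
  have hα' : ∀ᵐ t ∂(volume.restrict (Ioo 0 L)),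
      IsWarping W (Matrix.of fun i j => curvL2 hL (γ x) i j t) (α t) := by
    rw [hq]
    filter_upwards [hα, curvL2_ae_matrix hL q] with t h1 h2
    rw [h2]
    exact h1
  have hM' : ∀ i j, M i j =ᵐ[volume.restrict (Ioo 0 L)] fun t =>
      momentWork W (Matrix.of fun i j => curvL2 hL (γ x) i j t) (α t) (Matrix.single i j 1) := by
    intro i j
    rw [hq]
    filter_upwards [hM i j, curvL2_ae_matrix hL q] with t h1 h2
    rw [h2, h1]
  have h1 := hasDerivWithinAt_fieldEnergy (a := fun ε => curvL2 hL (γ ε)) hS hW hα' hM'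
    (hasDerivWithinAt_curvL2 hL hγ)
  have h2 : HasDerivWithinAt (fun ε => inner ℝ (hg.toLp g) (toL2 L (midFiberW12 L (γ ε))))
      (inner ℝ (hg.toLp g) (toL2 L (midFiberW12 L η))) s x := by
    have h3 := HasDerivWithinAt.clm_map (E := Config L) (F := W12 L) (midFiberW12 L) hγ
    have h4 := HasDerivWithinAt.clm_map (toL2 L) h3
    exact HasDerivWithinAt.clm_map (innerSL ℝ (hg.toLp g)) h4
  have h3 := (h1.const_mul (1 / 2)).fun_sub h2
  have e : 1 / 2 * (2 * ∑ i, ∑ j, inner ℝ (M i j) (curvVar hL (γ x) η i j)) =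
      ∫ t in Ioo 0 L, momentWork W (curv q t) (α t)
        (Matrix.of fun i j => curvVar hL q η i j t) := by
    rw [one_div, inv_mul_cancel_left₀ two_ne_zero, hq]
    exact sum_inner_eq_integral_momentWork hM _
  refine (h3.congr (fun ε _ => J2_eq hL hg (γ ε)) (J2_eq hL hg (γ x))).congr_deriv ?_
  rw [e, inner_toLp_midFiber]

end FirstVariationTheorem

end Rod

namespace Rod

/-! ### Frames and their variations -/

section Frames

variable {L : ℝ}

lemma IsPrim.inner {c d w v : ℝ → E3} (h : IsPrim L c w) (h' : IsPrim L d v) :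
    IsPrim L (fun t => inner ℝ (c t) (d t)) (fun t => inner ℝ (w t) (d t) + inner ℝ (c t) (v t)) := by
  have h1 := IsPrim.sum Finset.univ fun i _ =>
    (isPrim_iff_apply.1 h i).mul (isPrim_iff_apply.1 h' i)
  simpa only [inner_eq_sum, ← Finset.sum_add_distrib] using h1

lemma W12.inner_isPrim (hL : 0 < L) (U V : W12 L) :
    IsPrim L (fun t => inner ℝ (W12.rep hL U t) (W12.rep hL V t))
      (fun t => inner ℝ (U.1.2 t) (V.1.1 t) + inner ℝ (U.1.1 t) (V.1.2 t)) := by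
  refine ((W12.rep_isPrim hL U).inner (W12.rep_isPrim hL V)).congr_deriv ?_
  filter_upwards [W12.ae_eq_rep hL U, W12.ae_eq_rep hL V] with t h1 h2
  rw [h1, h2]

lemma orthonormal_of_mem_SO3 {R : M3} (h : R ∈ SO3) (k j : Fin 3) :
    ∑ i, R i k * R i j = if k = j then 1 else 0 := by
  have h1 : Rᵀ * R = 1 := by
    have := ((Matrix.mem_specialOrthogonalGroup_iff).1 h).1
    rw [Matrix.mem_orthogonalGroup_iff'] at this
    simpa using this
  have h2 := congrFun (congrFun h1 k) j
  simpa [Matrix.mul_apply, Matrix.one_apply] using h2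

lemma orthonormal_of_mem_SO3' {R : M3} (h : R ∈ SO3) (k j : Fin 3) :
    ∑ i, R k i * R j i = if k = j then 1 else 0 := by
  have h1 : R * Rᵀ = 1 := by
    have := ((Matrix.mem_specialOrthogonalGroup_iff).1 h).1
    rw [Matrix.mem_orthogonalGroup_iff] at this
    simpa using this
  have h2 := congrFun (congrFun h1 k) j
  simpa [Matrix.mul_apply, Matrix.one_apply] using h2

lemma inner_column_column {q : Config L} {t : ℝ} (h : rot q t ∈ SO3) (k j : Fin 3) :
    inner ℝ ((column L k q).1.1 t) ((column L j q).1.1 t) = if k = j then (1 : ℝ) else 0 := by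
  rw [← orthonormal_of_mem_SO3 h k j, inner_eq_sum]
  simp only [rot_apply]

/-- Parseval's identity for the frame `R`. -/
lemma inner_eq_sum_column {q : Config L} {t : ℝ} (h : rot q t ∈ SO3) (a b : E3) :
    inner ℝ a b = ∑ l, inner ℝ ((column L l q).1.1 t) a * inner ℝ ((column L l q).1.1 t) b := by
  have h1 := orthonormal_of_mem_SO3' h
  simp only [rot_apply, Fin.sum_univ_three] at h1
  have h00 := h1 0 0
  have h01 := h1 0 1
  have h02 := h1 0 2
  have h11 := h1 1 1
  have h12 := h1 1 2
  have h22 := h1 2 2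
  simp only [inner_eq_sum, Fin.sum_univ_three]
  simp at h00 h01 h02 h11 h12 h22
  -- The relation `R Rᵀ = 1` contracted with `a` and `b`.
  linear_combination (-(a 0 * b 0)) * h00 - (a 0 * b 1 + a 1 * b 0) * h01
    - (a 0 * b 2 + a 2 * b 0) * h02 - (a 1 * b 1) * h11 - (a 1 * b 2 + a 2 * b 1) * h12
    - (a 2 * b 2) * h22

/-- The inner products of the columns of `R` are constant, so their a.e. derivatives, the entries of
`A + Aᵀ`, vanish. -/
lemma curv_skew (hL : 0 < L) {q : Config L} (hq : q ∈ classA L) :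
    ∀ᵐ t ∂(volume.restrict (Ioo 0 L)), ∀ k j, curv q t k j = - curv q t j k := by
  refine ae_all_iff.2 fun k => ae_all_iff.2 fun j => ?_
  have hq' : ∀ᵐ t ∂(volume.restrict (Ioo 0 L)), rot q t ∈ SO3 := hq
  have h1 := W12.inner_isPrim hL (column L k q) (column L j q)
  have h2 := IsPrim.const (L := L) (if k = j then (1 : ℝ) else 0)
  have h3 : EqOn (fun t => inner ℝ (W12.rep hL (column L k q) t) (W12.rep hL (column L j q) t))
      (fun _ => if k = j then (1 : ℝ) else 0) (Icc 0 L) := by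
    refine eqOn_Icc_of_ae_eq hL h1.continuousOn h2.continuousOn ?_
    filter_upwards [hq', W12.ae_eq_rep hL (column L k q), W12.ae_eq_rep hL (column L j q)]
      with t ht hk hj
    rw [← hk, ← hj]
    exact inner_column_column ht k j
  filter_upwards [h1.ae_eq_of_eqOn h2 (h3.mono Ioo_subset_Icc_self)] with t ht
  have e1 := curv_apply q t k j
  have e2 := curv_apply q t j k
  have e3 := real_inner_comm ((column L k q).1.2 t) ((column L j q).1.1 t)
  linarith

lemma hasDerivWithinAt_eq_zero_of_const {E : Type*} [NormedAddCommGroup E] [NormedSpace ℝ E]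
    {f : ℝ → E} {f' : E} (h : HasDerivWithinAt f f' (Icc 0 1) 0)
    (hc : ∀ ε ∈ Icc (0 : ℝ) 1, f ε = f 0) : f' = 0 := by
  have h1 : HasDerivWithinAt f 0 (Icc 0 1) 0 :=
    (hasDerivWithinAt_const (0 : ℝ) (Icc 0 1) (f 0)).congr hc rfl
  exact (uniqueDiffOn_Icc zero_lt_one 0 (by simp)).eq_deriv _ h h1

variable {γ : ℝ → Config L} {q η : Config L}

/-- The product of `U` and `V` is a constant curve in `L²`; the product rule for `pairing` gives its
derivative, which must be zero. -/
lemma inner_var_add_eq_zero (hL : 0 < L) {U V : ℝ → W12 L} {U' V' : W12 L}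
    (hU : HasDerivWithinAt U U' (Icc 0 1) 0) (hV : HasDerivWithinAt V V' (Icc 0 1) 0) {c : ℝ}
    (hc : ∀ ε ∈ Icc (0 : ℝ) 1, ∀ᵐ t ∂(volume.restrict (Ioo 0 L)),
      inner ℝ ((U ε).1.1 t) ((V ε).1.1 t) = c) :
    ∀ᵐ t ∂(volume.restrict (Ioo 0 L)),
      inner ℝ (U'.1.1 t) ((V 0).1.1 t) + inner ℝ ((U 0).1.1 t) (V'.1.1 t) = 0 := by
  have h3 := hasDerivWithinAt_pairing hL hU (HasDerivWithinAt.clm_map (toL2 L) hV)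
  have h5 : ∀ ε ∈ Icc (0 : ℝ) 1, pairing hL (U ε) (toL2 L (V ε))
      =ᵐ[volume.restrict (Ioo 0 L)] fun _ => c := by
    intro ε hε
    filter_upwards [hc ε hε, pairing_ae hL (U ε) (toL2 L (V ε))] with t h7 h8
    exact h8.trans h7
  have h6 := hasDerivWithinAt_eq_zero_of_const h3 fun ε hε =>
    Lp.ext ((h5 ε hε).trans (h5 0 (by simp)).symm)
  filter_upwards [pairing_ae hL U' (toL2 L (V 0)), pairing_ae hL (U 0) (toL2 L V'),
    Lp.coeFn_add (pairing hL U' (toL2 L (V 0))) (pairing hL (U 0) (toL2 L V')),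
    Lp.coeFn_zero ℝ 2 (volume.restrict (Ioo 0 L))] with t e1 e2 e3 e4
  rw [h6] at e3
  exact (congrArg₂ (· + ·) e1 e2).symm.trans (e3.symm.trans e4)

/-- Variations within `𝓐` are of the form `R B` with `B` skew. -/
lemma column_var_skew (hL : 0 < L) (hγ : HasDerivWithinAt γ η (Icc 0 1) 0) (hq : γ 0 = q)
    (hA : ∀ ε ∈ Icc (0 : ℝ) 1, γ ε ∈ classA L) :
    ∀ᵐ t ∂(volume.restrict (Ioo 0 L)), ∀ k j,
      inner ℝ ((column L k q).1.1 t) ((column L j η).1.1 t) =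
        - inner ℝ ((column L j q).1.1 t) ((column L k η).1.1 t) := by
  subst hq
  refine ae_all_iff.2 fun k => ae_all_iff.2 fun j => ?_
  have h1 := HasDerivWithinAt.clm_map (E := Config L) (F := W12 L) (column L k) hγ
  have h2 := HasDerivWithinAt.clm_map (E := Config L) (F := W12 L) (column L j) hγ
  have h3 := inner_var_add_eq_zero hL h1 h2 (c := if k = j then 1 else 0) fun ε hε => by
    filter_upwards [hA ε hε] with t ht using inner_column_column ht k j
  filter_upwards [h3] with t ht
  have e := real_inner_comm ((column L j (γ 0)).1.1 t) ((column L k η).1.1 t)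
  linarith

/-- Along the curve `A + Aᵀ` is zero in `L²`, hence so is its derivative. -/
lemma curvVar_skew (hL : 0 < L) (hγ : HasDerivWithinAt γ η (Icc 0 1) 0) (hq : γ 0 = q)
    (hA : ∀ ε ∈ Icc (0 : ℝ) 1, γ ε ∈ classA L) :
    ∀ᵐ t ∂(volume.restrict (Ioo 0 L)), ∀ k j, curvVar hL q η k j t = - curvVar hL q η j k t := by
  subst hq
  refine ae_all_iff.2 fun k => ae_all_iff.2 fun j => ?_
  have h3 := (hasDerivWithinAt_curvL2 hL hγ k j).fun_add (hasDerivWithinAt_curvL2 hL hγ j k)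
  have h4 : ∀ ε ∈ Icc (0 : ℝ) 1, curvL2 hL (γ ε) k j + curvL2 hL (γ ε) j k =
      curvL2 hL (γ 0) k j + curvL2 hL (γ 0) j k := by
    have h5 : ∀ ε ∈ Icc (0 : ℝ) 1, curvL2 hL (γ ε) k j + curvL2 hL (γ ε) j k = 0 := by
      intro ε hε
      apply Lp.ext
      filter_upwards [curv_skew hL (hA ε hε), curvL2_ae hL (γ ε) k j, curvL2_ae hL (γ ε) j k,
        Lp.coeFn_add (curvL2 hL (γ ε) k j) (curvL2 hL (γ ε) j k),
        Lp.coeFn_zero ℝ 2 (volume.restrict (Ioo 0 L))] with t h6 h7 h8 h9 h10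
      rw [h9, h10, Pi.add_apply, h7, h8, h6 k j, neg_add_cancel, Pi.zero_apply]
    intro ε hε
    rw [h5 ε hε, h5 0 (by simp)]
  have h5 := hasDerivWithinAt_eq_zero_of_const h3 h4
  filter_upwards [Lp.coeFn_add (curvVar hL (γ 0) η k j) (curvVar hL (γ 0) η j k),
    Lp.coeFn_zero ℝ 2 (volume.restrict (Ioo 0 L))] with t e1 e2
  rw [h5, e2, Pi.add_apply, Pi.zero_apply] at e1
  linarith

lemma HasValueAt.rep_eq (hL : 0 < L) {U : W12 L} {a : E3} (h : HasValueAt L (⇑U.1.1) 0 a) :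
    W12.rep hL U 0 = a := by
  obtain ⟨c, hc, hu, h0⟩ := h
  rw [← h0]
  exact eqOn_Icc_of_ae_eq hL (W12.rep_isPrim hL U).continuousOn hc
    ((W12.ae_eq_rep hL U).symm.trans hu) ⟨le_rfl, hL.le⟩

/-- The value at `0` is thus carried by the constant class `U - volterra U'`. This is bounded and
linear in `U`, so boundary conditions can be differentiated along a curve. -/
lemma W12.ae_eq_add_volterra (hL : 0 < L) (U : W12 L) :
    ∀ᵐ t ∂(volume.restrict (Ioo 0 L)), U.1.1 t = W12.rep hL U 0 + volterra L U.1.2 t := by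
  filter_upwards [W12.ae_eq_rep hL U, volterra_ae U.1.2, ae_restrict_mem measurableSet_Ioo]
    with t h1 h2 ht
  rw [h1, h2, (W12.rep_isPrim hL U).eq_integral t (Ioo_subset_Icc_self ht)]

lemma W12.rep_zero_eq (hL : 0 < L) {U V : W12 L}
    (h : toL2 L U - volterra L (derivL2 L U) = toL2 L V - volterra L (derivL2 L V)) :
    W12.rep hL U 0 = W12.rep hL V 0 := by
  have h1 : ∀ᵐ t ∂(volume.restrict (Ioo 0 L)), W12.rep hL U 0 = W12.rep hL V 0 := by
    filter_upwards [W12.ae_eq_add_volterra hL U, W12.ae_eq_add_volterra hL V,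
      Lp.coeFn_sub (toL2 L U) (volterra L (derivL2 L U)),
      Lp.coeFn_sub (toL2 L V) (volterra L (derivL2 L V))] with t h1 h2 h3 h4
    rw [h, h4, Pi.sub_apply, Pi.sub_apply] at h3
    simp only [toL2_apply, derivL2_apply, h1, h2, add_sub_cancel_right] at h3
    exact h3.symm
  -- An a.e. equality of constants is an equality once the measure is nonzero.
  have : (volume.restrict (Ioo 0 L)) ≠ 0 := by
    simp [hL]
  have : NeZero (volume.restrict (Ioo 0 L)) := ⟨this⟩
  exact h1.exists.choose_spec

lemma W12.sub_volterra_eq (hL : 0 < L) {U V : W12 L} (h : W12.rep hL U 0 = W12.rep hL V 0) :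
    toL2 L U - volterra L (derivL2 L U) = toL2 L V - volterra L (derivL2 L V) := by
  apply Lp.ext
  filter_upwards [W12.ae_eq_add_volterra hL U, W12.ae_eq_add_volterra hL V,
    Lp.coeFn_sub (toL2 L U) (volterra L (derivL2 L U)),
    Lp.coeFn_sub (toL2 L V) (volterra L (derivL2 L V))] with t h1 h2 h3 h4
  rw [h3, h4, Pi.sub_apply, Pi.sub_apply]
  simp only [toL2_apply, derivL2_apply, h1, h2, add_sub_cancel_right, h]

lemma W12.rep_zero_of_zero (hL : 0 < L) : W12.rep hL (0 : W12 L) 0 = 0 := by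
  refine HasValueAt.rep_eq hL ⟨fun _ => 0, continuousOn_const, ?_, rfl⟩
  have : (0 : W12 L).1.1 = 0 := rfl
  rw [this]
  exact Lp.coeFn_zero E3 2 _

/-- A variation of functions with a fixed value at `0` vanishes at `0`. -/
lemma W12.rep_zero_of_hasDerivWithinAt (hL : 0 < L) {U : ℝ → W12 L} {U' : W12 L}
    (hU : HasDerivWithinAt U U' (Icc 0 1) 0) {a : E3}
    (h : ∀ ε ∈ Icc (0 : ℝ) 1, HasValueAt L (⇑(U ε).1.1) 0 a) : W12.rep hL U' 0 = 0 := by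
  have h1 := (HasDerivWithinAt.clm_map (toL2 L) hU).fun_sub
    (HasDerivWithinAt.clm_map (volterra L) (HasDerivWithinAt.clm_map (derivL2 L) hU))
  have h2 := hasDerivWithinAt_eq_zero_of_const h1 fun ε hε =>
    W12.sub_volterra_eq hL ((h ε hε).rep_eq hL |>.trans ((h 0 (by simp)).rep_eq hL).symm)
  rw [← W12.rep_zero_of_zero hL]
  refine W12.rep_zero_eq hL ?_
  rw [h2, map_zero, map_zero, map_zero, sub_zero]

end Frames

end Rod

namespace Rod

/-! ### The Euler–Lagrange form of the first variation -/

section EulerLagrange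

variable {S : Set E2} {W : M3 → ℝ≥0∞} {L : ℝ}

lemma momentWork_single_one (q : Config L) (α : ℝ → W12S S) (t : ℝ) (i : Fin 3) :
    momentWork W (curv q t) (α t) (Matrix.single i 1 1) = momentTilde W q α t i 0 := by
  simp only [momentWork, Fin.sum_univ_three, Matrix.single_apply, momentTilde, Matrix.of_apply]
  fin_cases i <;> simp

lemma momentWork_single_two (q : Config L) (α : ℝ → W12S S) (t : ℝ) (i : Fin 3) :
    momentWork W (curv q t) (α t) (Matrix.single i 2 1) = momentHat W q α t i 0 := by
  simp only [momentWork, Fin.sum_univ_three, Matrix.single_apply, momentHat, Matrix.of_apply]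
  fin_cases i <;> simp

lemma memLp_momentTilde (hL : 0 < L) (hS : IsCrossSection S) (hW : IsEnergyDensity W) {q : Config L}
    {α : ℝ → W12S S} (hα : ∀ᵐ t ∂(volume.restrict (Ioo 0 L)), IsWarping W (curv q t) (α t))
    (i : Fin 3) : MemLp (fun t => momentTilde W q α t i 0) 2 (volume.restrict (Ioo 0 L)) := by
  simpa only [momentWork_single_one] using memLp_momentWork hS hW (memLp_curv hL q) hα i 1

lemma memLp_momentHat (hL : 0 < L) (hS : IsCrossSection S) (hW : IsEnergyDensity W) {q : Config L}
    {α : ℝ → W12S S} (hα : ∀ᵐ t ∂(volume.restrict (Ioo 0 L)), IsWarping W (curv q t) (α t))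
    (i : Fin 3) : MemLp (fun t => momentHat W q α t i 0) 2 (volume.restrict (Ioo 0 L)) := by
  simpa only [momentWork_single_two] using memLp_momentWork hS hW (memLp_curv hL q) hα i 2

lemma isPrim_primitive_end (hL : 0 < L) {g : ℝ → E3} (hg : IntegrableOn g (Ioo 0 L)) :
    IsPrim L (primitive L g) g := by
  refine ⟨hg, fun t ht => ?_⟩
  have h0 : (0 : ℝ) ∈ Icc 0 L := ⟨le_rfl, hL.le⟩
  have h1 : L ∈ Icc 0 L := ⟨hL.le, le_rfl⟩
  rw [primitive, primitive, intervalIntegral.integral_add_adjacent_intervals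
    (intervalIntegrable_of_integrableOn_Ioo hg h1 h0)
    (intervalIntegrable_of_integrableOn_Ioo hg h0 ht)]

lemma transpose_rot_mulVec (q : Config L) (t : ℝ) (v : E3) (l : Fin 3) :
    ((rot q t)ᵀ *ᵥ v.ofLp) l = inner ℝ ((column L l q).1.1 t) v := by
  rw [inner_eq_sum]
  simp only [Matrix.mulVec, dotProduct, Matrix.transpose_apply, rot_apply]

lemma memLp_transpose_rot_primitive (hL : 0 < L) {g : ℝ → E3} (hg : IntegrableOn g (Ioo 0 L))
    (q : Config L) (l : Fin 3) :
    MemLp (fun t => ((rot q t)ᵀ *ᵥ (primitive L g t).ofLp) l) 2 (volume.restrict (Ioo 0 L)) := by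
  have h1 := memLp_of_isPrim (isPrim_primitive_end hL hg)
  simp only [transpose_rot_mulVec]
  refine (memLp_congr_ae ?_).1 (W12.memLp_inner hL (column L l q) (h1.toLp _))
  filter_upwards [h1.coeFn_toLp] with t ht
  rw [ht]

/-- The entries of `B = Rᵀ Ṙ`. -/
noncomputable def frameVar (q η : Config L) (k j : Fin 3) (t : ℝ) : ℝ :=
  inner ℝ ((column L k q).1.1 t) ((column L j η).1.1 t)

/-- The derivatives of the entries of `B = Rᵀ Ṙ`. -/
noncomputable def frameVarDeriv (q η : Config L) (k j : Fin 3) (t : ℝ) : ℝ :=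
  inner ℝ ((column L k q).1.2 t) ((column L j η).1.1 t) +
    inner ℝ ((column L k q).1.1 t) ((column L j η).1.2 t)

lemma memLp_frameVarDeriv (hL : 0 < L) (q η : Config L) (k j : Fin 3) :
    MemLp (frameVarDeriv q η k j) 2 (volume.restrict (Ioo 0 L)) := by
  refine MemLp.add ?_ (W12.memLp_inner hL _ _)
  refine (memLp_congr_ae (Filter.Eventually.of_forall fun t => ?_)).1
    (W12.memLp_inner hL (column L j η) (column L k q).1.2)
  exact real_inner_comm ((column L k q).1.2 t) ((column L j η).1.1 t)

/-- The continuous representative of an entry of `B` vanishes at `0` together with the column of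
`η`. -/
lemma exists_isPrim_frameVar (hL : 0 < L) (q η : Config L) (k j : Fin 3)
    (h0 : W12.rep hL (column L j η) 0 = 0) :
    ∃ β, IsPrim L β (frameVarDeriv q η k j) ∧ β 0 = 0 ∧
      frameVar q η k j =ᵐ[volume.restrict (Ioo 0 L)] β := by
  refine ⟨_, W12.inner_isPrim hL (column L k q) (column L j η), ?_, ?_⟩
  · simp only [h0, inner_zero_right]
  · filter_upwards [W12.ae_eq_rep hL (column L k q), W12.ae_eq_rep hL (column L j η)] with t h1 h2
    simp only [frameVar, h1, h2]

/-- This is `Ȧ = B' + BᵀA - AᵀB`. The variation of `A` and `B'` share the term `R · Ṙ'`; the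
remaining products of `Ṙ` with `R'` are expanded in the orthonormal frame by Parseval's identity. -/
lemma curvVar_eq (hL : 0 < L) {q : Config L} (hq : q ∈ classA L) (η : Config L) :
    ∀ᵐ t ∂(volume.restrict (Ioo 0 L)), ∀ k j, curvVar hL q η k j t = frameVarDeriv q η k j t +
      ∑ l, frameVar q η l k t * curv q t l j - ∑ l, curv q t l k * frameVar q η l j t := by
  refine ae_all_iff.2 fun k => ae_all_iff.2 fun j => ?_
  have hq' : ∀ᵐ t ∂(volume.restrict (Ioo 0 L)), rot q t ∈ SO3 := hq
  filter_upwards [hq', pairing_ae hL (column L k η) (derivL2 L (column L j q)),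
    pairing_ae hL (column L k q) (derivL2 L (column L j η)),
    Lp.coeFn_add (pairing hL (column L k η) (derivL2 L (column L j q)))
      (pairing hL (column L k q) (derivL2 L (column L j η)))] with t ht e1 e2 e3
  have e4 := inner_eq_sum_column ht ((column L k η).1.1 t) ((column L j q).1.2 t)
  have e5 := inner_eq_sum_column ht ((column L k q).1.2 t) ((column L j η).1.1 t)
  simp only [curv_apply]
  have e6 : curvVar hL q η k j t = inner ℝ ((column L k η).1.1 t) ((column L j q).1.2 t) +
      inner ℝ ((column L k q).1.1 t) ((column L j η).1.2 t) :=
    e3.trans (congrArg₂ (· + ·) e1 e2)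
  simp only [frameVarDeriv, frameVar]
  linarith

lemma columnZero_deriv (η : Config L) : (midFiberW12 L η).1.2 = (column L 0 η).1.1 := by
  rw [midFiberW12_apply, column_zero]
  exact η.1.2

/-- The work of the load, integrated by parts. -/
lemma integral_load (hL : 0 < L) {g : ℝ → E3} (hg : IntegrableOn g (Ioo 0 L)) {q : Config L}
    (hq : q ∈ classA L) {η : Config L} (h0 : W12.rep hL (midFiberW12 L η) 0 = 0) :
    ∫ t in Ioo 0 L, inner ℝ (g t) (midFiber η t) = - ∫ t in Ioo 0 L,
      ∑ l, frameVar q η l 0 t * ((rot q t)ᵀ *ᵥ (primitive L g t).ofLp) l := by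
  have hq' : ∀ᵐ t ∂(volume.restrict (Ioo 0 L)), rot q t ∈ SO3 := hq
  set Y := midFiberW12 L η with hY
  have hG := isPrim_primitive_end hL hg
  have hP := hG.inner (W12.rep_isPrim hL Y)
  have h1 := hP.sub_eq ⟨le_rfl, hL.le⟩ ⟨hL.le, le_rfl⟩
  -- No boundary terms remain: `g̃` vanishes at `L` and the variation of `y` at `0`.
  have hGL : primitive L g L = 0 := by simp [primitive]
  simp only [h0, hGL, inner_zero_left, inner_zero_right, sub_zero] at h1
  rw [← setIntegral_Ioo_eq_intervalIntegral hL.le] at h1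
  have hi1 : Integrable (fun t => inner ℝ (primitive L g t) (Y.1.2 t)) (volume.restrict (Ioo 0 L)) := by
    obtain ⟨C, hC⟩ := hG.exists_bound
    refine ((L2.integrableOn Y.1.2).norm.const_mul C).mono'
      (hG.aestronglyMeasurable.inner (Lp.aestronglyMeasurable _)) ?_
    filter_upwards [ae_restrict_mem measurableSet_Ioo] with t ht
    exact (norm_inner_le_norm _ _).trans (by gcongr; exact hC t (Ioo_subset_Icc_self ht))
  have hi2 : Integrable (fun t => inner ℝ (g t) (W12.rep hL Y t)) (volume.restrict (Ioo 0 L)) := by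
    refine (hP.integrableOn.sub hi1).congr (Filter.Eventually.of_forall fun t => ?_)
    simp
  rw [integral_add hi2 hi1] at h1
  have e1 : ∫ t in Ioo 0 L, inner ℝ (g t) (midFiber η t) =
      ∫ t in Ioo 0 L, inner ℝ (g t) (W12.rep hL Y t) := by
    refine integral_congr_ae ?_
    filter_upwards [W12.ae_eq_rep hL Y] with t ht
    rw [← ht, hY, midFiberW12_apply]
    rfl
  have e2 : ∫ t in Ioo 0 L, ∑ l, frameVar q η l 0 t * ((rot q t)ᵀ *ᵥ (primitive L g t).ofLp) l =
      ∫ t in Ioo 0 L, inner ℝ (primitive L g t) (Y.1.2 t) := by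
    refine integral_congr_ae ?_
    filter_upwards [hq'] with t ht
    rw [hY, columnZero_deriv, real_inner_comm, inner_eq_sum_column ht]
    simp only [transpose_rot_mulVec, frameVar]
  rw [e1, e2]
  linarith

/-- `∫ (p β' + f β)`, where `β` is an entry of the variation `B = Rᵀ Ṙ`. -/
noncomputable def weakResidual (q η : Config L) (p f : ℝ → ℝ) (k j : Fin 3) : ℝ :=
  ∫ t in Ioo 0 L, (p t * frameVarDeriv q η k j t + f t * frameVar q η k j t)

lemma integrable_weakResidual (hL : 0 < L) {q η : Config L} {p f : ℝ → ℝ} {k j : Fin 3}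
    (hp : MemLp p 2 (volume.restrict (Ioo 0 L))) (hf : IntegrableOn f (Ioo 0 L))
    (h0 : W12.rep hL (column L j η) 0 = 0) :
    Integrable (fun t => p t * frameVarDeriv q η k j t + f t * frameVar q η k j t)
      (volume.restrict (Ioo 0 L)) := by
  obtain ⟨β, hβ, -, hβe⟩ := exists_isPrim_frameVar hL q η k j h0
  refine (hp.integrable_mul (memLp_frameVarDeriv hL q η k j)).add
    ((hβ.integrableOn_mul_left hf).congr ?_)
  filter_upwards [hβe] with t ht
  rw [ht, mul_comm]

/-- Integration by parts of `(pβ)'`; the boundary terms vanish for opposite reasons, `p(L) = 0` and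
`β(0) = 0`. -/
lemma weakResidual_eq_zero (hL : 0 < L) {q η : Config L} {p f : ℝ → ℝ} {k j : Fin 3}
    (h : SolvesWithZeroEnd L p f) (h0 : W12.rep hL (column L j η) 0 = 0) :
    weakResidual q η p f k j = 0 := by
  obtain ⟨β, hβ, hβ0, hβe⟩ := exists_isPrim_frameVar hL q η k j h0
  obtain ⟨hp, hf, hw, c, hc, hpc, hcL⟩ := h
  obtain ⟨d, hd, hpd⟩ := hw.exists_isPrim_real hL hp hf
  have hdL : d L = 0 := by
    rw [← hcL]
    exact eqOn_Icc_of_ae_eq hL hd.continuousOn hc (hpd.symm.trans hpc) ⟨hL.le, le_rfl⟩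
  have h1 := hd.integral_mul hβ hL.le
  rw [hdL, hβ0, zero_mul, mul_zero, sub_zero] at h1
  refine (integral_congr_ae ?_).trans h1
  filter_upwards [hpd, hβe] with t e1 e2
  rw [e1, e2]
  ring

variable {g : ℝ → E3} {q η : Config L} {α : ℝ → W12S S}

/-- The right-hand sides of the Euler–Lagrange system. -/
noncomputable def elRhs (A Et Eh : ℝ → M3) (G : ℝ → Fin 3 → ℝ) : Fin 3 → ℝ → ℝ :=
  ![fun t => A t 0 2 * (Eh t 1 0 - Et t 2 0) - A t 1 2 * Eh t 0 0 - G t 1,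
    fun t => -(A t 0 1) * (Eh t 1 0 - Et t 2 0) + A t 1 2 * Et t 0 0 - G t 2,
    fun t => A t 0 1 * Eh t 0 0 - A t 0 2 * Et t 0 0]

/-- The unknowns of the Euler–Lagrange system. -/
noncomputable def elMoment (Et Eh : ℝ → M3) : Fin 3 → ℝ → ℝ :=
  ![fun t => Et t 0 0, fun t => Eh t 0 0, fun t => Eh t 1 0 - Et t 2 0]

lemma eulerLagrangeSystem_iff (A Et Eh : ℝ → M3) (G : ℝ → Fin 3 → ℝ) :
    EulerLagrangeSystem L A Et Eh G ↔
      ∀ n, SolvesWithZeroEnd L (elMoment Et Eh n) (elRhs A Et Eh G n) := by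
  refine ⟨fun h n => ?_, fun h => ⟨h 0, h 1, h 2⟩⟩
  fin_cases n
  exacts [h.1, h.2.1, h.2.2]

lemma memLp_elMoment (hL : 0 < L) (hS : IsCrossSection S) (hW : IsEnergyDensity W)
    (hα : ∀ᵐ t ∂(volume.restrict (Ioo 0 L)), IsWarping W (curv q t) (α t)) (n : Fin 3) :
    MemLp (elMoment (momentTilde W q α) (momentHat W q α) n) 2 (volume.restrict (Ioo 0 L)) := by
  have ht := memLp_momentTilde hL hS hW hα
  have hh := memLp_momentHat hL hS hW hα
  fin_cases n
  · exact ht 0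
  · exact hh 0
  · exact (hh 1).sub (ht 2)

lemma integrable_elRhs (hL : 0 < L) (hS : IsCrossSection S) (hW : IsEnergyDensity W)
    (hg : IntegrableOn g (Ioo 0 L))
    (hα : ∀ᵐ t ∂(volume.restrict (Ioo 0 L)), IsWarping W (curv q t) (α t)) (n : Fin 3) :
    IntegrableOn (elRhs (curv q) (momentTilde W q α) (momentHat W q α)
      (fun t => (rot q t)ᵀ *ᵥ (primitive L g t).ofLp) n) (Ioo 0 L) := by
  have ht := memLp_momentTilde hL hS hW hα
  have hh := memLp_momentHat hL hS hW hα
  have hA := memLp_curv hL q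
  have hG := fun l => (memLp_transpose_rot_primitive hL hg q l).integrable one_le_two
  fin_cases n
  · exact (((hA 0 2).integrable_mul ((hh 1).sub (ht 2))).sub ((hA 1 2).integrable_mul (hh 0))).sub
      (hG 1)
  · exact (((hA 0 1).neg.integrable_mul ((hh 1).sub (ht 2))).add
      ((hA 1 2).integrable_mul (ht 0))).sub (hG 2)
  · exact ((hA 0 1).integrable_mul (hh 0)).sub ((hA 0 2).integrable_mul (ht 0))

/-- The integrand of the first variation, for skew-symmetric matrices `A`, `β` and `X`. -/
lemma moment_algebra {A β X b : Fin 3 → Fin 3 → ℝ} {Et Eh G : Fin 3 → ℝ}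
    (hA : ∀ k j, A k j = - A j k) (hβ : ∀ k j, β k j = - β j k) (hX : ∀ k j, X k j = - X j k)
    (h : ∀ k j, X k j = b k j + ∑ l, β l k * A l j - ∑ l, A l k * β l j) :
    (∑ i, (Et i * X i 1 + Eh i * X i 2)) + ∑ l, β l 0 * G l =
      (Et 0 * b 0 1 + (A 0 2 * (Eh 1 - Et 2) - A 1 2 * Eh 0 - G 1) * β 0 1) +
      (Eh 0 * b 0 2 + (-(A 0 1) * (Eh 1 - Et 2) + A 1 2 * Et 0 - G 2) * β 0 2) +
      ((Eh 1 - Et 2) * b 1 2 + (A 0 1 * Eh 0 - A 0 2 * Et 0) * β 1 2) := by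
  have d : ∀ {M : Fin 3 → Fin 3 → ℝ}, (∀ k j, M k j = - M j k) → ∀ k, M k k = 0 := by
    intro M hM k
    have := hM k k
    linarith
  simp only [Fin.sum_univ_three]
  -- Skewness removes `X 1 1` and `X 2 2` and identifies `X 2 1` with `-X 1 2`; hence `Ê₂₁` and
  -- `Ẽ₃₁` enter only through their difference.
  rw [d hX 1, d hX 2, hX 2 1, h 0 1, h 0 2, h 1 2]
  simp only [Fin.sum_univ_three]
  rw [d hβ 0, d hβ 1, d hβ 2, d hA 0, d hA 1, d hA 2, hβ 1 0, hβ 2 0, hβ 2 1,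
    hA 1 0, hA 2 0, hA 2 1]
  ring

/-- The first variation of `J₂` in terms of `B = Rᵀ Ṙ`. -/
theorem firstVariation_eq (hL : 0 < L) (hS : IsCrossSection S) (hW : IsEnergyDensity W)
    (hg : IntegrableOn g (Ioo 0 L)) (hq : q ∈ classA L)
    (hα : ∀ᵐ t ∂(volume.restrict (Ioo 0 L)), IsWarping W (curv q t) (α t))
    (hB : ∀ᵐ t ∂(volume.restrict (Ioo 0 L)), ∀ k j, frameVar q η k j t = - frameVar q η j k t)
    (hX : ∀ᵐ t ∂(volume.restrict (Ioo 0 L)), ∀ k j, curvVar hL q η k j t = - curvVar hL q η j k t)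
    (hY : W12.rep hL (midFiberW12 L η) 0 = 0) (h1 : W12.rep hL (column L 1 η) 0 = 0)
    (h2 : W12.rep hL (column L 2 η) 0 = 0) :
    (∫ t in Ioo 0 L, momentWork W (curv q t) (α t) (Matrix.of fun i j => curvVar hL q η i j t))
        - ∫ t in Ioo 0 L, inner ℝ (g t) (midFiber η t) =
      ∑ n, weakResidual q η (elMoment (momentTilde W q α) (momentHat W q α) n)
        (elRhs (curv q) (momentTilde W q α) (momentHat W q α)
          (fun t => (rot q t)ᵀ *ᵥ (primitive L g t).ofLp) n) (![0, 0, 1] n) (![1, 2, 2] n) := by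
  have hp := memLp_elMoment hL hS hW hα
  have hf := integrable_elRhs hL hS hW hg hα
  have i0 := integrable_weakResidual hL (q := q) (k := 0) (hp 0) (hf 0) h1
  have i1 := integrable_weakResidual hL (q := q) (k := 0) (hp 1) (hf 1) h2
  have i2 := integrable_weakResidual hL (q := q) (k := 1) (hp 2) (hf 2) h2
  have hmem := memLp_momentWork hS hW (memLp_curv hL q) hα
  have hi1 : Integrable (fun t => momentWork W (curv q t) (α t)
      (Matrix.of fun i j => curvVar hL q η i j t)) (volume.restrict (Ioo 0 L)) := by
    have h3 : Integrable (fun t => ∑ i, ∑ j, momentWork W (curv q t) (α t) (Matrix.single i j 1) *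
        curvVar hL q η i j t) (volume.restrict (Ioo 0 L)) :=
      integrable_finsetSum _ fun i _ => integrable_finsetSum _ fun j _ =>
        (hmem i j).integrable_mul (Lp.memLp _)
    refine h3.congr (Filter.Eventually.of_forall fun t => ?_)
    exact (momentWork_eq_sum _ _ _).symm
  have key : ∀ᵐ t ∂(volume.restrict (Ioo 0 L)),
      momentWork W (curv q t) (α t) (Matrix.of fun i j => curvVar hL q η i j t) +
        ∑ l, frameVar q η l 0 t * ((rot q t)ᵀ *ᵥ (primitive L g t).ofLp) l =
      (elMoment (momentTilde W q α) (momentHat W q α) 0 t * frameVarDeriv q η 0 1 t +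
        elRhs (curv q) (momentTilde W q α) (momentHat W q α)
          (fun t => (rot q t)ᵀ *ᵥ (primitive L g t).ofLp) 0 t * frameVar q η 0 1 t) +
      (elMoment (momentTilde W q α) (momentHat W q α) 1 t * frameVarDeriv q η 0 2 t +
        elRhs (curv q) (momentTilde W q α) (momentHat W q α)
          (fun t => (rot q t)ᵀ *ᵥ (primitive L g t).ofLp) 1 t * frameVar q η 0 2 t) +
      (elMoment (momentTilde W q α) (momentHat W q α) 2 t * frameVarDeriv q η 1 2 t +
        elRhs (curv q) (momentTilde W q α) (momentHat W q α)
          (fun t => (rot q t)ᵀ *ᵥ (primitive L g t).ofLp) 2 t * frameVar q η 1 2 t) := by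
    filter_upwards [hB, hX, curv_skew hL hq, curvVar_eq hL hq η] with t hB hX hA hE
    exact moment_algebra (A := fun k j => curv q t k j) (β := fun k j => frameVar q η k j t)
      (X := fun k j => curvVar hL q η k j t) (b := fun k j => frameVarDeriv q η k j t)
      (Et := fun i => momentTilde W q α t i 0) (Eh := fun i => momentHat W q α t i 0) hA hB hX hE
  -- The pointwise identity expresses the load term through functions already known to be
  -- integrable.
  have hi2 : Integrable (fun t => ∑ l, frameVar q η l 0 t *
      ((rot q t)ᵀ *ᵥ (primitive L g t).ofLp) l) (volume.restrict (Ioo 0 L)) := by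
    refine (((i0.add i1).add i2).sub hi1).congr ?_
    filter_upwards [key] with t ht
    exact sub_eq_of_eq_add' ht.symm
  rw [integral_load hL hg hq hY, sub_neg_eq_add, ← integral_add hi1 hi2, Fin.sum_univ_three,
    integral_congr_ae key]
  exact (integral_add (i0.add i1) i2).trans (congrArg₂ (· + ·) (integral_add i0 i1) rfl)

end EulerLagrange

end Rod

namespace Rod

/-! ### Admissible variations -/

section AdmissibleVariations

variable {S : Set E2} {W : M3 → ℝ≥0∞} {L : ℝ} {g : ℝ → E3} {q η : Config L} {α : ℝ → W12S S}
  {γ : ℝ → Config L}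

/-- The first variation of `J₂` along an admissible curve, in the Euler–Lagrange form. -/
theorem hasDerivWithinAt_J2_admissible (hL : 0 < L) (hS : IsCrossSection S) (hW : IsEnergyDensity W)
    (hg : MemLp g 2 (volume.restrict (Ioo 0 L)))
    (hα : ∀ᵐ t ∂(volume.restrict (Ioo 0 L)), IsWarping W (curv q t) (α t))
    (hγ : HasDerivWithinAt γ η (Icc 0 1) 0) (hq : γ 0 = q)
    (hA : ∀ ε ∈ Icc (0 : ℝ) 1, γ ε ∈ classA L ∧ IsClamped (γ ε)) :
    (∀ n : Fin 3, W12.rep hL (column L (![1, 2, 2] n) η) 0 = 0) ∧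
    HasDerivWithinAt (fun ε => J2 S W g (γ ε))
      (∑ n, weakResidual q η (elMoment (momentTilde W q α) (momentHat W q α) n)
        (elRhs (curv q) (momentTilde W q α) (momentHat W q α)
          (fun t => (rot q t)ᵀ *ᵥ (primitive L g t).ofLp) n) (![0, 0, 1] n) (![1, 2, 2] n))
      (Icc 0 1) 0 := by
  have hqA : q ∈ classA L := hq ▸ (hA 0 (by simp)).1
  have hA1 := fun ε hε => (hA ε hε).1
  have hY : W12.rep hL (midFiberW12 L η) 0 = 0 :=
    W12.rep_zero_of_hasDerivWithinAt hL (HasDerivWithinAt.clm_map (E := Config L) (F := W12 L)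
      (midFiberW12 L) hγ) fun ε hε => by rw [midFiberW12_apply]; exact (hA ε hε).2.1
  have h1 : W12.rep hL (column L 1 η) 0 = 0 :=
    W12.rep_zero_of_hasDerivWithinAt hL (HasDerivWithinAt.clm_map (E := Config L) (F := W12 L)
      (column L 1) hγ) fun ε hε => by rw [column_one]; exact (hA ε hε).2.2.1
  have h2 : W12.rep hL (column L 2 η) 0 = 0 :=
    W12.rep_zero_of_hasDerivWithinAt hL (HasDerivWithinAt.clm_map (E := Config L) (F := W12 L)
      (column L 2) hγ) fun ε hε => by rw [column_two]; exact (hA ε hε).2.2.2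
  refine ⟨fun n => ?_, (hasDerivWithinAt_J2 hL hS hW hg hγ hq hα).congr_deriv ?_⟩
  · fin_cases n
    exacts [h1, h2, h2]
  · exact firstVariation_eq hL hS hW (hg.integrable one_le_two) hqA hα
      (column_var_skew hL hγ hq hA1) (curvVar_skew hL hγ hq hA1) hY h1 h2

/-- The Euler–Lagrange system is sufficient for stationarity. -/
theorem isStationaryPoint_of_solves (hL : 0 < L) (hS : IsCrossSection S) (hW : IsEnergyDensity W)
    (hg : MemLp g 2 (volume.restrict (Ioo 0 L)))
    (hα : ∀ᵐ t ∂(volume.restrict (Ioo 0 L)), IsWarping W (curv q t) (α t))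
    (h : ∀ n, SolvesWithZeroEnd L (elMoment (momentTilde W q α) (momentHat W q α) n)
      (elRhs (curv q) (momentTilde W q α) (momentHat W q α)
        (fun t => (rot q t)ᵀ *ᵥ (primitive L g t).ofLp) n)) :
    IsStationaryPoint S W g q := by
  intro γ hγ hA hq
  have h1 : HasDerivWithinAt γ (derivWithin γ (Icc 0 1) 0) (Icc 0 1) 0 :=
    ((hγ.differentiableOn (by simp)) 0 (by simp)).hasDerivWithinAt
  obtain ⟨h0, h2⟩ := hasDerivWithinAt_J2_admissible hL hS hW hg hα h1 hq hA
  exact h2.congr_deriv (Finset.sum_eq_zero fun n _ => weakResidual_eq_zero hL (h n) (h0 n))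

end AdmissibleVariations

end Rod

namespace Rod

/-! ### Multiplication of `L²` fields by continuous functions -/

section Multiplication

variable {L : ℝ}

/-- `projIcc` extends `c` by constants outside `[0, L]`, without effect on `(0, L)`. -/
lemma memLp_mul_L2 (hL : 0 ≤ L) (c : C(Icc 0 L, ℝ)) (f : L2 (Ioo 0 L) E3) :
    MemLp (fun t => c (projIcc 0 L hL t) • f t) 2 (volume.restrict (Ioo 0 L)) := by
  refine (Lp.memLp f).of_le_mul (c := ‖c‖)
    ((c.continuous.comp continuous_projIcc).aestronglyMeasurable.smul (Lp.aestronglyMeasurable f))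
    (Filter.Eventually.of_forall fun t => ?_)
  rw [norm_smul]
  gcongr
  exact c.norm_coe_le_norm _

lemma norm_mul_L2_le (hL : 0 ≤ L) (c : C(Icc 0 L, ℝ)) (f : L2 (Ioo 0 L) E3) :
    ‖(memLp_mul_L2 hL c f).toLp _‖ ≤ ‖c‖ * ‖f‖ := by
  refine Lp.norm_le_mul_norm_of_ae_le_mul ?_
  filter_upwards [(memLp_mul_L2 hL c f).coeFn_toLp] with t ht
  rw [ht, norm_smul]
  gcongr
  exact c.norm_coe_le_norm _

/-- Multiplication of `L²` fields by continuous functions. -/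
noncomputable def mulL2 (hL : 0 ≤ L) :
    C(Icc 0 L, ℝ) →L[ℝ] L2 (Ioo 0 L) E3 →L[ℝ] L2 (Ioo 0 L) E3 :=
  LinearMap.mkContinuous₂
    (LinearMap.mk₂ ℝ (fun c f => (memLp_mul_L2 hL c f).toLp _)
      (fun c c' f => by
        rw [← MemLp.toLp_add, MemLp.toLp_eq_toLp_iff]
        exact Filter.Eventually.of_forall fun t => add_smul _ _ _)
      (fun r c f => by
        rw [← MemLp.toLp_const_smul, MemLp.toLp_eq_toLp_iff]
        exact Filter.Eventually.of_forall fun t => smul_assoc r (c _) (f t))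
      (fun c f f' => by
        rw [← MemLp.toLp_add, MemLp.toLp_eq_toLp_iff]
        filter_upwards [Lp.coeFn_add f f'] with t ht
        rw [ht]
        exact smul_add _ _ _)
      (fun r c f => by
        rw [← MemLp.toLp_const_smul, MemLp.toLp_eq_toLp_iff]
        filter_upwards [Lp.coeFn_smul r f] with t ht
        exact (congrArg _ ht).trans (smul_comm (c _) r (f t)))) 1
    fun c f => by
      rw [one_mul]
      exact norm_mul_L2_le hL c f

lemma mulL2_ae (hL : 0 ≤ L) {c : C(Icc 0 L, ℝ)} {m : ℝ → ℝ} (hc : ∀ t : Icc 0 L, c t = m t)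
    (f : L2 (Ioo 0 L) E3) :
    mulL2 hL c f =ᵐ[volume.restrict (Ioo 0 L)] fun t => m t • f t := by
  filter_upwards [(memLp_mul_L2 hL c f).coeFn_toLp, ae_restrict_mem measurableSet_Ioo] with t h ht
  refine h.trans ?_
  rw [hc, projIcc_of_mem hL (Ioo_subset_Icc_self ht)]

/-- The primitive that vanishes at `0`, as a bounded operator from `L²` to `W^{1,2}`. -/
noncomputable def primW12 (hL : 0 ≤ L) : L2 (Ioo 0 L) E3 →L[ℝ] W12 L :=
  ((volterra L).prod (ContinuousLinearMap.id ℝ _)).codRestrict (W12 L)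
    fun f => volterra_hasWeakDeriv hL f

lemma primW12_snd (hL : 0 ≤ L) (f : L2 (Ioo 0 L) E3) : (primW12 hL f).1.2 = f := rfl

lemma primW12_ae (hL : 0 ≤ L) {f : L2 (Ioo 0 L) E3} {c w : ℝ → E3} (h : IsPrim L c w)
    (h0 : c 0 = 0) (hf : f =ᵐ[volume.restrict (Ioo 0 L)] w) :
    (primW12 hL f).1.1 =ᵐ[volume.restrict (Ioo 0 L)] c := by
  have h1 : (primW12 hL f).1.1 = volterra L f := rfl
  rw [h1]
  filter_upwards [volterra_ae f, ae_restrict_mem measurableSet_Ioo] with t h2 ht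
  rw [h2, (h.congr_deriv hf.symm).eq_integral t (Ioo_subset_Icc_self ht), h0, zero_add]

lemma hasValueAt_primW12 (hL : 0 ≤ L) (f : L2 (Ioo 0 L) E3) :
    HasValueAt L (⇑(primW12 hL f).1.1) 0 0 :=
  ⟨_, (isPrim_primitive f).continuousOn, volterra_ae f, by simp⟩

lemma hasValueAt_primW22 (hL : 0 ≤ L) (U : W12 L) : HasValueAt L (⇑(primW22 hL U).1.1.1.1) 0 0 :=
  ⟨_, (isPrim_primitive U.1.1).continuousOn, volterra_ae U.1.1, by simp⟩

lemma IsPrim.smul {m m' : ℝ → ℝ} {c w : ℝ → E3} (hm : IsPrim L m m') (hc : IsPrim L c w) :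
    IsPrim L (fun t => m t • c t) (fun t => m' t • c t + m t • w t) :=
  isPrim_iff_apply.2 fun i => hm.mul (isPrim_iff_apply.1 hc i)

end Multiplication

/-! ### Rotating the frame in a coordinate plane -/

section PlaneRotation

/-- The projection onto a coordinate plane. -/
def planeProj (n : Fin 3) : M3 :=
  ![!![1, 0, 0; 0, 1, 0; 0, 0, 0], !![1, 0, 0; 0, 0, 0; 0, 0, 1], !![0, 0, 0; 0, 1, 0; 0, 0, 1]] n

/-- The generator of the rotations of a coordinate plane. -/
def planeGen (n : Fin 3) : M3 :=
  ![!![0, 1, 0; -1, 0, 0; 0, 0, 0], !![0, 0, 1; 0, 0, 0; -1, 0, 0],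
    !![0, 0, 0; 0, 0, 1; 0, -1, 0]] n

/-- On the coordinate plane the matrix has diagonal entries `1 + c` and off-diagonal entries `b`,
`-b`; orthogonality and determinant one both reduce to `h`. -/
lemma planeRotation_mem_SO3 (n : Fin 3) {c b : ℝ} (h : (1 + c) ^ 2 + b ^ 2 = 1) :
    1 + (c • planeProj n + b • planeGen n) ∈ SO3 := by
  refine Matrix.mem_specialOrthogonalGroup_iff.2 ⟨?_, ?_⟩
  · rw [Matrix.mem_orthogonalGroup_iff]
    ext i j
    fin_cases n <;> fin_cases i <;> fin_cases j <;>
      simp [planeProj, planeGen, Matrix.mul_apply, Fin.sum_univ_three, Matrix.one_apply] <;>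
      first | linear_combination h | ring
  · fin_cases n <;> simp [planeProj, planeGen, Matrix.det_fin_three] <;>
      linear_combination h

/-- The three generators are dual to the three tested entries of `B`, so each plane rotation
isolates one equation. -/
lemma planeGen_apply (n m : Fin 3) :
    planeGen n (![0, 0, 1] m) (![1, 2, 2] m) = if n = m then 1 else 0 := by
  fin_cases n <;> fin_cases m <;> simp [planeGen]

end PlaneRotation

end Rod

namespace Rod

/-! ### Curves in `𝓐` through a given configuration -/

section RationalRotation

variable {X : Type*} [TopologicalSpace X]

/-- `(1 + ε² φ²)⁻¹`. -/
noncomputable def rotInv (φ : C(X, ℝ)) (ε : ℝ) : C(X, ℝ) := Ring.inverse (1 + ε ^ 2 • (φ * φ))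

/-- The function is everywhere positive, so `Ring.inverse` in `rotInv` is a true inverse and not its
default value `0`. -/
lemma isUnit_one_add_sq (φ : C(X, ℝ)) (ε : ℝ) : IsUnit (1 + ε ^ 2 • (φ * φ)) := by
  rw [ContinuousMap.isUnit_iff_forall_ne_zero]
  intro x
  have : 0 ≤ ε ^ 2 * (φ x * φ x) := mul_nonneg (sq_nonneg _) (mul_self_nonneg _)
  simp only [ContinuousMap.add_apply, ContinuousMap.one_apply, ContinuousMap.smul_apply,
    ContinuousMap.mul_apply, smul_eq_mul]
  positivity

lemma rotInv_apply (φ : C(X, ℝ)) (ε : ℝ) (x : X) :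
    rotInv φ ε x = (1 + ε ^ 2 * φ x ^ 2)⁻¹ := by
  have h := DFunLike.congr_fun (Ring.inverse_mul_cancel _ (isUnit_one_add_sq φ ε)) x
  refine eq_inv_of_mul_eq_one_left ?_
  rw [sq (φ x)]
  exact h

/-- On a compact space the continuous functions form a Banach algebra, in which inversion is smooth
at units. The rational parametrization of rotations thus gives curves that are smooth in the
function space, not merely pointwise. -/
lemma contDiff_rotInv [CompactSpace X] (φ : C(X, ℝ)) : ContDiff ℝ ∞ (rotInv φ) := by
  refine contDiff_iff_contDiffAt.2 fun ε => ?_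
  obtain ⟨u, hu⟩ := isUnit_one_add_sq φ ε
  have h1 : ContDiffAt ℝ ∞ (fun ε : ℝ => 1 + ε ^ 2 • (φ * φ)) ε := by fun_prop
  have h2 : ContDiffAt ℝ ∞ Ring.inverse (1 + ε ^ 2 • (φ * φ)) := hu ▸ contDiffAt_ringInverse ℝ u
  exact h2.comp ε h1

/-- The coefficients of `(1 / ε) (Q - 1)`, where `Q` is the rotation of a coordinate plane by
`2 arctan (ε φ)`. -/
noncomputable def rotCoeff (n : Fin 3) (φ : C(X, ℝ)) (ε : ℝ) (i l : Fin 3) : C(X, ℝ) :=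
  planeProj n i l • (-(2 * ε)) • (φ * φ * rotInv φ ε) + planeGen n i l • (2 : ℝ) • (φ * rotInv φ ε)

/-- The derivatives of the coefficients `rotCoeff`, where `ψ` is the derivative of `φ`. -/
noncomputable def rotCoeffDeriv (n : Fin 3) (φ ψ : C(X, ℝ)) (ε : ℝ) (i l : Fin 3) : C(X, ℝ) :=
  planeProj n i l • (-(4 * ε)) • (φ * ψ * rotInv φ ε ^ 2) +
    planeGen n i l • ((2 : ℝ) • (ψ * rotInv φ ε) - (4 * ε ^ 2) • (φ * φ * ψ * rotInv φ ε ^ 2))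

lemma contDiff_rotCoeff [CompactSpace X] (n : Fin 3) (φ : C(X, ℝ)) (i l : Fin 3) :
    ContDiff ℝ ∞ (fun ε => rotCoeff n φ ε i l) := by
  have := contDiff_rotInv φ
  unfold rotCoeff
  fun_prop

lemma contDiff_rotCoeffDeriv [CompactSpace X] (n : Fin 3) (φ ψ : C(X, ℝ)) (i l : Fin 3) :
    ContDiff ℝ ∞ (fun ε => rotCoeffDeriv n φ ψ ε i l) := by
  have := contDiff_rotInv φ
  unfold rotCoeffDeriv
  fun_prop

/-- The values of `rotCoeff` as a function of the value of `φ`. -/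
noncomputable def rotFun (n : Fin 3) (ε : ℝ) (i l : Fin 3) (s : ℝ) : ℝ :=
  planeProj n i l * (-(2 * ε) * (s ^ 2 * (1 + ε ^ 2 * s ^ 2)⁻¹)) +
    planeGen n i l * (2 * (s * (1 + ε ^ 2 * s ^ 2)⁻¹))

/-- The derivative of `rotFun`. -/
noncomputable def rotFunDeriv (n : Fin 3) (ε : ℝ) (i l : Fin 3) (s : ℝ) : ℝ :=
  planeProj n i l * (-(4 * ε) * (s * (1 + ε ^ 2 * s ^ 2)⁻¹ ^ 2)) +
    planeGen n i l * (2 * (1 + ε ^ 2 * s ^ 2)⁻¹ - 4 * ε ^ 2 * (s ^ 2 * (1 + ε ^ 2 * s ^ 2)⁻¹ ^ 2))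

lemma rotCoeff_apply (n : Fin 3) (φ : C(X, ℝ)) (ε : ℝ) (i l : Fin 3) (x : X) :
    rotCoeff n φ ε i l x = rotFun n ε i l (φ x) := by
  simp only [rotCoeff, rotFun, ContinuousMap.add_apply, ContinuousMap.smul_apply,
    ContinuousMap.mul_apply, smul_eq_mul, rotInv_apply]
  ring

lemma rotCoeffDeriv_apply (n : Fin 3) (φ ψ : C(X, ℝ)) (ε : ℝ) (i l : Fin 3) (x : X) :
    rotCoeffDeriv n φ ψ ε i l x = rotFunDeriv n ε i l (φ x) * ψ x := by
  simp only [rotCoeffDeriv, rotFunDeriv, ContinuousMap.add_apply, ContinuousMap.sub_apply,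
    ContinuousMap.smul_apply, ContinuousMap.mul_apply, ContinuousMap.pow_apply, smul_eq_mul,
    rotInv_apply]
  ring

lemma hasDerivAt_rotFun (n : Fin 3) (ε : ℝ) (i l : Fin 3) (s : ℝ) :
    HasDerivAt (rotFun n ε i l) (rotFunDeriv n ε i l s) s := by
  have h0 : 1 + ε ^ 2 * s ^ 2 ≠ 0 := by positivity
  have h2 : HasDerivAt (fun s : ℝ => s ^ 2) (2 * s) s := by simpa using hasDerivAt_pow 2 s
  have h1 := ((h2.const_mul (ε ^ 2)).const_add 1).fun_inv h0
  refine ((((h2.mul h1).const_mul (-(2 * ε))).const_mul (planeProj n i l)).add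
    ((((hasDerivAt_id s).mul h1).const_mul 2).const_mul (planeGen n i l))).congr_deriv ?_
  simp only [rotFunDeriv, id]
  field_simp
  ring

lemma continuous_rotFunDeriv (n : Fin 3) (ε : ℝ) (i l : Fin 3) :
    Continuous (rotFunDeriv n ε i l) := by
  have h0 : ∀ s : ℝ, 1 + ε ^ 2 * s ^ 2 ≠ 0 := fun s => by positivity
  unfold rotFunDeriv
  fun_prop (disch := exact h0 _)

lemma rotFun_at_zero (n : Fin 3) (ε : ℝ) (i l : Fin 3) : rotFun n ε i l 0 = 0 := by
  simp [rotFun]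

lemma rotFun_zero (n : Fin 3) (i l : Fin 3) (s : ℝ) : rotFun n 0 i l s = 2 * planeGen n i l * s := by
  simp [rotFun]
  ring

lemma rotFunDeriv_zero (n : Fin 3) (i l : Fin 3) (s : ℝ) :
    rotFunDeriv n 0 i l s = 2 * planeGen n i l := by
  simp [rotFunDeriv]
  ring

lemma one_add_rotFun_mem_SO3 (n : Fin 3) (ε s : ℝ) :
    1 + ε • (Matrix.of fun i l => rotFun n ε i l s) ∈ SO3 := by
  have h0 : 1 + ε ^ 2 * s ^ 2 ≠ 0 := by positivity
  -- With `tan (θ / 2) = ε s`, these are `c = cos θ - 1` and `b = sin θ`.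
  have h := planeRotation_mem_SO3 n (c := ε * (-(2 * ε) * (s ^ 2 * (1 + ε ^ 2 * s ^ 2)⁻¹)))
    (b := ε * (2 * (s * (1 + ε ^ 2 * s ^ 2)⁻¹))) (by field_simp; ring)
  convert h using 2
  ext i l
  simp only [rotFun, Matrix.smul_apply, Matrix.add_apply, Matrix.of_apply, smul_eq_mul]
  ring

end RationalRotation

/-! ### Configurations with frame R M -/

section FrameLift

variable {L : ℝ}

lemma isPrim_of_hasDerivAt {f f' : ℝ → ℝ} (h : ∀ t, HasDerivAt f (f' t) t) (hf' : Continuous f') :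
    IsPrim L f f' := by
  have h1 : deriv f = f' := funext fun t => (h t).deriv
  have h2 : ContDiff ℝ 1 f :=
    contDiff_one_iff_deriv.2 ⟨fun t => (h t).differentiableAt, h1 ▸ hf'⟩
  exact h1 ▸ isPrim_of_contDiff h2

/-- The configuration with the given derivatives of the columns, zero at `0`. -/
noncomputable def frameLift (hL : 0 ≤ L) :
    (L2 (Ioo 0 L) E3 × L2 (Ioo 0 L) E3 × L2 (Ioo 0 L) E3) →L[ℝ] Config L :=
  ((primW22 hL).comp (primW12 hL)).prodMap ((primW12 hL).prodMap (primW12 hL))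

/-- The derivatives of the columns of `R M`, where `M'` is the derivative of `M`. -/
noncomputable def mulFrameDeriv (hL : 0 ≤ L) (q : Config L) (M M' : Fin 3 → Fin 3 → C(Icc 0 L, ℝ))
    (l : Fin 3) : L2 (Ioo 0 L) E3 :=
  ∑ i, (mulL2 hL (M' i l) (column L i q).1.1 + mulL2 hL (M i l) (column L i q).1.2)

/-- The configuration with frame `R M`, where `M` vanishes at `0` and has the derivative `M'`. -/
noncomputable def mulFrame (hL : 0 ≤ L) (q : Config L) (M M' : Fin 3 → Fin 3 → C(Icc 0 L, ℝ)) :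
    Config L :=
  frameLift hL (mulFrameDeriv hL q M M' 0, mulFrameDeriv hL q M M' 1, mulFrameDeriv hL q M M' 2)

lemma column_mulFrame (hL : 0 ≤ L) (q : Config L) (M M' : Fin 3 → Fin 3 → C(Icc 0 L, ℝ))
    (l : Fin 3) : column L l (mulFrame hL q M M') = primW12 hL (mulFrameDeriv hL q M M' l) := by
  fin_cases l
  · exact (column_zero _).trans rfl
  · exact (column_one _).trans rfl
  · exact (column_two _).trans rfl

variable {q : Config L} {M M' : Fin 3 → Fin 3 → C(Icc 0 L, ℝ)} {m m' : Fin 3 → Fin 3 → ℝ → ℝ}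

lemma L2.sum_ae {f : Fin 3 → L2 (Ioo 0 L) E3} {F : Fin 3 → ℝ → E3}
    (h : ∀ i, f i =ᵐ[volume.restrict (Ioo 0 L)] F i) :
    (∑ i, f i : L2 (Ioo 0 L) E3) =ᵐ[volume.restrict (Ioo 0 L)] fun t => ∑ i, F i t := by
  simp only [Fin.sum_univ_three]
  filter_upwards [h 0, h 1, h 2, Lp.coeFn_add (f 0 + f 1) (f 2), Lp.coeFn_add (f 0) (f 1)]
    with t h0 h1 h2 h3 h4
  rw [h3, Pi.add_apply, h4, Pi.add_apply, h0, h1, h2]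

lemma mulL2_add_ae (hL : 0 ≤ L) {c c' : C(Icc 0 L, ℝ)} {k k' : ℝ → ℝ}
    (hc : ∀ t : Icc 0 L, c t = k t) (hc' : ∀ t : Icc 0 L, c' t = k' t) (f f' : L2 (Ioo 0 L) E3) :
    (mulL2 hL c' f' + mulL2 hL c f : L2 (Ioo 0 L) E3) =ᵐ[volume.restrict (Ioo 0 L)] fun t =>
      k' t • f' t + k t • f t := by
  filter_upwards [Lp.coeFn_add (mulL2 hL c' f') (mulL2 hL c f), mulL2_ae hL hc' f',
    mulL2_ae hL hc f] with t e1 e2 e3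
  rw [e1, Pi.add_apply, e2, e3]

lemma mulFrameDeriv_ae (hL : 0 ≤ L) (hM : ∀ i l (t : Icc 0 L), M i l t = m i l t)
    (hM' : ∀ i l (t : Icc 0 L), M' i l t = m' i l t) (l : Fin 3) :
    mulFrameDeriv hL q M M' l =ᵐ[volume.restrict (Ioo 0 L)] fun t =>
      ∑ i, (m' i l t • (column L i q).1.1 t + m i l t • (column L i q).1.2 t) :=
  L2.sum_ae fun i => mulL2_add_ae hL (hM i l) (hM' i l) _ _

/-- By the product rule the sum of the `k i • U i` is the primitive of `f` that vanishes at `0`. -/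
lemma primW12_sum_ae (hL : 0 < L) {U : Fin 3 → W12 L} {k k' : Fin 3 → ℝ → ℝ}
    {f : L2 (Ioo 0 L) E3} (hk : ∀ i, IsPrim L (k i) (k' i)) (hk0 : ∀ i, k i 0 = 0)
    (hf : f =ᵐ[volume.restrict (Ioo 0 L)] fun t =>
      ∑ i, (k' i t • (U i).1.1 t + k i t • (U i).1.2 t)) :
    (primW12 hL.le f).1.1 =ᵐ[volume.restrict (Ioo 0 L)] fun t => ∑ i, k i t • (U i).1.1 t := by
  have h1 := IsPrim.sum Finset.univ fun i _ => (hk i).smul (W12.rep_isPrim hL (U i))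
  have h3 : ∀ᵐ t ∂(volume.restrict (Ioo 0 L)), ∀ i, (U i).1.1 t = W12.rep hL (U i) t :=
    ae_all_iff.2 fun i => W12.ae_eq_rep hL (U i)
  refine (primW12_ae hL.le h1 ?_ (hf.trans ?_)).trans ?_
  · exact Finset.sum_eq_zero fun i _ => by rw [hk0, zero_smul]
  · filter_upwards [h3] with t e2
    exact Finset.sum_congr rfl fun i _ => by rw [e2 i]
  · filter_upwards [h3] with t e2
    exact Finset.sum_congr rfl fun i _ => by rw [e2 i]

lemma column_mulFrame_ae (hL : 0 < L) (hM : ∀ i l (t : Icc 0 L), M i l t = m i l t)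
    (hM' : ∀ i l (t : Icc 0 L), M' i l t = m' i l t) (hm : ∀ i l, IsPrim L (m i l) (m' i l))
    (hm0 : ∀ i l, m i l 0 = 0) (l : Fin 3) :
    (column L l (mulFrame hL.le q M M')).1.1 =ᵐ[volume.restrict (Ioo 0 L)] fun t =>
      ∑ i, m i l t • (column L i q).1.1 t := by
  rw [column_mulFrame]
  exact primW12_sum_ae hL (fun i => hm i l) (fun i => hm0 i l) (mulFrameDeriv_ae hL.le hM hM' l)

end FrameLift

end Rod

namespace Rod

/-! ### The plane-rotation curves: smoothness, admissibility, initial velocity -/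

section PlaneCurve

variable {L : ℝ}

lemma W12.add_smul_ae (U V : W12 L) (r : ℝ) :
    (U + r • V).1.1 =ᵐ[volume.restrict (Ioo 0 L)] fun t => U.1.1 t + r • V.1.1 t := by
  filter_upwards [Lp.coeFn_add U.1.1 (r • V.1.1), Lp.coeFn_smul r V.1.1] with t h1 h2
  exact h1.trans (congrArg (U.1.1 t + ·) h2)

lemma HasValueAt.add_smul {U V : W12 L} {a : E3} (hU : HasValueAt L (⇑U.1.1) 0 a)
    (hV : HasValueAt L (⇑V.1.1) 0 0) (r : ℝ) : HasValueAt L (⇑(U + r • V).1.1) 0 a := by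
  obtain ⟨c, hc, hcU, rfl⟩ := hU
  obtain ⟨d, hd, hdV, hd0⟩ := hV
  refine ⟨fun t => c t + r • d t, hc.add (hd.const_smul r), ?_, by simp [hd0]⟩
  filter_upwards [W12.add_smul_ae U V r, hcU, hdV] with t h1 h2 h3
  rw [h1, h2, h3]

lemma HasValueAt.of_eq {U V : W12 L} {t : ℝ} {a : E3} (h : HasValueAt L (⇑U.1.1) t a) (e : U = V) :
    HasValueAt L (⇑V.1.1) t a := e ▸ h

lemma isClamped_iff (q : Config L) : IsClamped q ↔ HasValueAt L (⇑(midFiberW12 L q).1.1) 0 0 ∧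
    HasValueAt L (⇑(column L 1 q).1.1) 0 (EuclideanSpace.single 1 (1 : ℝ)) ∧
    HasValueAt L (⇑(column L 2 q).1.1) 0 (EuclideanSpace.single 2 (1 : ℝ)) :=
  ⟨fun h => ⟨HasValueAt.of_eq h.1 (midFiberW12_apply q).symm,
      HasValueAt.of_eq h.2.1 (column_one q).symm, HasValueAt.of_eq h.2.2 (column_two q).symm⟩,
    fun h => ⟨HasValueAt.of_eq h.1 (midFiberW12_apply q), HasValueAt.of_eq h.2.1 (column_one q),
      HasValueAt.of_eq h.2.2 (column_two q)⟩⟩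

/-- The curve `ε ↦ a + ε f(ε)`. -/
def curveFrom {E : Type*} [NormedAddCommGroup E] [NormedSpace ℝ E] (a : E) (f : ℝ → E) (ε : ℝ) : E :=
  a + ε • f ε

section CurveFrom

variable {E F : Type*} [NormedAddCommGroup E] [NormedSpace ℝ E] [NormedAddCommGroup F]
  [NormedSpace ℝ F] {f : ℝ → E}

lemma curveFrom_zero (a : E) (f : ℝ → E) : curveFrom a f 0 = a := by
  rw [curveFrom, zero_smul, add_zero]

lemma map_curveFrom (T : E →L[ℝ] F) (a : E) (f : ℝ → E) (ε : ℝ) :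
    T (curveFrom a f ε) = T a + ε • T (f ε) := by
  rw [curveFrom, map_add, map_smul]

lemma contDiff_curveFrom (hf : ContDiff ℝ ∞ f) (a : E) : ContDiff ℝ ∞ (curveFrom a f) :=
  contDiff_const.add (contDiff_id.smul hf)

lemma hasDerivWithinAt_curveFrom (hf : ContDiff ℝ ∞ f) (a : E) (s : Set ℝ) :
    HasDerivWithinAt (curveFrom a f) (f 0) s 0 := by
  have hf0 : DifferentiableAt ℝ f 0 := (hf.differentiable (by simp)) 0
  exact ((((hasDerivAt_id (0 : ℝ)).smul hf0.hasDerivAt).const_add a).congr_deriv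
    (by simp)).hasDerivWithinAt

lemma contDiff_clm_map (T : E →L[ℝ] F) (hf : ContDiff ℝ ∞ f) : ContDiff ℝ ∞ fun x => T (f x) :=
  T.contDiff.comp hf

end CurveFrom

variable {n : Fin 3} {q : Config L} {φ ψ : C(Icc 0 L, ℝ)}

lemma contDiff_mulFrameDeriv (hL : 0 ≤ L) (l : Fin 3) : ContDiff ℝ ∞
    (fun ε => mulFrameDeriv hL q (rotCoeff n φ ε) (rotCoeffDeriv n φ ψ ε) l) :=
  ContDiff.sum fun i _ =>
    (((mulL2 hL).contDiff.comp (contDiff_rotCoeffDeriv n φ ψ i l)).clm_apply contDiff_const).add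
    (((mulL2 hL).contDiff.comp (contDiff_rotCoeff n φ i l)).clm_apply contDiff_const)

variable (n q φ ψ) in
/-- The difference quotient of `planeCurve`. -/
noncomputable def planeQuot (hL : 0 ≤ L) (ε : ℝ) : Config L :=
  mulFrame hL q (rotCoeff n φ ε) (rotCoeffDeriv n φ ψ ε)

lemma contDiff_planeQuot (hL : 0 ≤ L) : ContDiff ℝ ∞ (planeQuot n q φ ψ hL) :=
  contDiff_clm_map (F := Config L) (frameLift hL) ((contDiff_mulFrameDeriv hL 0).prodMk
    ((contDiff_mulFrameDeriv hL 1).prodMk (contDiff_mulFrameDeriv hL 2)))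

variable (n q φ ψ) in
/-- The frame of `q`, rotated in the `n`-th coordinate plane by `2 arctan (ε φ)`; the function `ψ`
is the derivative of `φ`. -/
noncomputable def planeCurve (hL : 0 ≤ L) : ℝ → Config L :=
  curveFrom (E := Config L) q (planeQuot n q φ ψ hL)

lemma planeCurve_zero (hL : 0 ≤ L) : planeCurve n q φ ψ hL 0 = q :=
  curveFrom_zero (E := Config L) _ _

lemma contDiff_planeCurve (hL : 0 ≤ L) : ContDiff ℝ ∞ (planeCurve n q φ ψ hL) :=
  contDiff_curveFrom (E := Config L) (contDiff_planeQuot hL) q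

lemma hasDerivWithinAt_planeCurve (hL : 0 ≤ L) (s : Set ℝ) :
    HasDerivWithinAt (planeCurve n q φ ψ hL) (planeQuot n q φ ψ hL 0) s 0 :=
  hasDerivWithinAt_curveFrom (E := Config L) (contDiff_planeQuot hL) q s

lemma midFiberW12_planeCurve (hL : 0 ≤ L) (ε : ℝ) : midFiberW12 L (planeCurve n q φ ψ hL ε) =
    midFiberW12 L q + ε • midFiberW12 L (planeQuot n q φ ψ hL ε) :=
  map_curveFrom (E := Config L) (F := W12 L) (midFiberW12 L) _ _ _

lemma column_planeCurve (hL : 0 ≤ L) (ε : ℝ) (l : Fin 3) : column L l (planeCurve n q φ ψ hL ε) =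
    column L l q + ε • column L l (planeQuot n q φ ψ hL ε) :=
  map_curveFrom (E := Config L) (F := W12 L) (column L l) _ _ _

lemma midFiberW12_mulFrame (hL : 0 ≤ L) (q : Config L) (M M' : Fin 3 → Fin 3 → C(Icc 0 L, ℝ)) :
    midFiberW12 L (mulFrame hL q M M') =
      (primW22 hL (primW12 hL (mulFrameDeriv hL q M M' 0))).1.1 :=
  (midFiberW12_apply _).trans rfl

lemma hasValueAt_midFiber_planeQuot (hL : 0 ≤ L) (ε : ℝ) :
    HasValueAt L (⇑(midFiberW12 L (planeQuot n q φ ψ hL ε)).1.1) 0 0 :=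
  HasValueAt.of_eq (hasValueAt_primW22 hL _) (midFiberW12_mulFrame hL _ _ _).symm

lemma hasValueAt_column_planeQuot (hL : 0 ≤ L) (ε : ℝ) (l : Fin 3) :
    HasValueAt L (⇑(column L l (planeQuot n q φ ψ hL ε)).1.1) 0 0 :=
  HasValueAt.of_eq (hasValueAt_primW12 hL _) (column_mulFrame hL _ _ _ _).symm

/-- The increments of `y`, `d₂` and `d₃` are built as primitives vanishing at `0`. -/
lemma isClamped_planeCurve (hL : 0 ≤ L) (hq : IsClamped q) (ε : ℝ) :
    IsClamped (planeCurve n q φ ψ hL ε) := by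
  have h := (isClamped_iff q).1 hq
  refine (isClamped_iff _).2 ⟨?_, ?_, ?_⟩
  · exact HasValueAt.of_eq (h.1.add_smul (hasValueAt_midFiber_planeQuot hL ε) ε)
      (midFiberW12_planeCurve hL ε).symm
  · exact HasValueAt.of_eq (h.2.1.add_smul (hasValueAt_column_planeQuot hL ε 1) ε)
      (column_planeCurve hL ε 1).symm
  · exact HasValueAt.of_eq (h.2.2.add_smul (hasValueAt_column_planeQuot hL ε 2) ε)
      (column_planeCurve hL ε 2).symm

variable {f f' : ℝ → ℝ}

lemma isPrim_rotFun (hf : ∀ t, HasDerivAt f (f' t) t) (hf' : Continuous f') (n : Fin 3) (ε : ℝ)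
    (i l : Fin 3) :
    IsPrim L (fun t => rotFun n ε i l (f t)) (fun t => rotFunDeriv n ε i l (f t) * f' t) :=
  isPrim_of_hasDerivAt (fun t => (hasDerivAt_rotFun n ε i l (f t)).comp t (hf t))
    (((continuous_rotFunDeriv n ε i l).comp
      (continuous_iff_continuousAt.2 fun t => (hf t).continuousAt)).mul hf')

lemma column_planeQuot_ae (hL : 0 < L) (hf : ∀ t, HasDerivAt f (f' t) t)
    (hf' : Continuous f') (hf0 : f 0 = 0) (hφ : ∀ t : Icc 0 L, φ t = f t)
    (hψ : ∀ t : Icc 0 L, ψ t = f' t) (ε : ℝ) (l : Fin 3) :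
    (column L l (planeQuot n q φ ψ hL.le ε)).1.1
      =ᵐ[volume.restrict (Ioo 0 L)] fun t => ∑ i, rotFun n ε i l (f t) • (column L i q).1.1 t :=
  column_mulFrame_ae (m := fun i l t => rotFun n ε i l (f t))
    (m' := fun i l t => rotFunDeriv n ε i l (f t) * f' t) hL
    (fun i l t => by rw [rotCoeff_apply, hφ])
    (fun i l t => by rw [rotCoeffDeriv_apply, hφ, hψ]) (isPrim_rotFun hf hf' n ε)
    (fun i l => by rw [hf0, rotFun_at_zero]) l

lemma column_planeQuot_deriv_ae (hL : 0 ≤ L) (hφ : ∀ t : Icc 0 L, φ t = f t)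
    (hψ : ∀ t : Icc 0 L, ψ t = f' t) (ε : ℝ) (l : Fin 3) :
    (column L l (planeQuot n q φ ψ hL ε)).1.2 =ᵐ[volume.restrict (Ioo 0 L)] fun t =>
      ∑ i, ((rotFunDeriv n ε i l (f t) * f' t) • (column L i q).1.1 t +
        rotFun n ε i l (f t) • (column L i q).1.2 t) := by
  have h1 : (column L l (planeQuot n q φ ψ hL ε)).1.2 =
      mulFrameDeriv hL q (rotCoeff n φ ε) (rotCoeffDeriv n φ ψ ε) l :=
    (congrArg (fun U : W12 L => U.1.2) (column_mulFrame hL _ _ _ l)).trans (primW12_snd hL _)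
  rw [h1]
  exact mulFrameDeriv_ae (m := fun i l t => rotFun n ε i l (f t))
    (m' := fun i l t => rotFunDeriv n ε i l (f t) * f' t) hL
    (fun i l t => by rw [rotCoeff_apply, hφ]) (fun i l t => by rw [rotCoeffDeriv_apply, hφ, hψ]) l

lemma eq_mul_of_columns {R R' N : M3} {u u' : Fin 3 → E3} {ε : ℝ} (hR : ∀ i k, R i k = u k i)
    (hR' : ∀ i k, R' i k = u' k i) (h : ∀ l, u' l = u l + ε • ∑ i, N i l • u i) :
    R' = R * (1 + ε • N) := by
  ext i l
  rw [hR', h, Matrix.mul_add, Matrix.mul_one, Matrix.add_apply, Matrix.mul_smul, Matrix.smul_apply,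
    Matrix.mul_apply, hR]
  simp only [hR, PiLp.add_apply, PiLp.smul_apply, WithLp.ofLp_sum, WithLp.ofLp_smul,
    Finset.sum_apply, Pi.smul_apply, smul_eq_mul, mul_comm]

lemma inner_sum_smul_orthonormal {u : Fin 3 → E3} {k : Fin 3}
    (hu : ∀ i, inner ℝ (u k) (u i) = if k = i then (1 : ℝ) else 0) (c : Fin 3 → ℝ) :
    inner ℝ (u k) (∑ i, c i • u i) = c k := by
  simp [inner_sum, inner_smul_right, hu]

/-- This is `(Rᵀ R N)' = N'`: the terms with `R'` cancel by skewness of `Rᵀ R'`. -/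
lemma inner_sum_smul_orthonormal_deriv {u v : Fin 3 → E3} {k : Fin 3}
    (hu : ∀ i, inner ℝ (u k) (u i) = if k = i then (1 : ℝ) else 0)
    (hv : ∀ i, inner ℝ (v k) (u i) = - inner ℝ (u k) (v i)) (c d : Fin 3 → ℝ) :
    inner ℝ (v k) (∑ i, c i • u i) + inner ℝ (u k) (∑ i, (d i • u i + c i • v i)) = d k := by
  rw [Finset.sum_add_distrib, inner_add_right, inner_sum_smul_orthonormal hu]
  simp [inner_sum, inner_smul_right, hv]

/-- The frame of the curve is `R (1 + ε N)`, a product of two rotations. -/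
lemma planeCurve_mem_classA (hL : 0 < L) (hq : q ∈ classA L) (hf : ∀ t, HasDerivAt f (f' t) t)
    (hf' : Continuous f') (hf0 : f 0 = 0) (hφ : ∀ t : Icc 0 L, φ t = f t)
    (hψ : ∀ t : Icc 0 L, ψ t = f' t) (ε : ℝ) : planeCurve n q φ ψ hL.le ε ∈ classA L := by
  have h1 : ∀ᵐ t ∂(volume.restrict (Ioo 0 L)), ∀ l,
      (column L l (planeCurve n q φ ψ hL.le ε)).1.1 t = (column L l q).1.1 t +
        ε • ∑ i, rotFun n ε i l (f t) • (column L i q).1.1 t := by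
    refine ae_all_iff.2 fun l => ?_
    have e0 := column_planeCurve (n := n) (q := q) (φ := φ) (ψ := ψ) hL.le ε l
    filter_upwards [column_planeQuot_ae (q := q) (n := n) hL hf hf' hf0 hφ hψ ε l,
      W12.add_smul_ae (column L l q) (column L l (planeQuot n q φ ψ hL.le ε)) ε] with t e1 e2
    exact (congrArg (fun U : W12 L => U.1.1 t) e0).trans
      (e2.trans (congrArg (fun v : E3 => (column L l q).1.1 t + ε • v) e1))
  have hq' : ∀ᵐ t ∂(volume.restrict (Ioo 0 L)), rot q t ∈ SO3 := hq
  change ∀ᵐ t ∂(volume.restrict (Ioo 0 L)), rot (planeCurve n q φ ψ hL.le ε) t ∈ SO3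
  filter_upwards [h1, hq'] with t h1 h2
  have h3 := eq_mul_of_columns (N := Matrix.of fun i l => rotFun n ε i l (f t))
    (rot_apply q t) (rot_apply (planeCurve n q φ ψ hL.le ε) t) h1
  rw [h3]
  exact (Matrix.specialOrthogonalGroup (Fin 3) ℝ).mul_mem h2 (one_add_rotFun_mem_SO3 n ε (f t))

/-- The angle `2 arctan (ε f)` has velocity `2 f` at `ε = 0`, so `B` is `2 f` times the generator of
the plane. -/
lemma frameVar_planeCurve (hL : 0 < L) (hq : q ∈ classA L) (hf : ∀ t, HasDerivAt f (f' t) t)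
    (hf' : Continuous f') (hf0 : f 0 = 0) (hφ : ∀ t : Icc 0 L, φ t = f t)
    (hψ : ∀ t : Icc 0 L, ψ t = f' t) (k j : Fin 3) :
    ∀ᵐ t ∂(volume.restrict (Ioo 0 L)),
      frameVar q (planeQuot n q φ ψ hL.le 0) k j t =
        2 * planeGen n k j * f t ∧
      frameVarDeriv q (planeQuot n q φ ψ hL.le 0) k j t =
        2 * planeGen n k j * f' t := by
  have hq' : ∀ᵐ t ∂(volume.restrict (Ioo 0 L)), rot q t ∈ SO3 := hq
  have h1 := column_planeQuot_ae (q := q) (n := n) hL hf hf' hf0 hφ hψ 0 j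
  have h2 := column_planeQuot_deriv_ae (q := q) (n := n) hL.le hφ hψ 0 j
  filter_upwards [hq', h1, h2, curv_skew hL hq] with t h0 h1 h2 hA
  have hu : ∀ i, inner ℝ ((column L k q).1.1 t) ((column L i q).1.1 t) =
      if k = i then (1 : ℝ) else 0 := inner_column_column h0 k
  have hA' : ∀ i, inner ℝ ((column L k q).1.2 t) ((column L i q).1.1 t) =
      - inner ℝ ((column L k q).1.1 t) ((column L i q).1.2 t) := by
    intro i
    have e1 := curv_apply q t k i
    have e2 := curv_apply q t i k
    have e3 := real_inner_comm ((column L k q).1.2 t) ((column L i q).1.1 t)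
    have e4 := hA k i
    linarith
  constructor
  · refine ((congrArg (inner ℝ ((column L k q).1.1 t)) h1).trans
      (inner_sum_smul_orthonormal (u := fun i => (column L i q).1.1 t) hu _)).trans ?_
    exact rotFun_zero n k j (f t)
  · refine (congrArg₂ (· + ·) (congrArg (inner ℝ ((column L k q).1.2 t)) h1)
      (congrArg (inner ℝ ((column L k q).1.1 t)) h2)).trans
      ((inner_sum_smul_orthonormal_deriv (u := fun i => (column L i q).1.1 t)
        (v := fun i => (column L i q).1.2 t) hu hA' _ _).trans ?_)
    rw [rotFunDeriv_zero]

end PlaneCurve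

end Rod

namespace Rod

/-! ### Necessity of the Euler–Lagrange system -/

section Necessity

variable {S : Set E2} {W : M3 → ℝ≥0∞} {L : ℝ} {g : ℝ → E3} {q : Config L} {α : ℝ → W12S S}

/-- A weak equation `∫ (p f' + r f) = 0`, tested with all smooth `f` such that `f(0) = 0`. -/
lemma solvesWithZeroEnd_of_forall (hL : 0 < L) {p r : ℝ → ℝ} (hp : IntegrableOn p (Ioo 0 L))
    (hr : IntegrableOn r (Ioo 0 L)) (h : ∀ f : ℝ → ℝ, ContDiff ℝ ∞ f → f 0 = 0 →
      ∫ t in Ioo 0 L, (p t * deriv f t + r t * f t) = 0) : SolvesWithZeroEnd L p r := by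
  have hw : HasWeakDeriv (Ioo 0 L) (1 : ℝ) p r := by
    intro f hf hs ht
    have hf0 : f 0 = 0 := image_eq_zero_of_notMem_tsupport fun h0 => lt_irrefl _ (ht h0).1
    have h1 := h f hf hf0
    have h2 : Integrable (fun t => f t • r t) (volume.restrict (Ioo 0 L)) := by
      obtain ⟨C, hC⟩ := hf.continuous.bounded_above_of_compact_support hs
      exact Integrable.bdd_smul (C := C) hr hf.continuous.aestronglyMeasurable
        (Filter.Eventually.of_forall hC)
    have h3 : Integrable (fun t => fderiv ℝ f t 1 • p t) (volume.restrict (Ioo 0 L)) := by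
      obtain ⟨C, hC⟩ := ((hf.continuous_fderiv (by simp)).clm_apply
        (continuous_const (y := (1 : ℝ)))).bounded_above_of_compact_support (hs.fderiv_apply ℝ 1)
      exact Integrable.bdd_smul (C := C) hp ((hf.continuous_fderiv (by simp)).clm_apply
        continuous_const).aestronglyMeasurable (Filter.Eventually.of_forall hC)
    rw [eq_neg_iff_add_eq_zero, ← integral_add h3 h2]
    refine (integral_congr_ae (Filter.Eventually.of_forall fun t => ?_)).trans h1
    simp only [smul_eq_mul, fderiv_apply_one_eq_deriv]
    ring
  obtain ⟨c, hc, hpc⟩ := hw.exists_isPrim_real hL hp hr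
  refine ⟨hp, hr, hw, c, hc.continuousOn, hpc, ?_⟩
  -- The identity vanishes at `0` but not at `L`; as a test function it yields `c L * L = 0`, the
  -- natural boundary condition.
  have h1 := hc.integral_mul (isPrim_of_contDiff (φ := id) contDiff_id) hL.le
  have h2 : ∫ t in Ioo 0 L, (p t * deriv id t + r t * id t) = c L * L - c 0 * 0 := by
    refine (integral_congr_ae ?_).trans h1
    filter_upwards [hpc] with t ht
    rw [ht]
    ring
  rw [h id contDiff_id rfl, mul_zero, sub_zero] at h2
  exact (mul_eq_zero.1 h2.symm).resolve_right hL.ne'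

lemma weakResidual_eq_of_ae {η : Config L} {p r f f' : ℝ → ℝ} {k j : Fin 3} {a : ℝ} {P : Prop}
    [Decidable P] (ha : a = if P then 1 else 0)
    (h : ∀ᵐ t ∂(volume.restrict (Ioo 0 L)), frameVar q η k j t = 2 * a * f t ∧
      frameVarDeriv q η k j t = 2 * a * f' t) :
    weakResidual q η p r k j =
      if P then 2 * ∫ t in Ioo 0 L, (p t * f' t + r t * f t) else 0 := by
  have h1 : weakResidual q η p r k j =
      ∫ t in Ioo 0 L, (2 * a) * (p t * f' t + r t * f t) := by
    refine integral_congr_ae ?_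
    filter_upwards [h] with t ht
    rw [ht.1, ht.2]
    ring
  rw [h1, integral_const_mul, ha]
  split_ifs <;> simp

/-- The Euler–Lagrange system is necessary for stationarity. -/
theorem solves_of_isStationaryPoint (hL : 0 < L) (hS : IsCrossSection S) (hW : IsEnergyDensity W)
    (hg : MemLp g 2 (volume.restrict (Ioo 0 L))) (hq : q ∈ classA L) (hq0 : IsClamped q)
    (hα : ∀ᵐ t ∂(volume.restrict (Ioo 0 L)), IsWarping W (curv q t) (α t))
    (h : IsStationaryPoint S W g q) (n : Fin 3) :
    SolvesWithZeroEnd L (elMoment (momentTilde W q α) (momentHat W q α) n)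
      (elRhs (curv q) (momentTilde W q α) (momentHat W q α)
        (fun t => (rot q t)ᵀ *ᵥ (primitive L g t).ofLp) n) := by
  refine solvesWithZeroEnd_of_forall hL ((memLp_elMoment hL hS hW hα n).integrable one_le_two)
    (integrable_elRhs hL hS hW (hg.integrable one_le_two) hα n) fun f hf hf0 => ?_
  obtain ⟨φ, hφ⟩ : ∃ φ : C(Icc 0 L, ℝ), ∀ t : Icc 0 L, φ t = f t :=
    ⟨⟨fun t => f t, hf.continuous.comp continuous_subtype_val⟩, fun _ => rfl⟩
  have hf' : Continuous (deriv f) := hf.continuous_deriv (by simp)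
  obtain ⟨ψ, hψ⟩ : ∃ ψ : C(Icc 0 L, ℝ), ∀ t : Icc 0 L, ψ t = deriv f t :=
    ⟨⟨fun t => deriv f t, hf'.comp continuous_subtype_val⟩, fun _ => rfl⟩
  have hfd : ∀ t, HasDerivAt f (deriv f t) t := fun t =>
    (hf.differentiable (by simp) t).hasDerivAt
  have hA : ∀ ε ∈ Icc (0 : ℝ) 1, planeCurve n q φ ψ hL.le ε ∈ classA L ∧
      IsClamped (planeCurve n q φ ψ hL.le ε) := fun ε _ =>
    ⟨planeCurve_mem_classA hL hq hfd hf' hf0 hφ hψ ε, isClamped_planeCurve hL.le hq0 ε⟩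
  have h1 := h _ (contDiff_planeCurve hL.le).contDiffOn hA (planeCurve_zero hL.le)
  have h2 := (hasDerivWithinAt_J2_admissible hL hS hW hg hα
    (hasDerivWithinAt_planeCurve hL.le _) (planeCurve_zero hL.le) hA).2
  have h3 := (uniqueDiffOn_Icc zero_lt_one 0 (by simp)).eq_deriv _ h2 h1
  have h4 : ∀ m, weakResidual q (planeQuot n q φ ψ hL.le 0)
      (elMoment (momentTilde W q α) (momentHat W q α) m)
      (elRhs (curv q) (momentTilde W q α) (momentHat W q α)
        (fun t => (rot q t)ᵀ *ᵥ (primitive L g t).ofLp) m) (![0, 0, 1] m) (![1, 2, 2] m) =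
      if n = m then 2 * ∫ t in Ioo 0 L,
        (elMoment (momentTilde W q α) (momentHat W q α) m t * deriv f t +
        elRhs (curv q) (momentTilde W q α) (momentHat W q α)
          (fun t => (rot q t)ᵀ *ᵥ (primitive L g t).ofLp) m t * f t) else 0 := by
    intro m
    exact weakResidual_eq_of_ae (planeGen_apply n m)
      (frameVar_planeCurve hL hq hfd hf' hf0 hφ hψ (![0, 0, 1] m) (![1, 2, 2] m))
  -- Only the equation of the rotated plane survives in the sum.
  rw [Finset.sum_congr rfl fun m _ => h4 m, Finset.sum_ite_eq, if_pos (Finset.mem_univ n)] at h3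
  exact (mul_eq_zero.1 h3).resolve_left two_ne_zero

end Necessity

end Rod

open Rod
theorem lemma2p2 (L : ℝ) (hL : 0 < L) (S : Set E2) (hS : IsCrossSection S)
    (W : M3 → ENNReal) (hW : IsEnergyDensity W)
    (g : ℝ → E3) (hg : MemLp g 2 (volume.restrict (Ioo 0 L)))
    (q : Config L) (hq : q ∈ classA L) (hq0 : IsClamped q)
    (α : ℝ → W12S S)
    (hα : ∀ᵐ t ∂(volume.restrict (Ioo 0 L)), IsWarping W (curv q t) (α t)) :
    IsStationaryPoint S W g q ↔
      EulerLagrangeSystem L (curv q) (momentTilde W q α) (momentHat W q α)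
        (fun t => (rot q t)ᵀ *ᵥ (primitive L g t).ofLp) := by
  rw [eulerLagrangeSystem_iff]
  exact ⟨solves_of_isStationaryPoint hL hS hW hg hq hq0 hα,
    isStationaryPoint_of_solves hL hS hW hg hα⟩
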